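/- **Setting.** Let $\Omega=[0,2\pi]$, $T>0$, let $\alpha$ be a smooth $2\pi$-periodic function that has at least one zero, all of whose zeros have finite order, and let $m\ge 1$ be the largest of these orders (so a single zero of order $m$ in a period is included). Let $g$ be smooth on $\Omega\times[0,T]$, and let $u$, with $\sup_{\tau\in[0,T]}\|u(\cdot,\tau)\|_{k+3,\infty}<\infty$, solve $$u_t+(\alpha u)_x=g\ \text{ on } \Omega\times[0,T],\qquad u(0,t)=u(2\pi,t),\qquad u(\cdot,0)=u_0 .$$ Here $\|\cdot\|_{n,\infty}$ is the norm of $W^{n,\infty}(0,2\pi)$, and we write $\|u\|_{k+3,\infty}=\sup_{\tau\in[0,T]}\|u(\cdot,\tau)\|_{k+3,\infty}$. **Scheme.** Let $0=x_{1/2}<x_{3/2}<\dots<x_{N+1/2}=2\pi$, $V_i=[x_{i-1/2},x_{i+1/2}]$, $h_i=|V_i|$, $h=\max_i h_i$, with $h\le\rho h_i$ for all $i$. Let $k\ge1$, let $V_h$ be the space of piecewise polynomials of degree at most $k$, and let $x_{i,j}$ be the image in $V_i$ of $s_j$, where $-1=s_0<s_1<\dots<s_{k+1}=1$ (the choice may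 depend on $i$). With $L_n$ the Legendre polynomials, one of the following two choices is made. * LSV: $s_1,\dots,s_k$ are the zeros of $L_k$. * RSV: $s_1,\dots,s_{k+1}$ are the zeros of $L_{k+1}-L_k$ (right Radau points) if $\alpha>0$ at both ends of $V_i$; $s_0,\dots,s_k$ are the zeros of $L_{k+1}+L_k$ (left Radau points) if $\alpha<0$ at both ends; otherwise either of the two. For $v\in V_h$ the upwind value $\hat v$ at $x_{i+1/2}$ is the left limit $v^-$ if $\alpha(x_{i+1/2})>0$ and the right limit $v^+$ if $\alpha(x_{i+1/2})\le0$ (with periodic continuation); at interior points of elements $\hat v=v$. The SV solution $u_h(\cdot,t)\in V_h$ satisfies $u_h(\cdot,0)=I_hu_0$ and, for $t\in[0,T]$, all $i$ and $0\le j\le k$, $$\int_{x_{i,j}}^{x_{i,j+1}}(u_h)_t\,dx+(\alpha\hat u_h)(x_{i,j+1})-(\alpha\hat u_h)(x_{i,j})=\int_{x_{i,j}}^{x_{i,j+1}}g\,dx .$$ On $V_i$, $I_h\phi$ is the polynomial of degree at most $k$ that interpolates $\phi$ at the nodes $\{y_{i,j}\}_{j=1}^{k+1}$, which are all the points $x_{i,0},\dots,x_{i,k+1}$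 except $x_{i,0}$ if $\alpha(x_{i-1/2})\ge0$ and $\alpha(x_{i+1/2})>0$; except $x_{i,k+1}$ if $\alpha(x_{i-1/2})\le0$ and $\alpha(x_{i+1/2})<0$; except $x_{i,k}$ otherwise. Let $\{z_{i,j}\}_{j=1}^k$ be the roots of $\partial_x\prod_{j=1}^{k+1}(x-y_{i,j})$. **Theorem 5.3.** Consider RSV with $k\ge1$ or LSV with $k\ge2$. Set $m'=\min\{m,k+3\}$ if $m\le k+3$ or $g\equiv0$, and $m'=m$ otherwise. There is a constant $C>0$, depending only on $k,\alpha,g,T,\rho$ (not on the mesh, nor on $u$), such that for all $t\in[0,T]$ $$e_u:=\|u_h-I_hu\|_{L^2(0,2\pi)}\le C\,h^{k+1+\frac1{2m'}}\|u\|_{k+3,\infty},$$ $$e_{u,n}+e_{u,c}+e_{u,r}\le C\,h^{k+1+\frac1{2m'}}\|u\|_{k+3,\infty},\qquad e_{u,l}\le C\,h^{k+\frac1{2m'}}\|u\|_{k+3,\infty},$$ where $$e_{u,n}^2=\frac1N\sum_{i=1}^N(u-\hat u_h)^2(x_{i+\frac12}),\qquad e_{u,c}^2=\frac1N\sum_{i=1}^N\Big(\frac1{h_i}\int_{V_i}(u-u_h)\,dx\Big)^2,$$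 $$e_{u,r}^2=\frac1N\sum_{i=1}^N\sum_{j=1}^{k+1}(u-u_h)^2(y_{i,j}),\qquad e_{u,l}^2=\frac1N\sum_{i=1}^N\sum_{j=1}^{k}(\partial_xu-\partial_xu_h)^2(z_{i,j}),$$ and values of $u_h$ at points of $V_i$ in $e_{u,r}$ and $e_{u,l}$ are those of its polynomial on $V_i$. In particular, if all zeros of $\alpha$ are simple, then $m'=1$ and the first two rates are $h^{k+3/2}$. -/

import Mathlib

open Set MeasureTheory Polynomial
open scoped ContDiff ENNReal

noncomputable section

namespace SpectralVolume

/-! ### Sobolev norms on `Ω = (0, 2π)` -/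

/-- Lebesgue measure on the open interval `(0, 2π)`. -/
def domainMeasure : Measure ℝ := volume.restrict (Ioo 0 (2 * Real.pi))

/-- `w` is a weak derivative of order `j` of `v` on `(0, 2π)`. -/
def IsWeakDeriv (j : ℕ) (v w : ℝ → ℝ) : Prop :=
  ∀ φ : ℝ → ℝ, ContDiff ℝ ∞ φ → HasCompactSupport φ →
    tsupport φ ⊆ Ioo 0 (2 * Real.pi) →
      ∫ x, v x * iteratedDeriv j φ x ∂domainMeasure
        = (-1) ^ j * ∫ x, w x * φ x ∂domainMeasure

/-- The families `v = D 0, D 1, …, D n` of essentially bounded weak derivatives of `v`. -/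
def weakJets (n : ℕ) (v : ℝ → ℝ) : Set (ℕ → ℝ → ℝ) :=
  {D | D 0 = v ∧ ∀ j ≤ n, MemLp (D j) ⊤ domainMeasure ∧ IsWeakDeriv j v (D j)}

/-- The `W^{n,∞}(0, 2π)` norm of `v`, the largest of the `L^∞` norms of the weak derivatives of
order at most `n`.  These are unique almost everywhere, so the infimum is over one value; it is
`⊤` exactly when `v` is not in `W^{n,∞}`. -/
def sobolevNorm (n : ℕ) (v : ℝ → ℝ) : ℝ≥0∞ :=
  ⨅ D ∈ weakJets n v, (Finset.range (n + 1)).sup fun j => eLpNorm (D j) ⊤ domainMeasure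

/-- The supremum over `t ∈ [0, T]` of the `W^{n,∞}(0, 2π)` norm of `u(·, t)`
(time is the first argument of `u`). -/
def sobolevNormOn (n : ℕ) (T : ℝ) (u : ℝ → ℝ → ℝ) : ℝ≥0∞ :=
  ⨆ t ∈ Icc 0 T, sobolevNorm n (u t)

/-! ### The continuous problem -/

/-- The first nonvanishing derivative of `α` at `z` is the one of order `j`. -/
def HasZeroOfOrder (α : ℝ → ℝ) (z : ℝ) (j : ℕ) : Prop :=
  (∀ l < j, iteratedDeriv l α z = 0) ∧ iteratedDeriv j α z ≠ 0

/-- `α` vanishes somewhere, all its zeros have finite order, and the largest order is `m`. -/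
structure HasMaxZeroOrder (α : ℝ → ℝ) (m : ℕ) : Prop where
  pos : 1 ≤ m
  attained : ∃ z, HasZeroOfOrder α z m
  le : ∀ z, α z = 0 → ∃ j ≤ m, HasZeroOfOrder α z j

/-- `u` solves `u_t + (α u)_x = g` on `[0, 2π] × [0, T]` with periodic boundary condition and
belongs to `W^{n,∞}`; `u t x` is the value at time `t` and position `x`. -/
structure IsSolution (α : ℝ → ℝ) (g : ℝ → ℝ → ℝ) (T : ℝ) (n : ℕ) (u : ℝ → ℝ → ℝ) : Prop where
  continuousOn : ∀ t ∈ Icc 0 T, ContinuousOn (u t) (Icc 0 (2 * Real.pi))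
  regular : sobolevNormOn n T u < ⊤
  periodic : ∀ t ∈ Icc 0 T, u t 0 = u t (2 * Real.pi)
  differentiable_time : ∀ t ∈ Icc 0 T, ∀ x ∈ Icc 0 (2 * Real.pi),
    DifferentiableWithinAt ℝ (fun τ => u τ x) (Icc 0 T) t
  differentiable_space : ∀ t ∈ Icc 0 T, ∀ x ∈ Icc 0 (2 * Real.pi),
    DifferentiableWithinAt ℝ (fun y => α y * u t y) (Icc 0 (2 * Real.pi)) x
  equation : ∀ t ∈ Icc 0 T, ∀ x ∈ Icc 0 (2 * Real.pi),
    derivWithin (fun τ => u τ x) (Icc 0 T) t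
      + derivWithin (fun y => α y * u t y) (Icc 0 (2 * Real.pi)) x = g t x

/-! ### Meshes and control volumes -/

/-- A partition of `[0, 2π]` into `N` elements. -/
structure Mesh (N : ℕ) where
  node : Fin (N + 1) → ℝ
  strictMono : StrictMono node
  first : node 0 = 0
  last : node (Fin.last N) = 2 * Real.pi

namespace Mesh

variable {N : ℕ} (M : Mesh N)

/-- Left end point of the `i`-th element. -/
def left (i : Fin N) : ℝ := M.node i.castSucc

/-- Right end point of the `i`-th element. -/
def right (i : Fin N) : ℝ := M.node i.succ

/-- Length `h_i` of the `i`-th element. -/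
def len (i : Fin N) : ℝ := M.right i - M.left i

/-- The mesh size `h = max_i h_i`. -/
def size : ℝ := ⨆ i, M.len i

/-- Shape regularity `h ≤ ρ h_i`. -/
def IsRegular (ρ : ℝ) : Prop := ∀ i, M.size ≤ ρ * M.len i

/-- The affine image in the `i`-th element of a point `σ` of the reference element `[-1, 1]`. -/
def toElement (i : Fin N) (σ : ℝ) : ℝ := M.len i / 2 * σ + (M.left i + M.right i) / 2

end Mesh

/-- The Legendre polynomial `L_n` on `[-1, 1]` (Rodrigues' formula). -/
def legendre (n : ℕ) : ℝ[X] :=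
  C (1 / (2 ^ n * (n.factorial : ℝ))) * derivative^[n] ((X ^ 2 - 1) ^ n)

/-- `-1 = s_0 < s_1 < ⋯ < s_{k+1} = 1`. -/
structure IsPartition {k : ℕ} (s : Fin (k + 2) → ℝ) : Prop where
  strictMono : StrictMono s
  first : s 0 = -1
  last : s (Fin.last (k + 1)) = 1

/-- The interior points `s_1, …, s_k` are Gauss-Legendre points. -/
def IsGauss {k : ℕ} (s : Fin (k + 2) → ℝ) : Prop :=
  IsPartition s ∧ ∀ j, j ≠ 0 → j ≠ Fin.last (k + 1) → (legendre k).eval (s j) = 0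

/-- `s_1, …, s_{k+1}` are right Radau points. -/
def IsRightRadau {k : ℕ} (s : Fin (k + 2) → ℝ) : Prop :=
  IsPartition s ∧ ∀ j, j ≠ 0 → (legendre (k + 1) - legendre k).eval (s j) = 0

/-- `s_0, …, s_k` are left Radau points. -/
def IsLeftRadau {k : ℕ} (s : Fin (k + 2) → ℝ) : Prop :=
  IsPartition s ∧ ∀ j, j ≠ Fin.last (k + 1) → (legendre (k + 1) + legendre k).eval (s j) = 0

section Scheme

variable {N k : ℕ} (α : ℝ → ℝ) (M : Mesh N)

/-- The choice of partition points `s i` in each element `i` for the Gauss-Legendre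
spectral volume method. -/
def IsLSV (s : Fin N → Fin (k + 2) → ℝ) : Prop := ∀ i, IsGauss (s i)

/-- The choice of partition points `s i` in each element `i` for the Radau
spectral volume method. -/
def IsRSV (s : Fin N → Fin (k + 2) → ℝ) : Prop :=
  ∀ i, (0 < α (M.left i) → 0 < α (M.right i) → IsRightRadau (s i)) ∧
    (α (M.left i) < 0 → α (M.right i) < 0 → IsLeftRadau (s i)) ∧
    (IsLeftRadau (s i) ∨ IsRightRadau (s i))

/-- The points `x_{i,j}`, `0 ≤ j ≤ k + 1`. -/
def point (s : Fin N → Fin (k + 2) → ℝ) (i : Fin N) (j : Fin (k + 2)) : ℝ :=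
  M.toElement i (s i j)

/-- The upwind value `v̂` at the right end of the `i`-th element.  A piecewise polynomial
`v` is given by its polynomials on the elements; `i + 1` is cyclic (periodic boundary condition). -/
def upwind [NeZero N] (v : Fin N → ℝ[X]) (i : Fin N) : ℝ :=
  if 0 < α (M.right i) then (v i).eval (M.right i) else (v (i + 1)).eval (M.left (i + 1))

/-- The value `v̂` at `x_{i,j}`: the upwind value at the ends of the element, the point value
in its interior. -/
def fluxValue [NeZero N] (s : Fin N → Fin (k + 2) → ℝ) (v : Fin N → ℝ[X]) (i : Fin N)
    (j : Fin (k + 2)) : ℝ :=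
  if j = 0 then upwind α M v (i - 1)
  else if j = Fin.last (k + 1) then upwind α M v i
  else (v i).eval (point M s i j)

/-- The index in `{0, …, k + 1}` of the one point `x_{i,j}` that is not an interpolation node
of `I_h` in the `i`-th element: `0` for `I_h^-`, `k + 1` for `I_h^+`, and `k` for `I_h^±`. -/
def omitted (k : ℕ) (i : Fin N) : Fin (k + 2) :=
  open Classical in
  if 0 ≤ α (M.left i) ∧ 0 < α (M.right i) then 0
  else if α (M.left i) ≤ 0 ∧ α (M.right i) < 0 then Fin.last (k + 1)
  else (Fin.last k).castSucc

/-- The interpolation nodes `y_{i,j}`, `1 ≤ j ≤ k + 1`, in increasing order. -/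
def interpNode (s : Fin N → Fin (k + 2) → ℝ) (i : Fin N) (j : Fin (k + 1)) : ℝ :=
  point M s i ((omitted α M k i).succAbove j)

/-- The interpolant `I_h φ`. -/
def interp (s : Fin N → Fin (k + 2) → ℝ) (φ : ℝ → ℝ) (i : Fin N) : ℝ[X] :=
  Lagrange.interpolate Finset.univ (interpNode α M s i) fun j => φ (interpNode α M s i j)

/-- The roots `z_{i,j}`, `1 ≤ j ≤ k`, of `∂_x ∏_j (x - y_{i,j})`. -/
def criticalPoints (s : Fin N → Fin (k + 2) → ℝ) (i : Fin N) : Finset ℝ :=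
  (derivative (∏ j, (X - C (interpNode α M s i j)))).roots.toFinset

/-- `uh` is the solution on `[0, T]` of the semidiscrete spectral volume scheme with initial value
`I_h u_0`: a differentiable curve in the space of piecewise polynomials of degree at most `k`
that satisfies the conservation law in every control volume `[x_{i,j}, x_{i,j+1}]`. -/
structure IsSVSolution [NeZero N] (g : ℝ → ℝ → ℝ) (T : ℝ) (s : Fin N → Fin (k + 2) → ℝ)
    (u₀ : ℝ → ℝ) (uh : ℝ → Fin N → ℝ[X]) : Prop where
  degree : ∀ t ∈ Icc 0 T, ∀ i, (uh t i).natDegree ≤ k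
  differentiable : ∀ i n, DifferentiableOn ℝ (fun t => (uh t i).coeff n) (Icc 0 T)
  initial : uh 0 = interp α M s u₀
  conservation : ∀ t ∈ Icc 0 T, ∀ i, ∀ j : Fin (k + 1),
    (∫ x in (point M s i j.castSucc)..(point M s i j.succ),
        derivWithin (fun τ => (uh τ i).eval x) (Icc 0 T) t)
      + α (point M s i j.succ) * fluxValue α M s (uh t) i j.succ
      - α (point M s i j.castSucc) * fluxValue α M s (uh t) i j.castSucc
    = ∫ x in (point M s i j.castSucc)..(point M s i j.succ), g t x

/-! ### The errors, for `v = u_h(·, t)` and `φ = u(·, t)` -/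

/-- `‖v - I_h φ‖_0`. -/
def errInterp (s : Fin N → Fin (k + 2) → ℝ) (v : Fin N → ℝ[X]) (φ : ℝ → ℝ) : ℝ :=
  √(∑ i, ∫ x in (M.left i)..(M.right i), ((v i).eval x - (interp α M s φ i).eval x) ^ 2)

/-- Error of the upwind values at the element boundaries. -/
def errUpwind [NeZero N] (v : Fin N → ℝ[X]) (φ : ℝ → ℝ) : ℝ :=
  √(1 / N * ∑ i, (φ (M.right i) - upwind α M v i) ^ 2)

/-- Error of the cell averages. -/
def errAverage (v : Fin N → ℝ[X]) (φ : ℝ → ℝ) : ℝ :=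
  √(1 / N * ∑ i,
    (1 / M.len i * ∫ x in (M.left i)..(M.right i), (φ x - (v i).eval x)) ^ 2)

/-- Error at the interpolation nodes. -/
def errNodes (s : Fin N → Fin (k + 2) → ℝ) (v : Fin N → ℝ[X]) (φ : ℝ → ℝ) : ℝ :=
  √(1 / N * ∑ i, ∑ j, (φ (interpNode α M s i j) - (v i).eval (interpNode α M s i j)) ^ 2)

/-- Error of the derivative at the points `z_{i,j}`. -/
def errDeriv (s : Fin N → Fin (k + 2) → ℝ) (v : Fin N → ℝ[X]) (φ : ℝ → ℝ) : ℝ :=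
  √(1 / N * ∑ i, ∑ z ∈ criticalPoints α M s i, (deriv φ z - (derivative (v i)).eval z) ^ 2)

end Scheme

end SpectralVolume

end

/-!
Write `h` for the mesh size.  On a fixed mesh the scheme is a linear system of ordinary differential
equations, and the error `u_h - I_h u` is estimated as "stability times consistency"; the point is
that the consistency error is of order `h ^ (k + 2)` away from the zeros of `α`, one order more than
interpolation gives, and loses accuracy only near these zeros.

*Stability.*  Pulled back to `[-1, 1]`, the control volume equations of an element say that the
primitives of `∂_t u_h` are balanced by the polynomial that interpolates the fluxes at the partition
points.  They are tested with `u_h` in the form `energyForm κ`, for which the fluxes of the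
derivatives of the Lagrange basis reproduce the end values (`LeftExact`, `RightExact`).  Legendre
orthogonality gives this with `κ = 0` at the inflow end for Radau points, and at both ends for Gauss
points with the positive `gaussCoeff`, which makes up for the inexactness of the Gauss rule.
The upwind values then give the interface terms the right sign (`sum_energy_le`), and Gronwall's
inequality yields `sum_l2norm_sq_le`.

*Consistency.*  Up to `O(h ^ (k + 2))` the interpolation error of `u_t = g - (α u)_x` on an element
is a number times the nodal polynomial of the interpolation nodes
(`abs_sub_refInterp_sub_defect_le`).  By Leibniz' rule the number is of the order
`q h ^ (k + 1)`, where `q = derivSize α γ k` is the size of the derivatives of `α` of order at most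
`k + 2`, plus `γ` for the source.  Where `α` has no zero the nodal polynomial has mean zero
(`IsSuperconvergent.polyInt_nodalOmit`), so its integrals over the control volumes are differences
of the fluxes of a piecewise polynomial with vanishing upwind values, the `corrector`.  Subtracting
it removes the leading term at the price of a function smaller by the factor `h / |α|`
(`abs_eval_corrector_le`).  Its coefficient is computed from point values of `g` and `α u`, so that
one time derivative of it needs no more regularity than the solution has.

*Degeneracy.*  The squared loss is therefore at most the integral of `q² h² / (α² + h²)`, together
with the total length `O(h)` of the elements that contain a zero.  At a zero of order
`j ≤ m'` the integral is of the order `h ^ (1 / j)`, since `|α| < h` on a set of that size.  A zero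
of order `j > m'` occurs only for `g ≡ 0`, when `γ = 0`, `m' = k + 3` and `q` itself vanishes at the
zero, so fast that the integrand is `O(h ^ (1 / (k + 3)))` (`exists_weight_bound_and_finite_zeros`).
A source `g ≠ 0` is not bounded by a multiple of the norm of `u` that is independent of `g`, but it
forces a positive lower bound on the norm of every solution (`exists_pos_le_of_source_ne_zero`), so
that its size is absorbed into the constant.

*Special points.*  At the interpolation nodes `I_h u` is exact.  The leading term of `u - I_h u` is
a multiple of the nodal polynomial, so this error gains an order in the derivative at the critical
points of that polynomial, and in the mean over the elements without a zero of `α`.  The remaining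
part of the error is `u_h - I_h u`, estimated pointwise by norm equivalence.
-/

noncomputable section

namespace SpectralVolume

/-! ### Functions with vanishing weak derivative -/

/-- The lemma of du Bois-Reymond. -/
theorem ae_eq_const_of_integral_mul_deriv_eq_zero {a b : ℝ} (hab : a < b) {F : ℝ → ℝ}
    (hF : IntegrableOn F (Ioo a b))
    (h : ∀ φ : ℝ → ℝ, ContDiff ℝ ∞ φ → HasCompactSupport φ → tsupport φ ⊆ Ioo a b →
      ∫ x in Ioo a b, F x * deriv φ x = 0) :
    ∃ c, ∀ᵐ x ∂volume.restrict (Ioo a b), F x = c := by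
  obtain ⟨ψ, hψs, hψc, hψd, hψr, hψ1⟩ := exists_contDiff_tsupport_subset (n := ⊤)
    (Ioo_mem_nhds (show a < (a + b) / 2 by linarith) (show (a + b) / 2 < b by linarith))
  have hψpos : 0 < ∫ x, ψ x := by
    refine hψd.continuous.integral_pos_of_hasCompactSupport_nonneg_nonzero hψc
      (fun x => (hψr (mem_range_self x)).1) (x := (a + b) / 2) ?_
    rw [hψ1]; exact one_ne_zero
  set I₀ := ∫ x, ψ x with hI₀
  -- a test function with vanishing integral is the derivative of a test function
  have key : ∀ η : ℝ → ℝ, ContDiff ℝ ∞ η → HasCompactSupport η → tsupport η ⊆ Ioo a b →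
      ∫ x, η x = 0 → ∫ x in Ioo a b, F x * η x = 0 := by
    intro η hη hηc hηs hη0
    have hK : IsCompact (tsupport η ∪ {(a + b) / 2}) := hηc.isCompact.union isCompact_singleton
    obtain ⟨c, hcm, hc⟩ := hK.exists_isLeast ⟨_, Or.inr rfl⟩
    obtain ⟨d, hdm, hd⟩ := hK.exists_isGreatest ⟨_, Or.inr rfl⟩
    have hsub : tsupport η ∪ {(a + b) / 2} ⊆ Ioo a b := by
      rintro x (hx | rfl)
      · exact hηs hx
      · constructor <;> linarith
    have hzero : ∀ x, x ∉ Icc c d → η x = 0 := by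
      intro x hx
      by_contra hne
      have : x ∈ tsupport η := subset_tsupport _ hne
      exact hx ⟨hc (Or.inl this), hd (Or.inl this)⟩
    set φ : ℝ → ℝ := fun x => ∫ y in a..x, η y with hφ
    have hder : ∀ x, HasDerivAt φ (η x) x := fun x =>
      intervalIntegral.integral_hasDerivAt_right (hη.continuous.intervalIntegrable _ _)
        (hη.continuous.stronglyMeasurableAtFilter _ _) hη.continuous.continuousAt
    have hderiv : deriv φ = η := funext fun x => (hder x).deriv
    have hφd : ContDiff ℝ ∞ φ := by
      rw [contDiff_infty_iff_deriv]
      exact ⟨fun x => (hder x).differentiableAt, by rwa [hderiv]⟩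
    have hφz : ∀ x, x ∉ Icc c d → φ x = 0 := by
      intro x hx
      rw [mem_Icc, not_and_or, not_le, not_le] at hx
      rcases hx with hx | hx
      · simp only [hφ]
        rw [intervalIntegral.integral_congr (g := fun _ => (0 : ℝ))]
        · simp
        · intro y hy
          apply hzero
          have h1 : a < c := (hsub hcm).1
          have := hy.2
          intro hy'
          have h3 : max a x < c := max_lt h1 hx
          exact absurd hy'.1 (not_le.2 (lt_of_le_of_lt this h3))
      · have h1 : ∫ y, η y = ∫ y in Ioc a x, η y := by
          rw [setIntegral_eq_integral_of_forall_compl_eq_zero]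
          intro y hy
          apply hzero
          intro hy'
          exact hy ⟨lt_of_lt_of_le (hsub hcm).1 hy'.1, hy'.2.trans hx.le⟩
        simp only [hφ]
        rw [intervalIntegral.integral_of_le ((hsub hdm).1.le.trans hx.le), ← h1, hη0]
    have hts : tsupport φ ⊆ Icc c d := by
      apply closure_minimal _ isClosed_Icc
      intro x hx
      by_contra hn
      exact hx (hφz x hn)
    have hIcc : Icc c d ⊆ Ioo a b := fun x hx =>
      ⟨lt_of_lt_of_le (hsub hcm).1 hx.1, lt_of_le_of_lt hx.2 (hsub hdm).2⟩
    have := h φ hφd (isCompact_Icc.of_isClosed_subset (isClosed_tsupport _) hts)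
      (hts.trans hIcc)
    rwa [hderiv] at this
  have hψi : ∫ x in Ioo a b, ψ x = I₀ :=
    setIntegral_eq_integral_of_forall_compl_eq_zero fun y hy => by
      by_contra hne
      exact hy (hψs (subset_tsupport _ hne))
  have hint : ∀ η : ℝ → ℝ, ContDiff ℝ ∞ η → HasCompactSupport η →
      IntegrableOn (fun x => F x * η x) (Ioo a b) := by
    intro η hη hηc
    obtain ⟨B, hB⟩ := hηc.exists_bound_of_continuous hη.continuous
    exact hF.mul_bdd (c := B) hη.continuous.aestronglyMeasurable (ae_of_all _ hB)
  set c := (∫ x in Ioo a b, F x * ψ x) / I₀ with hc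
  refine ⟨c, ?_⟩
  have hFc : IntegrableOn (fun x => F x - c) (Ioo a b) := hF.sub (by simp)
  have := isOpen_Ioo.ae_eq_zero_of_integral_contDiff_smul_eq_zero (μ := volume)
    (f := fun x => F x - c) hFc.locallyIntegrableOn ?_
  · rw [ae_restrict_iff' measurableSet_Ioo]
    filter_upwards [this] with x hx hx'
    exact sub_eq_zero.1 (hx hx')
  · intro g hg hgc hgs
    have hgi : ∫ x in Ioo a b, g x = ∫ x, g x :=
      setIntegral_eq_integral_of_forall_compl_eq_zero fun y hy => by
        by_contra hne
        exact hy (hgs (subset_tsupport _ hne))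
    have h0 : ∫ x, g x • (F x - c) = ∫ x in Ioo a b, g x • (F x - c) := by
      rw [setIntegral_eq_integral_of_forall_compl_eq_zero]
      intro y hy
      have : g y = 0 := by
        by_contra hne
        exact hy (hgs (subset_tsupport _ hne))
      simp [this]
    set r := (∫ x, g x) / I₀ with hr
    have hk := key (fun x => g x - r * ψ x) (hg.sub (contDiff_const.mul hψd))
      (hgc.sub (hψc.mul_left)) ?_ ?_
    · have hgint := hint g hg hgc
      have hψint := hint ψ hψd hψc
      have e1 : ∫ x in Ioo a b, F x * (g x - r * ψ x)
          = (∫ x in Ioo a b, F x * g x) - r * ∫ x in Ioo a b, F x * ψ x := by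
        rw [← integral_const_mul, ← integral_sub hgint (hψint.const_mul r)]
        congr 1; ext x; ring
      have e2 : ∫ x in Ioo a b, g x • (F x - c)
          = (∫ x in Ioo a b, F x * g x) - c * ∫ x in Ioo a b, g x := by
        rw [← integral_const_mul, ← integral_sub hgint
          ((hg.continuous.integrable_of_hasCompactSupport hgc).integrableOn.const_mul c)]
        congr 1; ext x; simp only [smul_eq_mul]; ring
      rw [h0, e2, hgi, ← hk, e1, hr, hc]
      ring
    · have : tsupport (fun x => g x - r * ψ x) ⊆ tsupport g ∪ tsupport ψ := by
        apply closure_minimal _ ((isClosed_tsupport _).union (isClosed_tsupport _))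
        intro x hx
        by_contra hn
        rw [mem_union, not_or] at hn
        apply hx
        simp [image_eq_zero_of_notMem_tsupport hn.1, image_eq_zero_of_notMem_tsupport hn.2]
      exact this.trans (union_subset hgs hψs)
    · rw [integral_sub (hg.continuous.integrable_of_hasCompactSupport hgc)
        ((hψd.continuous.integrable_of_hasCompactSupport hψc).const_mul r), integral_const_mul,
        ← hI₀, hr, div_mul_cancel₀ _ hψpos.ne', sub_self]

/-! ### Jets with bounds -/

/-- `F` has `W^{n+1,∞}(S)` norm at most `Q`: the derivatives of order at most `n` exist in the
classical sense and are bounded by `Q`, and the one of order `n` is `Q`-Lipschitz. -/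
def JetBound (S : Set ℝ) : ℕ → (ℝ → ℝ) → ℝ → Prop
  | 0, F, Q => (∀ x ∈ S, |F x| ≤ Q) ∧ ∀ x ∈ S, ∀ y ∈ S, |F x - F y| ≤ Q * |x - y|
  | n + 1, F, Q => (∀ x ∈ S, |F x| ≤ Q) ∧
      ∃ F' : ℝ → ℝ, (∀ x ∈ S, HasDerivWithinAt F (F' x) S x) ∧ JetBound S n F' Q

namespace JetBound

variable {S S' : Set ℝ} {n : ℕ} {F G : ℝ → ℝ} {Q Q' : ℝ}

theorem bound (h : JetBound S n F Q) : ∀ x ∈ S, |F x| ≤ Q := by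
  cases n <;> exact h.1

theorem mono_set (hS : S' ⊆ S) (h : JetBound S n F Q) : JetBound S' n F Q := by
  induction n generalizing F with
  | zero => exact ⟨fun x hx => h.1 x (hS hx), fun x hx y hy => h.2 x (hS hx) y (hS hy)⟩
  | succ n ih =>
    obtain ⟨h1, F', h2, h3⟩ := h
    exact ⟨fun x hx => h1 x (hS hx), F', fun x hx => (h2 x (hS hx)).mono hS, ih h3⟩

theorem mono (hQ : Q ≤ Q') (h : JetBound S n F Q) : JetBound S n F Q' := by
  induction n generalizing F with
  | zero =>
    exact ⟨fun x hx => (h.1 x hx).trans hQ, fun x hx y hy =>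
      (h.2 x hx y hy).trans (mul_le_mul_of_nonneg_right hQ (abs_nonneg _))⟩
  | succ n ih =>
    obtain ⟨h1, F', h2, h3⟩ := h
    exact ⟨fun x hx => (h1 x hx).trans hQ, F', h2, ih h3⟩

theorem congr (h : JetBound S n F Q) (he : ∀ x ∈ S, G x = F x) : JetBound S n G Q := by
  cases n with
  | zero =>
    exact ⟨fun x hx => by rw [he x hx]; exact h.1 x hx, fun x hx y hy => by
      rw [he x hx, he y hy]; exact h.2 x hx y hy⟩
  | succ n =>
    obtain ⟨h1, F', h2, h3⟩ := h
    exact ⟨fun x hx => by rw [he x hx]; exact h1 x hx, F',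
      fun x hx => (h2 x hx).congr he (he x hx), h3⟩

theorem lipschitz (hS : Convex ℝ S) (h : JetBound S n F Q) :
    ∀ x ∈ S, ∀ y ∈ S, |F x - F y| ≤ Q * |x - y| := by
  cases n with
  | zero => exact h.2
  | succ n =>
    obtain ⟨h1, F', h2, h3⟩ := h
    intro x hx y hy
    exact hS.norm_image_sub_le_of_norm_hasDerivWithin_le h2 h3.bound hy hx

theorem pred (hS : Convex ℝ S) (h : JetBound S (n + 1) F Q) : JetBound S n F Q := by
  induction n generalizing F with
  | zero => exact ⟨h.bound, h.lipschitz hS⟩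
  | succ n ih =>
    obtain ⟨h1, F', h2, h3⟩ := h
    exact ⟨h1, F', h2, ih h3⟩

theorem of_le (hS : Convex ℝ S) {m : ℕ} (hmn : m ≤ n) (h : JetBound S n F Q) :
    JetBound S m F Q := by
  induction hmn with
  | refl => exact h
  | step _ ih => exact ih (h.pred hS)

theorem add (hF : JetBound S n F Q) (hG : JetBound S n G Q') :
    JetBound S n (fun x => F x + G x) (Q + Q') := by
  induction n generalizing F G with
  | zero =>
    refine ⟨fun x hx => (abs_add_le _ _).trans (add_le_add (hF.1 x hx) (hG.1 x hx)),
      fun x hx y hy => ?_⟩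
    have : F x + G x - (F y + G y) = (F x - F y) + (G x - G y) := by ring
    rw [this, add_mul]
    exact (abs_add_le _ _).trans (add_le_add (hF.2 x hx y hy) (hG.2 x hx y hy))
  | succ n ih =>
    obtain ⟨h1, F', h2, h3⟩ := hF
    obtain ⟨k1, G', k2, k3⟩ := hG
    exact ⟨fun x hx => (abs_add_le _ _).trans (add_le_add (h1 x hx) (k1 x hx)),
      fun x => F' x + G' x, fun x hx => (h2 x hx).add (k2 x hx), ih h3 k3⟩

theorem neg (hF : JetBound S n F Q) : JetBound S n (fun x => -F x) Q := by
  induction n generalizing F with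
  | zero =>
    refine ⟨fun x hx => by rw [abs_neg]; exact hF.1 x hx, fun x hx y hy => ?_⟩
    rw [neg_sub_neg, abs_sub_comm]
    exact hF.2 x hx y hy
  | succ n ih =>
    obtain ⟨h1, F', h2, h3⟩ := hF
    exact ⟨fun x hx => by rw [abs_neg]; exact h1 x hx, fun x => -F' x,
      fun x hx => (h2 x hx).neg, ih h3⟩

theorem sub (hF : JetBound S n F Q) (hG : JetBound S n G Q') :
    JetBound S n (fun x => F x - G x) (Q + Q') := by
  simpa only [sub_eq_add_neg] using hF.add hG.neg

theorem mul (hS : Convex ℝ S) (hQ : 0 ≤ Q) (hQ' : 0 ≤ Q') (hF : JetBound S n F Q)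
    (hG : JetBound S n G Q') :
    JetBound S n (fun x => F x * G x) (2 ^ (n + 1) * (Q * Q')) := by
  have hb : ∀ n : ℕ, ∀ F G : ℝ → ℝ, JetBound S n F Q → JetBound S n G Q' → ∀ x ∈ S,
      |F x * G x| ≤ 2 ^ (n + 1) * (Q * Q') := by
    intro n F G hF hG x hx
    rw [abs_mul]
    have h1 := mul_le_mul (hF.bound x hx) (hG.bound x hx) (abs_nonneg _) hQ
    have h2 : (1 : ℝ) ≤ 2 ^ (n + 1) := one_le_pow₀ (by norm_num)
    nlinarith [mul_nonneg hQ hQ']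
  induction n generalizing F G with
  | zero =>
    refine ⟨hb _ _ _ hF hG, fun x hx y hy => ?_⟩
    have : F x * G x - F y * G y = F x * (G x - G y) + (F x - F y) * G y := by ring
    rw [this]
    refine (abs_add_le _ _).trans ?_
    rw [abs_mul, abs_mul]
    have h1 := mul_le_mul (hF.bound x hx) (hG.2 x hx y hy) (abs_nonneg _) hQ
    have h2 := mul_le_mul (hF.2 x hx y hy) (hG.bound y hy) (abs_nonneg _)
      (mul_nonneg hQ (abs_nonneg _))
    exact (add_le_add h1 h2).trans (le_of_eq (by ring))
  | succ n ih =>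
    have hFn := hF.pred hS
    have hGn := hG.pred hS
    refine ⟨hb _ _ _ hF hG, ?_⟩
    obtain ⟨h1, F', h2, h3⟩ := hF
    obtain ⟨k1, G', k2, k3⟩ := hG
    refine ⟨fun x => F' x * G x + F x * G' x, fun x hx => (h2 x hx).mul (k2 x hx), ?_⟩
    exact ((ih h3 hGn).add (ih hFn k3)).mono (le_of_eq (by ring))

theorem zero (hQ : 0 ≤ Q) : JetBound S n (fun _ => 0) Q := by
  induction n with
  | zero => exact ⟨fun x _ => by simpa using hQ, fun x _ y _ => by simp; positivity⟩
  | succ n ih => exact ⟨fun x _ => by simpa using hQ, fun _ => 0,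
      fun x _ => hasDerivWithinAt_const _ _ _, ih⟩

theorem of_contDiff (hS : Convex ℝ S) {α : ℝ → ℝ} (hα : ContDiff ℝ ∞ α)
    (hb : ∀ x ∈ S, ∀ l ≤ n + 1, |iteratedDeriv l α x| ≤ Q) : JetBound S n α Q := by
  induction n generalizing α with
  | zero =>
    refine ⟨fun x hx => by simpa using hb x hx 0 (by omega), fun x hx y hy => ?_⟩
    refine hS.norm_image_sub_le_of_norm_hasDerivWithin_le (f' := deriv α) (fun z _ =>
      ((hα.differentiable (by simp)) z).hasDerivAt.hasDerivWithinAt) (fun z hz => ?_) hy hx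
    simpa using hb z hz 1 (by omega)
  | succ n ih =>
    refine ⟨fun x hx => by simpa using hb x hx 0 (by omega), deriv α, fun z _ =>
      ((hα.differentiable (by simp)) z).hasDerivAt.hasDerivWithinAt,
      ih (contDiff_infty_iff_deriv.1 hα).2 fun x hx l hl => ?_⟩
    rw [← iteratedDeriv_succ']
    exact hb x hx (l + 1) (by omega)

end JetBound

/-- The primitive of a real polynomial that vanishes at `0`. -/
def primitive (p : ℝ[X]) : ℝ[X] :=
  ∑ i ∈ Finset.range (p.natDegree + 1), C (p.coeff i / (i + 1)) * X ^ (i + 1)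

theorem derivative_primitive (p : ℝ[X]) : derivative (primitive p) = p := by
  conv_rhs => rw [p.as_sum_range_C_mul_X_pow]
  rw [primitive, derivative_sum]
  refine Finset.sum_congr rfl fun i _ => ?_
  rw [derivative_C_mul_X_pow]
  congr 2
  push_cast
  field_simp

theorem natDegree_primitive_le (p : ℝ[X]) : (primitive p).natDegree ≤ p.natDegree + 1 := by
  refine natDegree_sum_le_of_forall_le _ _ fun i hi => ?_
  exact (natDegree_C_mul_X_pow_le _ _).trans (by simpa using Finset.mem_range_succ_iff.1 hi)

namespace JetBound

variable {n : ℕ} {F F' : ℝ → ℝ} {Q a b : ℝ}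

theorem exists_poly_of_deriv (hab : a ≤ b)
    (hF : ∀ x ∈ Icc a b, HasDerivWithinAt F (F' x) (Icc a b) x)
    {P' : ℝ[X]} {ε : ℝ} (hP' : ∀ x ∈ Icc a b, |F' x - P'.eval x| ≤ ε) :
    ∃ P : ℝ[X], P.natDegree ≤ P'.natDegree + 1 ∧ derivative P = P' ∧
      ∀ x ∈ Icc a b, |F x - P.eval x| ≤ ε * (b - a) := by
  refine ⟨primitive P' + C (F a - (primitive P').eval a), ?_, ?_, ?_⟩
  · rw [natDegree_add_C]
    exact natDegree_primitive_le _
  · simp [derivative_primitive]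
  · intro x hx
    have hε : 0 ≤ ε := (abs_nonneg _).trans (hP' x hx)
    have := (convex_Icc a b).norm_image_sub_le_of_norm_hasDerivWithin_le
      (f := fun x => F x - (primitive P').eval x) (f' := fun x => F' x - P'.eval x) (C := ε)
      (fun y hy => (hF y hy).sub (by
        have := (primitive P').hasDerivAt y
        rw [derivative_primitive] at this
        exact this.hasDerivWithinAt)) hP' (left_mem_Icc.2 hab) hx
    simp only [eval_add, eval_C]
    rw [Real.norm_eq_abs, Real.norm_eq_abs, abs_of_nonneg (sub_nonneg.2 hx.1)] at this
    refine le_trans (le_of_eq ?_) (this.trans (mul_le_mul_of_nonneg_left (by linarith [hx.2]) hε))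
    congr 1; ring

theorem exists_poly (hab : a ≤ b) (h : JetBound (Icc a b) n F Q) :
    ∃ P : ℝ[X], P.natDegree ≤ n ∧ ∀ x ∈ Icc a b, |F x - P.eval x| ≤ Q * (b - a) ^ (n + 1) := by
  induction n generalizing F with
  | zero =>
    refine ⟨C (F a), by simp, fun x hx => ?_⟩
    have hQ : 0 ≤ Q := (abs_nonneg _).trans (h.1 x hx)
    have := h.2 x hx a (left_mem_Icc.2 hab)
    rw [abs_of_nonneg (sub_nonneg.2 hx.1)] at this
    simpa using this.trans (mul_le_mul_of_nonneg_left (by linarith [hx.2]) hQ)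
  | succ n ih =>
    obtain ⟨h1, F', h2, h3⟩ := h
    obtain ⟨P', hd, hP'⟩ := ih h3
    obtain ⟨P, hPd, -, hP⟩ := exists_poly_of_deriv hab h2 hP'
    exact ⟨P, by omega, fun x hx => (hP x hx).trans (le_of_eq (by ring))⟩

/-- Taylor approximation of a function together with its derivative. -/
theorem exists_poly_deriv (hab : a ≤ b)
    (hF : ∀ x ∈ Icc a b, HasDerivWithinAt F (F' x) (Icc a b) x)
    (h : JetBound (Icc a b) n F' Q) :
    ∃ P : ℝ[X], P.natDegree ≤ n + 1 ∧ (∀ x ∈ Icc a b, |F x - P.eval x| ≤ Q * (b - a) ^ (n + 2)) ∧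
      ∀ x ∈ Icc a b, |F' x - (derivative P).eval x| ≤ Q * (b - a) ^ (n + 1) := by
  obtain ⟨P', hd, hP'⟩ := h.exists_poly hab
  obtain ⟨P, hPd, hPP', hP⟩ := exists_poly_of_deriv hab hF hP'
  exact ⟨P, by omega, fun x hx => (hP x hx).trans (le_of_eq (by ring)), by rwa [hPP']⟩

end JetBound

/-! ### Regularity of Sobolev functions -/

instance : IsFiniteMeasure domainMeasure := by
  unfold domainMeasure; infer_instance

theorem intervalIntegrable_of_memLp {w : ℝ → ℝ} (hw : MemLp w ⊤ domainMeasure) :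
    IntervalIntegrable w volume 0 (2 * Real.pi) := by
  rw [intervalIntegrable_iff_integrableOn_Ioo_of_le Real.two_pi_pos.le]
  exact hw.integrable le_top

theorem setIntegral_domain (f : ℝ → ℝ) :
    ∫ x, f x ∂domainMeasure = ∫ x in (0 : ℝ)..(2 * Real.pi), f x := by
  rw [intervalIntegral.integral_of_le Real.two_pi_pos.le, integral_Ioc_eq_integral_Ioo]
  rfl

/-- A function with an essentially bounded weak derivative is almost everywhere a primitive. -/
theorem ae_eq_primitive_of_weakDeriv {f w : ℝ → ℝ} (hf : MemLp f ⊤ domainMeasure)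
    (hw : MemLp w ⊤ domainMeasure)
    (h : ∀ φ : ℝ → ℝ, ContDiff ℝ ∞ φ → HasCompactSupport φ →
      tsupport φ ⊆ Ioo 0 (2 * Real.pi) →
        ∫ x, f x * deriv φ x ∂domainMeasure = -∫ x, w x * φ x ∂domainMeasure) :
    ∃ c, ∀ᵐ x ∂domainMeasure, f x = c + ∫ y in (0 : ℝ)..x, w y := by
  have hwi := intervalIntegrable_of_memLp hw
  have hW := hwi.absolutelyContinuousOnInterval_intervalIntegral (c := 0) (by simp)
  have hWc : ContinuousOn (fun x => ∫ y in (0 : ℝ)..x, w y) (Icc 0 (2 * Real.pi)) := by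
    have := hW.continuousOn
    rwa [uIcc_of_le Real.two_pi_pos.le] at this
  have hWi : IntegrableOn (fun x => ∫ y in (0 : ℝ)..x, w y) (Ioo 0 (2 * Real.pi)) :=
    (hWc.integrableOn_Icc).mono_set Ioo_subset_Icc_self
  have hfi : IntegrableOn f (Ioo 0 (2 * Real.pi)) := hf.integrable le_top
  obtain ⟨c, hc⟩ := ae_eq_const_of_integral_mul_deriv_eq_zero Real.two_pi_pos
    (F := fun x => f x - ∫ y in (0 : ℝ)..x, w y) (hfi.sub hWi) (by
      intro φ hφ hφc hφs
      have hφ0 : ∀ x, x ∉ Ioo 0 (2 * Real.pi) → φ x = 0 := fun x hx =>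
        image_eq_zero_of_notMem_tsupport fun hx' => hx (hφs hx')
      have hφac : AbsolutelyContinuousOnInterval φ 0 (2 * Real.pi) :=
        (hφ.contDiffOn.of_le (by simp)).absolutelyContinuousOnInterval
      have h1 := hW.integral_mul_deriv_eq_deriv_mul hφac
      rw [hφ0 0 (by simp), hφ0 (2 * Real.pi) (by simp)] at h1
      have h2 : ∫ x in (0 : ℝ)..(2 * Real.pi), deriv (fun x => ∫ y in (0 : ℝ)..x, w y) x * φ x
          = ∫ x in (0 : ℝ)..(2 * Real.pi), w x * φ x := by
        apply intervalIntegral.integral_congr_ae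
        filter_upwards [hwi.ae_hasDerivAt_integral] with x hx hx'
        rw [(hx (uIoc_subset_uIcc hx') 0 (by simp)).deriv]
      obtain ⟨B, hB⟩ := (hφc.deriv).exists_bound_of_continuous (hφ.continuous_deriv (by simp))
      have hdm : AEStronglyMeasurable (deriv φ) (volume.restrict (Ioo 0 (2 * Real.pi))) :=
        (hφ.continuous_deriv (by simp)).aestronglyMeasurable
      have h3 := h φ hφ hφc hφs
      rw [setIntegral_domain (fun x => w x * φ x)] at h3
      have h4 := setIntegral_domain (fun x => (∫ y in (0 : ℝ)..x, w y) * deriv φ x)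
      rw [domainMeasure] at h3 h4
      simp only [sub_mul]
      rw [integral_sub (hfi.mul_bdd (c := B) hdm (ae_of_all _ hB))
        (hWi.mul_bdd (c := B) hdm (ae_of_all _ hB)), h3, h4, h1, h2]
      ring)
  refine ⟨c, ?_⟩
  filter_upwards [hc] with x hx
  linarith

theorem abs_le_of_ae_abs_le {F : ℝ → ℝ} {Q : ℝ} (hF : ContinuousOn F (Icc 0 (2 * Real.pi)))
    (h : ∀ᵐ x ∂domainMeasure, |F x| ≤ Q) : ∀ x ∈ Icc 0 (2 * Real.pi), |F x| ≤ Q := by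
  have h' : ∀ᵐ x ∂volume.restrict (Icc 0 (2 * Real.pi)), |F x| ≤ Q := by
    rw [← restrict_Ioo_eq_restrict_Icc]; exact h
  have := Measure.eqOn_Icc_of_ae_eq (μ := volume) Real.two_pi_pos.ne
    (f := fun x => min |F x| Q) (g := fun x => |F x|)
    (h'.mono fun x hx => min_eq_left hx) (by fun_prop) (by fun_prop)
  intro x hx
  exact min_eq_left_iff.1 (this hx)

/-- The weak derivatives of an element of `W^{n+1,∞}` give a bounded jet of its continuous
representative. -/
theorem exists_jetBound_of_weakDeriv {n : ℕ} {D : ℕ → ℝ → ℝ} {Q : ℝ}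
    (hD : ∀ l ≤ n + 1, MemLp (D l) ⊤ domainMeasure)
    (hQ : ∀ l ≤ n + 1, ∀ᵐ x ∂domainMeasure, |D l x| ≤ Q)
    (hw : ∀ l ≤ n, ∀ φ : ℝ → ℝ, ContDiff ℝ ∞ φ → HasCompactSupport φ →
      tsupport φ ⊆ Ioo 0 (2 * Real.pi) →
        ∫ x, D l x * deriv φ x ∂domainMeasure = -∫ x, D (l + 1) x * φ x ∂domainMeasure) :
    ∃ F : ℝ → ℝ, D 0 =ᵐ[domainMeasure] F ∧ ContinuousOn F (Icc 0 (2 * Real.pi)) ∧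
      JetBound (Icc 0 (2 * Real.pi)) n F Q := by
  obtain ⟨c, hc⟩ := ae_eq_primitive_of_weakDeriv (hD 0 (by omega)) (hD 1 (by omega))
    (hw 0 (by omega))
  have hint := intervalIntegrable_of_memLp (hD 1 (by omega))
  have hcont : ContinuousOn (fun x => c + ∫ y in (0 : ℝ)..x, D 1 y) (Icc 0 (2 * Real.pi)) := by
    have := (hint.absolutelyContinuousOnInterval_intervalIntegral (c := 0) (by simp)).continuousOn
    rw [uIcc_of_le Real.two_pi_pos.le] at this
    exact continuousOn_const.add this
  have hbd : ∀ x ∈ Icc 0 (2 * Real.pi), |c + ∫ y in (0 : ℝ)..x, D 1 y| ≤ Q := by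
    apply abs_le_of_ae_abs_le hcont
    filter_upwards [hc, hQ 0 (by omega)] with x h1 h2
    rwa [← h1]
  have hsubint : ∀ x ∈ Icc 0 (2 * Real.pi), ∀ y ∈ Icc 0 (2 * Real.pi),
      IntervalIntegrable (D 1) volume x y := fun x hx y hy => hint.mono_set (by
    rw [uIcc_of_le Real.two_pi_pos.le]; exact uIcc_subset_Icc hx hy)
  have h0 : (0 : ℝ) ∈ Icc 0 (2 * Real.pi) := ⟨le_rfl, Real.two_pi_pos.le⟩
  induction n generalizing D c with
  | zero =>
    refine ⟨_, hc, hcont, hbd, fun x hx y hy => ?_⟩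
    have h1 := intervalIntegral.integral_interval_sub_left (hsubint 0 h0 x hx)
      (hsubint 0 h0 y hy)
    rw [add_sub_add_left_eq_sub, h1, ← Real.norm_eq_abs]
    have hq := hQ 1 (by omega)
    rw [domainMeasure, restrict_Ioo_eq_restrict_Ioc, ae_restrict_iff' measurableSet_Ioc] at hq
    refine intervalIntegral.norm_integral_le_of_norm_le_const_ae ?_
    filter_upwards [hq] with z hz hz'
    exact hz (by
      have := uIoc_subset_uIcc hz'
      rw [uIoc, mem_Ioc] at hz'
      exact ⟨lt_of_le_of_lt (le_min hy.1 hx.1) hz'.1, hz'.2.trans (max_le hy.2 hx.2)⟩)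
  | succ n ih =>
    obtain ⟨c', hc'⟩ := ae_eq_primitive_of_weakDeriv (hD 1 (by omega)) (hD 2 (by omega))
      (hw 1 (by omega))
    have hint' := intervalIntegrable_of_memLp (hD 2 (by omega))
    have hcont' : ContinuousOn (fun x => c' + ∫ y in (0 : ℝ)..x, D 2 y)
        (Icc 0 (2 * Real.pi)) := by
      have := (hint'.absolutelyContinuousOnInterval_intervalIntegral (c := 0)
        (by simp)).continuousOn
      rw [uIcc_of_le Real.two_pi_pos.le] at this
      exact continuousOn_const.add this
    obtain ⟨G, hG, hGc, hGj⟩ := ih (D := fun l => D (l + 1)) (c := c')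
      (fun l hl => hD (l + 1) (by omega)) (fun l hl => hQ (l + 1) (by omega))
      (fun l hl => hw (l + 1) (by omega)) hc' hint' hcont' (by
        apply abs_le_of_ae_abs_le hcont'
        filter_upwards [hc', hQ 1 (by omega)] with x h1 h2
        rwa [← h1]) (fun x hx y hy => hint'.mono_set (by
          rw [uIcc_of_le Real.two_pi_pos.le]; exact uIcc_subset_Icc hx hy))
    refine ⟨_, hc, hcont, hbd, G, fun x hx => ?_, hGj⟩
    -- extend the continuous representative of the derivative to the real line
    set G' : ℝ → ℝ := IccExtend Real.two_pi_pos.le ((Icc 0 (2 * Real.pi)).domRestrict G) with hG'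
    have hG'c : Continuous G' := hGc.domRestrict.Icc_extend'
    have hG'e : ∀ y ∈ Icc 0 (2 * Real.pi), G' y = G y := fun y hy =>
      IccExtend_of_mem _ _ hy
    have hder : HasDerivAt (fun x => c + ∫ y in (0 : ℝ)..x, G' y) (G' x) x :=
      (intervalIntegral.integral_hasDerivAt_right (hG'c.intervalIntegrable _ _)
        (hG'c.stronglyMeasurableAtFilter _ _) hG'c.continuousAt).const_add c
    rw [hG'e x hx] at hder
    have heq : ∀ y ∈ Icc 0 (2 * Real.pi),
        c + ∫ z in (0 : ℝ)..y, D 1 z = c + ∫ z in (0 : ℝ)..y, G' z := by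
      intro y hy
      congr 1
      apply intervalIntegral.integral_congr_ae
      have hG2 := hG
      rw [Filter.EventuallyEq, domainMeasure, restrict_Ioo_eq_restrict_Ioc,
        ae_restrict_iff' measurableSet_Ioc] at hG2
      filter_upwards [hG2] with z hz hz'
      rw [uIoc_of_le hy.1] at hz'
      have : z ∈ Ioc 0 (2 * Real.pi) := ⟨hz'.1, hz'.2.trans hy.2⟩
      rw [hG'e z (Ioc_subset_Icc_self this)]
      exact hz this
    exact hder.hasDerivWithinAt.congr heq (heq x hx)

/-- A continuous function with `W^{n+1,∞}` norm less than `A` has a jet bounded by `A`. -/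
theorem jetBound_of_sobolevNorm_lt {n : ℕ} {v : ℝ → ℝ} {A : ℝ}
    (hv : ContinuousOn v (Icc 0 (2 * Real.pi)))
    (h : sobolevNorm (n + 1) v < ENNReal.ofReal A) :
    JetBound (Icc 0 (2 * Real.pi)) n v A := by
  rw [sobolevNorm] at h
  simp only [iInf_lt_iff] at h
  obtain ⟨D, ⟨hD0, hD⟩, hlt⟩ := h
  have hA : 0 ≤ A := by
    by_contra hn
    rw [ENNReal.ofReal_of_nonpos (not_le.1 hn).le] at hlt
    exact absurd hlt (by simp)
  obtain ⟨F, hF, hFc, hFj⟩ := exists_jetBound_of_weakDeriv (n := n) (D := D) (Q := A)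
    (fun l hl => (hD l hl).1) (fun l hl => by
      have h1 : eLpNorm (D l) ⊤ domainMeasure ≤ ENNReal.ofReal A :=
        (Finset.le_sup (f := fun j => eLpNorm (D j) ⊤ domainMeasure)
          (Finset.mem_range_succ_iff.2 hl)).trans hlt.le
      rw [eLpNorm_exponent_top] at h1
      filter_upwards [enorm_ae_le_eLpNormEssSup (D l) domainMeasure] with x hx
      have := hx.trans h1
      rw [← ofReal_norm, ENNReal.ofReal_le_ofReal_iff hA] at this
      exact this) (fun l hl φ hφ hφc hφs => by
      have hφ' : ContDiff ℝ ∞ (deriv φ) := (contDiff_infty_iff_deriv.1 hφ).2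
      have h1 := (hD l (by omega)).2 (deriv φ) hφ' hφc.deriv
        (fun x hx => hφs (tsupport_deriv_subset hx))
      have h2 := (hD (l + 1) (by omega)).2 φ hφ hφc hφs
      rw [iteratedDeriv_succ', h1, pow_succ, mul_neg_one, neg_mul, ← mul_neg] at h2
      exact mul_left_cancel₀ (pow_ne_zero l (by norm_num)) h2)
  refine hFj.congr ?_
  rw [hD0] at hF
  exact Measure.eqOn_Icc_of_ae_eq (μ := volume) Real.two_pi_pos.ne
    (by rw [← restrict_Ioo_eq_restrict_Icc]; exact hF) hv hFc

/-! ### Regularity of the flux and of the source -/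

theorem exists_partial_derivs {T : ℝ} (hT : 0 < T) {G : ℝ × ℝ → ℝ}
    (hG : ContDiffOn ℝ ∞ G (Icc 0 T ×ˢ Icc 0 (2 * Real.pi))) (w : ℝ × ℝ) :
    ContDiffOn ℝ ∞ (fun p => fderivWithin ℝ G (Icc 0 T ×ˢ Icc 0 (2 * Real.pi)) p w)
      (Icc 0 T ×ˢ Icc 0 (2 * Real.pi)) := by
  have hU : UniqueDiffOn ℝ (Icc 0 T ×ˢ Icc 0 (2 * Real.pi)) :=
    (uniqueDiffOn_Icc hT).prod (uniqueDiffOn_Icc Real.two_pi_pos)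
  exact (hG.fderivWithin hU (m := ∞) (by simp)).clm_apply contDiffOn_const

theorem hasDerivWithinAt_space {T : ℝ} {G : ℝ × ℝ → ℝ}
    (hG : ContDiffOn ℝ ∞ G (Icc 0 T ×ˢ Icc 0 (2 * Real.pi))) {t x : ℝ} (ht : t ∈ Icc 0 T)
    (hx : x ∈ Icc 0 (2 * Real.pi)) :
    HasDerivWithinAt (fun y => G (t, y))
      (fderivWithin ℝ G (Icc 0 T ×ˢ Icc 0 (2 * Real.pi)) (t, x) (0, 1)) (Icc 0 (2 * Real.pi)) x :=
  ((hG.differentiableOn (by simp)) (t, x) ⟨ht, hx⟩).hasFDerivWithinAt.comp_hasDerivWithinAt x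
    ((hasDerivWithinAt_const x _ t).prodMk (hasDerivWithinAt_id x _))
    fun _ hy => Set.mk_mem_prod ht hy

theorem hasDerivWithinAt_time {T : ℝ} {G : ℝ × ℝ → ℝ}
    (hG : ContDiffOn ℝ ∞ G (Icc 0 T ×ˢ Icc 0 (2 * Real.pi))) {t x : ℝ} (ht : t ∈ Icc 0 T)
    (hx : x ∈ Icc 0 (2 * Real.pi)) :
    HasDerivWithinAt (fun τ => G (τ, x))
      (fderivWithin ℝ G (Icc 0 T ×ˢ Icc 0 (2 * Real.pi)) (t, x) (1, 0)) (Icc 0 T) t :=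
  ((hG.differentiableOn (by simp)) (t, x) ⟨ht, hx⟩).hasFDerivWithinAt.comp_hasDerivWithinAt t
    ((hasDerivWithinAt_id t _).prodMk (hasDerivWithinAt_const t _ x))
    fun _ hy => Set.mk_mem_prod hy hx

/-- A function that is smooth on the closed space-time cylinder has bounded jets in space, uniformly
in time. -/
theorem exists_uniform_jetBound {T : ℝ} (hT : 0 < T) (n : ℕ) {G : ℝ × ℝ → ℝ}
    (hG : ContDiffOn ℝ ∞ G (Icc 0 T ×ˢ Icc 0 (2 * Real.pi))) :
    ∃ Q, 0 ≤ Q ∧ ∀ t ∈ Icc 0 T, JetBound (Icc 0 (2 * Real.pi)) n (fun x => G (t, x)) Q := by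
  have hb : ∀ G : ℝ × ℝ → ℝ, ContDiffOn ℝ ∞ G (Icc 0 T ×ˢ Icc 0 (2 * Real.pi)) →
      ∃ B, 0 ≤ B ∧ ∀ t ∈ Icc 0 T, ∀ x ∈ Icc 0 (2 * Real.pi), |G (t, x)| ≤ B := by
    intro G hG
    obtain ⟨B, hB⟩ := (isCompact_Icc.prod isCompact_Icc).exists_bound_of_continuousOn
      hG.continuousOn
    exact ⟨max B 0, le_max_right _ _, fun t ht x hx => (hB (t, x) ⟨ht, hx⟩).trans (le_max_left _ _)⟩
  induction n generalizing G with
  | zero =>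
    obtain ⟨B, hB0, hB⟩ := hb G hG
    obtain ⟨B', hB0', hB'⟩ := hb _ (exists_partial_derivs hT hG (0, 1))
    refine ⟨max B B', hB0.trans (le_max_left _ _), fun t ht =>
      ⟨fun x hx => (hB t ht x hx).trans (le_max_left _ _), fun x hx y hy => ?_⟩⟩
    exact (convex_Icc _ _).norm_image_sub_le_of_norm_hasDerivWithin_le
      (fun z hz => hasDerivWithinAt_space hG ht hz)
      (fun z hz => (hB' t ht z hz).trans (le_max_right B B')) hy hx
  | succ n ih =>
    obtain ⟨B, hB0, hB⟩ := hb G hG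
    obtain ⟨B', hB0', hB'⟩ := ih (exists_partial_derivs hT hG (0, 1))
    exact ⟨max B B', hB0.trans (le_max_left _ _), fun t ht =>
      ⟨fun x hx => (hB t ht x hx).trans (le_max_left _ _), _,
        fun x hx => hasDerivWithinAt_space hG ht hx, (hB' t ht).mono (le_max_right _ _)⟩⟩

/-- The space derivative of the flux `α u` on `[0, 2π]`. -/
def fluxDeriv (α : ℝ → ℝ) (u : ℝ → ℝ → ℝ) (t x : ℝ) : ℝ :=
  derivWithin (fun y => α y * u t y) (Icc 0 (2 * Real.pi)) x

section Solution

variable {α : ℝ → ℝ} {g u : ℝ → ℝ → ℝ} {T A : ℝ} {n : ℕ}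

theorem IsSolution.jetBound (hu : IsSolution α g T (n + 1) u)
    (hA : sobolevNormOn (n + 1) T u < ENNReal.ofReal A) {t : ℝ} (ht : t ∈ Icc 0 T) :
    JetBound (Icc 0 (2 * Real.pi)) n (u t) A :=
  jetBound_of_sobolevNorm_lt (hu.continuousOn t ht)
    (lt_of_le_of_lt (le_iSup₂ (f := fun t (_ : t ∈ Icc 0 T) => sobolevNorm (n + 1) (u t)) t ht) hA)

theorem IsSolution.hasDerivWithinAt_flux (hu : IsSolution α g T n u) {t x : ℝ}
    (ht : t ∈ Icc 0 T) (hx : x ∈ Icc 0 (2 * Real.pi)) :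
    HasDerivWithinAt (fun y => α y * u t y) (fluxDeriv α u t x) (Icc 0 (2 * Real.pi)) x :=
  (hu.differentiable_space t ht x hx).hasDerivWithinAt

theorem IsSolution.hasDerivWithinAt_time (hu : IsSolution α g T n u) {t x : ℝ}
    (ht : t ∈ Icc 0 T) (hx : x ∈ Icc 0 (2 * Real.pi)) :
    HasDerivWithinAt (fun τ => u τ x) (g t x - fluxDeriv α u t x) (Icc 0 T) t := by
  have h := (hu.differentiable_time t ht x hx).hasDerivWithinAt
  have := hu.equation t ht x hx
  rwa [← this, fluxDeriv, add_sub_cancel_right]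

theorem exists_jetBound_of_contDiff (n : ℕ) (hα : ContDiff ℝ ∞ α) :
    ∃ Q, 1 ≤ Q ∧ JetBound (Icc 0 (2 * Real.pi)) n α Q := by
  have : ∀ l : ℕ, ∃ B, ∀ x ∈ Icc 0 (2 * Real.pi), |iteratedDeriv l α x| ≤ B := fun l =>
    isCompact_Icc.exists_bound_of_continuousOn
      (hα.continuous_iteratedDeriv l (by exact_mod_cast le_top)).continuousOn
  choose B hB using this
  refine ⟨1 + ∑ l ∈ Finset.range (n + 2), |B l|, ?_, JetBound.of_contDiff (convex_Icc _ _) hα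
    fun x hx l hl => ?_⟩
  · have : 0 ≤ ∑ l ∈ Finset.range (n + 2), |B l| := Finset.sum_nonneg fun _ _ => abs_nonneg _
    linarith
  · have := Finset.single_le_sum (f := fun l => |B l|) (fun l _ => abs_nonneg (B l))
      (Finset.mem_range.2 (show l < n + 2 by omega))
    have h2 := (hB l x hx).trans (le_abs_self _)
    linarith

theorem JetBound.flux {Q : ℝ} (hQ : 1 ≤ Q) (hα : JetBound (Icc 0 (2 * Real.pi)) n α Q)
    (hA : 0 ≤ A) {v : ℝ → ℝ} (hv : JetBound (Icc 0 (2 * Real.pi)) n v A) :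
    JetBound (Icc 0 (2 * Real.pi)) n (fun x => α x * v x) (2 ^ (n + 1) * Q * A) :=
  (hα.mul (convex_Icc _ _) (by linarith) hA hv).mono (le_of_eq (by ring))

theorem IsSolution.jetBound_fluxDeriv {Q : ℝ} (hQ : 1 ≤ Q)
    (hα : JetBound (Icc 0 (2 * Real.pi)) (n + 1) α Q)
    (hu : IsSolution α g T (n + 2) u) (hA0 : 0 ≤ A)
    (hA : sobolevNormOn (n + 2) T u < ENNReal.ofReal A) {t : ℝ} (ht : t ∈ Icc 0 T) :
    JetBound (Icc 0 (2 * Real.pi)) n (fluxDeriv α u t) (2 ^ (n + 2) * Q * A) := by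
  obtain ⟨h1, F', h2, h3⟩ := hα.flux hQ hA0 (hu.jetBound hA ht)
  exact h3.congr fun x hx =>
    (h2 x hx).derivWithin (uniqueDiffOn_Icc Real.two_pi_pos x hx)

/-- A nonzero source forces a lower bound on the size of every solution, since a small solution
has a small flux and can then not grow as the source demands. -/
theorem exists_pos_le_of_source_ne_zero (hα : ContDiff ℝ ∞ α)
    (hg : ContDiffOn ℝ ∞ (fun p : ℝ × ℝ => g p.1 p.2) (Icc 0 T ×ˢ Icc 0 (2 * Real.pi)))
    (hT : 0 < T) {t₀ x₀ : ℝ} (ht₀ : t₀ ∈ Icc 0 T) (hx₀ : x₀ ∈ Icc 0 (2 * Real.pi))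
    (h0 : g t₀ x₀ ≠ 0) (n : ℕ) :
    ∃ c > 0, ∀ u A, 0 ≤ A → IsSolution α g T (n + 2) u →
      sobolevNormOn (n + 2) T u < ENNReal.ofReal A → c ≤ A := by
  obtain ⟨Q, hQ, hαQ⟩ := exists_jetBound_of_contDiff (n + 1) hα
  have hgc : ContinuousOn (fun τ => g τ x₀) (Icc 0 T) := fun τ hτ =>
    (SpectralVolume.hasDerivWithinAt_time hg hτ hx₀).continuousWithinAt
  -- `σ` is the sign of the source at the point
  obtain ⟨σ, hσ, hσg⟩ : ∃ σ : ℝ, |σ| = 1 ∧ 0 < σ * g t₀ x₀ := by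
    rcases lt_or_gt_of_ne h0 with h | h
    · exact ⟨-1, by simp, by linarith⟩
    · exact ⟨1, by simp, by linarith⟩
  set c := σ * g t₀ x₀ / 2 with hc
  have hcpos : 0 < c := by positivity
  have hev : ∀ᶠ τ in nhdsWithin t₀ (Icc 0 T), c < σ * g τ x₀ :=
    ((continuousOn_const.mul hgc) t₀ ht₀).eventually_const_lt
      (by simp only [Pi.mul_apply, hc]; linarith)
  obtain ⟨δ, hδ, hδs⟩ := Metric.mem_nhdsWithin_iff.1 hev
  obtain ⟨t₁, t₂, h12, hsub⟩ : ∃ t₁ t₂, t₁ < t₂ ∧ Icc t₁ t₂ ⊆ Metric.ball t₀ δ ∩ Icc 0 T := by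
    rcases lt_or_ge t₀ T with h | h
    · refine ⟨t₀, min (t₀ + δ / 2) T, lt_min (by linarith) h, fun y hy => ?_⟩
      have h1 := hy.2.trans (min_le_left _ _)
      have h2 := hy.2.trans (min_le_right _ _)
      refine ⟨?_, ht₀.1.trans hy.1, h2⟩
      rw [Metric.mem_ball, Real.dist_eq, abs_lt]
      constructor <;> linarith [hy.1]
    · refine ⟨max (t₀ - δ / 2) 0, t₀, max_lt (by linarith) (hT.trans_le h), fun y hy => ?_⟩
      have h1 := (le_max_left _ _).trans hy.1
      have h2 := (le_max_right _ _).trans hy.1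
      refine ⟨?_, h2, hy.2.trans ht₀.2⟩
      rw [Metric.mem_ball, Real.dist_eq, abs_lt]
      constructor <;> linarith [hy.2]
  set L := 2 ^ (n + 2) * Q with hL
  have hLpos : 0 < L := by positivity
  refine ⟨min (c / (2 * L)) (c * (t₂ - t₁) / 4),
    lt_min (by positivity) (by have := sub_pos.2 h12; positivity), fun u A hA0 hu hA => ?_⟩
  by_contra hlt
  rw [not_le, lt_min_iff, lt_div_iff₀ (by positivity)] at hlt
  have hmem1 : t₁ ∈ Icc 0 T := (hsub (left_mem_Icc.2 h12.le)).2
  have hmem2 : t₂ ∈ Icc 0 T := (hsub (right_mem_Icc.2 h12.le)).2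
  have hsubT : Icc t₁ t₂ ⊆ Icc 0 T := fun y hy => (hsub hy).2
  have hd : ∀ τ ∈ Icc t₁ t₂, HasDerivWithinAt (fun τ => σ * u τ x₀)
      (σ * (g τ x₀ - fluxDeriv α u τ x₀)) (Icc t₁ t₂) τ := fun τ hτ =>
    ((hu.hasDerivWithinAt_time (hsubT hτ) hx₀).mono hsubT).const_mul σ
  have hge := (convex_Icc t₁ t₂).mul_sub_le_image_sub_of_le_deriv (C := c / 2)
    (f := fun τ => σ * u τ x₀) (fun τ hτ => (hd τ hτ).continuousWithinAt)
    (fun τ hτ => ((hd τ (interior_subset hτ)).mono interior_subset).differentiableWithinAt)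
    (fun τ hτ => by
      have hτ' := interior_subset hτ
      rw [interior_Icc] at hτ
      rw [((hd τ hτ').hasDerivAt (Icc_mem_nhds hτ.1 hτ.2)).deriv]
      have h1 : c < σ * g τ x₀ := hδs (hsub hτ')
      have h2 := (hu.jetBound_fluxDeriv hQ hαQ hA0 hA (hsubT hτ')).bound x₀ hx₀
      have h3 : |σ * fluxDeriv α u τ x₀| ≤ L * A := by rw [abs_mul, hσ, one_mul]; exact h2
      have := le_abs_self (σ * fluxDeriv α u τ x₀)
      nlinarith)
    t₁ (left_mem_Icc.2 h12.le) t₂ (right_mem_Icc.2 h12.le) h12.le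
  have hb1 := (hu.jetBound hA hmem1).bound x₀ hx₀
  have hb2 := (hu.jetBound hA hmem2).bound x₀ hx₀
  have h1 : |σ * u t₁ x₀| ≤ A := by rwa [abs_mul, hσ, one_mul]
  have h2 : |σ * u t₂ x₀| ≤ A := by rwa [abs_mul, hσ, one_mul]
  have := le_abs_self (σ * u t₂ x₀)
  have := neg_abs_le (σ * u t₁ x₀)
  have := hlt.2
  nlinarith

/-- The jets of the source and of its time derivative are controlled by the size of the solution.
The factor `γ` may be taken to be `0` when the source vanishes. -/
theorem exists_source_jetBound (hα : ContDiff ℝ ∞ α)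
    (hg : ContDiffOn ℝ ∞ (fun p : ℝ × ℝ => g p.1 p.2) (Icc 0 T ×ˢ Icc 0 (2 * Real.pi)))
    (hT : 0 < T) {γ : ℝ}
    (hγ1 : γ = 1 ∨ ∀ t ∈ Icc 0 T, ∀ x ∈ Icc 0 (2 * Real.pi), g t x = 0) (n l : ℕ) :
    ∃ K, 0 ≤ K ∧ ∃ gt : ℝ → ℝ → ℝ, (∀ t ∈ Icc 0 T, ∀ x ∈ Icc 0 (2 * Real.pi),
        HasDerivWithinAt (fun τ => g τ x) (gt t x) (Icc 0 T) t) ∧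
      ∀ u A, 0 ≤ A → IsSolution α g T (n + 2) u → sobolevNormOn (n + 2) T u < ENNReal.ofReal A →
        ∀ t ∈ Icc 0 T, JetBound (Icc 0 (2 * Real.pi)) l (g t) (K * γ * A) ∧
          JetBound (Icc 0 (2 * Real.pi)) l (gt t) (K * γ * A) := by
  by_cases h0 : ∀ t ∈ Icc 0 T, ∀ x ∈ Icc 0 (2 * Real.pi), g t x = 0
  · refine ⟨0, le_rfl, fun _ _ => 0, fun t ht x hx =>
      (hasDerivWithinAt_const t _ (0 : ℝ)).congr (fun τ hτ => h0 τ hτ x hx) (h0 t ht x hx),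
      fun u A hA0 hu hA t ht => ⟨?_, ?_⟩⟩
    · exact (JetBound.zero (by simp)).congr (h0 t ht)
    · exact JetBound.zero (by simp)
  · have hγ' := hγ1.resolve_right h0
    push Not at h0
    obtain ⟨t₀, ht₀, x₀, hx₀, hne⟩ := h0
    obtain ⟨c, hc, hcA⟩ := exists_pos_le_of_source_ne_zero hα hg hT ht₀ hx₀ hne n
    obtain ⟨Q₁, hQ₁, h₁⟩ := exists_uniform_jetBound hT l hg
    obtain ⟨Q₂, hQ₂, h₂⟩ := exists_uniform_jetBound hT l (exists_partial_derivs hT hg (1, 0))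
    refine ⟨(Q₁ + Q₂) / c, by positivity, _, fun t ht x hx =>
      SpectralVolume.hasDerivWithinAt_time hg ht hx, fun u A hA0 hu hA t ht => ?_⟩
    have hle : Q₁ + Q₂ ≤ (Q₁ + Q₂) / c * γ * A := by
      rw [hγ', mul_one, div_mul_eq_mul_div, le_div_iff₀ hc]
      exact mul_le_mul_of_nonneg_left (hcA u A hA0 hu hA) (by positivity)
    exact ⟨(h₁ t ht).mono (by linarith), (h₂ t ht).mono (by linarith)⟩

end Solution

/-! ### Functions near a zero of finite order -/

/-- Taylor's formula at a point where the first `n` derivatives vanish, on either side. -/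
theorem exists_eq_iteratedDeriv_mul_pow {n : ℕ} {f : ℝ → ℝ} {z : ℝ} (hf : ContDiff ℝ ∞ f)
    (hz : ∀ l < n, iteratedDeriv l f z = 0) (x : ℝ) :
    ∃ ξ ∈ uIcc z x, f x = iteratedDeriv n f ξ / n.factorial * (x - z) ^ n := by
  induction n generalizing f x with
  | zero => exact ⟨x, right_mem_uIcc, by simp⟩
  | succ n ih =>
    have hf0 : f z = 0 := by simpa using hz 0 (by omega)
    rcases eq_or_ne x z with rfl | hne
    · exact ⟨x, left_mem_uIcc, by simp [hf0]⟩
    have hd : ∀ y, HasDerivAt f (deriv f y) y := fun y =>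
      ((hf.differentiable (by simp)) y).hasDerivAt
    have hp : ∀ y, HasDerivAt (fun y => (y - z) ^ (n + 1)) ((n + 1 : ℝ) * (y - z) ^ n) y := by
      intro y
      simpa using ((hasDerivAt_id' y).sub_const z).fun_pow (n + 1)
    -- Cauchy's mean value theorem, for either order of the two points
    obtain ⟨c, hcmem, hcz, hc⟩ : ∃ c ∈ uIcc z x, c ≠ z ∧
        (x - z) ^ (n + 1) * deriv f c = f x * ((n + 1 : ℝ) * (c - z) ^ n) := by
      rcases lt_or_gt_of_ne hne with h | h
      · obtain ⟨c, hc, he⟩ := exists_ratio_hasDerivAt_eq_ratio_slope f (deriv f) h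
          hf.continuous.continuousOn (fun y _ => hd y) (fun y => (y - z) ^ (n + 1)) _
          (by fun_prop) (fun y _ => hp y)
        refine ⟨c, Icc_subset_uIcc' (Ioo_subset_Icc_self hc), hc.2.ne, ?_⟩
        simp only [hf0, sub_self, zero_pow (Nat.succ_ne_zero n)] at he
        linarith
      · obtain ⟨c, hc, he⟩ := exists_ratio_hasDerivAt_eq_ratio_slope f (deriv f) h
          hf.continuous.continuousOn (fun y _ => hd y) (fun y => (y - z) ^ (n + 1)) _
          (by fun_prop) (fun y _ => hp y)
        refine ⟨c, Icc_subset_uIcc (Ioo_subset_Icc_self hc), hc.1.ne', ?_⟩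
        simp only [hf0, sub_self, zero_pow (Nat.succ_ne_zero n)] at he
        linarith
    obtain ⟨ξ, hξ, he⟩ := ih (contDiff_infty_iff_deriv.1 hf).2 (fun l hl => by
      rw [← iteratedDeriv_succ']; exact hz (l + 1) (by omega)) c
    refine ⟨ξ, uIcc_subset_uIcc_left hcmem hξ, ?_⟩
    rw [← iteratedDeriv_succ'] at he
    rw [he] at hc
    have hcn : (c - z) ^ n ≠ 0 := pow_ne_zero _ (sub_ne_zero.2 hcz)
    have hn : (n.factorial : ℝ) ≠ 0 := by positivity
    have hn1 : (n + 1 : ℝ) ≠ 0 := by positivity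
    rw [Nat.factorial_succ]
    push_cast
    field_simp at hc ⊢
    linarith

/-- Behaviour of a function and of its derivatives near a zero of order `j`. -/
theorem HasZeroOfOrder.exists_bounds {α : ℝ → ℝ} (hα : ContDiff ℝ ∞ α) {z : ℝ} {j : ℕ}
    (h : HasZeroOfOrder α z j) :
    ∃ δ > 0, ∃ c > 0, ∃ K > 0, ∀ x, |x - z| < δ → c * |x - z| ^ j ≤ |α x| ∧
      ∀ l ≤ j, |iteratedDeriv l α x| ≤ K * |x - z| ^ (j - l) := by
  have hcont := hα.continuous_iteratedDeriv j (by exact_mod_cast le_top)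
  set a := |iteratedDeriv j α z| with ha
  have ha0 : 0 < a := abs_pos.2 h.2
  have hev : ∀ᶠ x in nhds z, a / 2 < |iteratedDeriv j α x| ∧ |iteratedDeriv j α x| < 2 * a := by
    have h1 := hcont.abs.continuousAt (x := z)
    exact (h1.eventually_const_lt (by linarith)).and (h1.eventually_lt_const (by linarith))
  obtain ⟨δ, hδ, hb⟩ := Metric.eventually_nhds_iff.1 hev
  have hseg : ∀ x, |x - z| < δ → ∀ ξ ∈ uIcc z x, dist ξ z < δ := fun x hx ξ hξ => by
    rw [Real.dist_eq]
    exact (abs_sub_left_of_mem_uIcc hξ).trans_lt hx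
  have hfac : (1 : ℝ) ≤ j.factorial := by exact_mod_cast j.factorial_pos
  refine ⟨δ, hδ, a / 2 / j.factorial, by positivity, 2 * a, by positivity, fun x hx =>
    ⟨?_, fun l hl => ?_⟩⟩
  · obtain ⟨ξ, hξ, he⟩ := exists_eq_iteratedDeriv_mul_pow hα h.1 x
    rw [he, abs_mul, abs_div, abs_pow, Nat.abs_cast]
    have := (hb (hseg x hx ξ hξ)).1
    gcongr
  · have hit : ∀ i, iteratedDeriv i (iteratedDeriv l α) = iteratedDeriv (i + l) α := by
      intro i
      simp only [iteratedDeriv_eq_iterate, Function.iterate_add_apply]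
    obtain ⟨ξ, hξ, he⟩ := exists_eq_iteratedDeriv_mul_pow (n := j - l)
      (f := iteratedDeriv l α) (z := z) (by
        rw [iteratedDeriv_eq_iterate]; exact hα.iterate_deriv l) (fun i hi => by
        rw [hit]; exact h.1 _ (by omega)) x
    rw [he, hit, Nat.sub_add_cancel hl, abs_mul, abs_div, abs_pow, Nat.abs_cast]
    have h1 := (hb (hseg x hx ξ hξ)).2.le
    have h2 : (1 : ℝ) ≤ (j - l).factorial := by exact_mod_cast (j - l).factorial_pos
    have h3 : |iteratedDeriv j α ξ| / (j - l).factorial ≤ 2 * a :=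
      (div_le_self (abs_nonneg _) h2).trans h1
    gcongr

theorem rpow_le_const_mul_rpow {h H a p : ℝ} (h0 : 0 < h) (hH : h ≤ H) (hpa : p ≤ a) :
    h ^ a ≤ H ^ (a - p) * h ^ p := by
  have : h ^ a = h ^ (a - p) * h ^ p := by rw [← Real.rpow_add h0]; congr 1; ring
  rw [this]
  gcongr

/-- The density of the squared loss of order that the degeneracy of `α` causes. -/
def degeneracyWeight (α q : ℝ → ℝ) (h x : ℝ) : ℝ := q x ^ 2 * (h ^ 2 / (α x ^ 2 + h ^ 2))

theorem degeneracyWeight_nonneg (α q : ℝ → ℝ) (h x : ℝ) : 0 ≤ degeneracyWeight α q h x := by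
  unfold degeneracyWeight; positivity

theorem div_add_sq_le_one (a h : ℝ) : h ^ 2 / (a ^ 2 + h ^ 2) ≤ 1 :=
  div_le_one_of_le₀ (by nlinarith [sq_nonneg a]) (by positivity)

theorem lintegral_inv_one_add_sq_le {C η : ℝ} (hC : 0 ≤ C) (hη : 0 < η) (z : ℝ) :
    ∫⁻ x, ENNReal.ofReal (C * (1 + ((x - z) / η) ^ 2)⁻¹) = ENNReal.ofReal (C * (η * Real.pi)) := by
  have h1 : ∫ x : ℝ, (1 + ((x - z) / η) ^ 2)⁻¹ = η * Real.pi := by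
    rw [integral_sub_right_eq_self (fun x => (1 + (x / η) ^ 2)⁻¹) z,
      Measure.integral_comp_div (fun x => (1 + x ^ 2)⁻¹) η, integral_univ_inv_one_add_sq,
      abs_of_pos hη, smul_eq_mul]
  have h2 : Integrable fun x : ℝ => (1 + ((x - z) / η) ^ 2)⁻¹ := by
    have := (integrable_inv_one_add_sq.comp_div hη.ne').comp_sub_right z
    exact this
  rw [← ofReal_integral_eq_lintegral_ofReal (h2.const_mul C)
    (ae_of_all _ fun x => by simp only [Pi.zero_apply]; positivity), integral_const_mul, h1]

/-- The weight is small in the mean near a zero of moderate order. -/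
theorem exists_lintegral_weight_le_of_order_le {α q : ℝ → ℝ} {z δ c W p : ℝ} {j : ℕ} (hj : 1 ≤ j)
    (hc : 0 < c) (hlow : ∀ x, |x - z| < δ → c * |x - z| ^ j ≤ |α x|)
    (hq : ∀ x ∈ Icc 0 (2 * Real.pi), |q x| ≤ W) (hp : p ≤ 1 / j) :
    ∃ C, 0 ≤ C ∧ ∀ h, 0 < h → h ≤ 2 * Real.pi →
      ∫⁻ x in {x | |x - z| < δ} ∩ Icc 0 (2 * Real.pi),
        ENNReal.ofReal (degeneracyWeight α q h x) ≤ ENNReal.ofReal (C * h ^ p) := by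
  set c' := min (c ^ 2) 1 with hc'
  have hc'0 : 0 < c' := lt_min (by positivity) one_pos
  refine ⟨W ^ 2 * (2 / c') * ((2 * Real.pi) ^ (1 / j - p) * Real.pi), by positivity,
    fun h h0 hH => ?_⟩
  set η := h ^ (1 / j : ℝ) with hη
  have hη0 : 0 < η := Real.rpow_pos_of_pos h0 _
  have hηj : η ^ j = h := by
    rw [hη, ← Real.rpow_natCast, ← Real.rpow_mul h0.le, one_div_mul_cancel (by positivity),
      Real.rpow_one]
  have hmeas : MeasurableSet ({x : ℝ | |x - z| < δ} ∩ Icc 0 (2 * Real.pi)) :=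
    (measurableSet_lt (by fun_prop) measurable_const).inter measurableSet_Icc
  calc _ ≤ ∫⁻ x in {x | |x - z| < δ} ∩ Icc 0 (2 * Real.pi),
        ENNReal.ofReal (W ^ 2 * (2 / c') * (1 + ((x - z) / η) ^ 2)⁻¹) := by
        refine setLIntegral_mono' hmeas fun x hx => ENNReal.ofReal_le_ofReal ?_
        have h1 : q x ^ 2 ≤ W ^ 2 := by
          rw [← sq_abs]; exact pow_le_pow_left₀ (abs_nonneg _) (hq x hx.2) 2
        rw [degeneracyWeight, mul_assoc]
        refine mul_le_mul h1 ?_ (by positivity) (by positivity)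
        have h2 : (c * |x - z| ^ j) ^ 2 ≤ α x ^ 2 := by
          rw [← sq_abs (α x)]; exact pow_le_pow_left₀ (by positivity) (hlow x hx.1) 2
        set y := |x - z| / η with hy
        have hy0 : 0 ≤ y := by positivity
        have hyx : |x - z| = y * η := by rw [hy, div_mul_cancel₀ _ hη0.ne']
        have hysq : ((x - z) / η) ^ 2 = y ^ 2 := by rw [hy, div_pow, div_pow, sq_abs]
        have h3 : c' * (1 + y ^ 2) / 2 ≤ 1 + c ^ 2 * (y ^ j) ^ 2 := by
          have e1 : c' ≤ c ^ 2 := min_le_left _ _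
          have e2 : c' ≤ 1 := min_le_right _ _
          rcases le_total y 1 with hy1 | hy1
          · have : y ^ 2 ≤ 1 := pow_le_one₀ hy0 hy1
            have : 0 ≤ c ^ 2 * (y ^ j) ^ 2 := by positivity
            nlinarith
          · have e3 : y ≤ y ^ j := by
              simpa using pow_le_pow_right₀ hy1 hj
            have e4 : y ^ 2 ≤ (y ^ j) ^ 2 := pow_le_pow_left₀ hy0 e3 2
            nlinarith [mul_le_mul e1 e4 (by positivity) (by positivity)]
        rw [hysq, ← div_eq_mul_inv, div_div, div_le_div_iff₀ (by positivity) (by positivity)]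
        rw [hyx, mul_pow, mul_pow y, hηj] at h2
        nlinarith [mul_le_mul_of_nonneg_right h3 (sq_nonneg h)]
    _ ≤ ∫⁻ x, ENNReal.ofReal (W ^ 2 * (2 / c') * (1 + ((x - z) / η) ^ 2)⁻¹) :=
        setLIntegral_le_lintegral _ _
    _ = ENNReal.ofReal (W ^ 2 * (2 / c') * (η * Real.pi)) :=
        lintegral_inv_one_add_sq_le (by positivity) hη0 z
    _ ≤ _ := by
        refine ENNReal.ofReal_le_ofReal ?_
        have := rpow_le_const_mul_rpow h0 hH hp
        rw [mul_assoc _ _ (h ^ p)]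
        refine mul_le_mul_of_nonneg_left ?_ (by positivity)
        nlinarith [mul_le_mul_of_nonneg_right this Real.pi_pos.le]

theorem lintegral_weight_le_of_pointwise {α q : ℝ → ℝ} {S : Set ℝ} (hS : MeasurableSet S)
    {h B : ℝ} (hB : ∀ x ∈ S ∩ Icc 0 (2 * Real.pi), degeneracyWeight α q h x ≤ B) :
    ∫⁻ x in S ∩ Icc 0 (2 * Real.pi), ENNReal.ofReal (degeneracyWeight α q h x)
      ≤ ENNReal.ofReal (2 * Real.pi * B) := by
  calc _ ≤ ∫⁻ x in S ∩ Icc 0 (2 * Real.pi), ENNReal.ofReal B :=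
        setLIntegral_mono' (hS.inter measurableSet_Icc) fun x hx =>
          ENNReal.ofReal_le_ofReal (hB x hx)
    _ ≤ ∫⁻ x in Icc 0 (2 * Real.pi), ENNReal.ofReal B :=
        lintegral_mono_set inter_subset_right
    _ = _ := by
        rw [setLIntegral_const, Real.volume_Icc, sub_zero, mul_comm,
          ← ENNReal.ofReal_mul Real.two_pi_pos.le]

/-- The weight is small near a zero of high order, if `q` is controlled by the derivatives of
order at most `k + 2`. -/
theorem exists_weight_le_of_order_gt {α q : ℝ → ℝ} {z δ c K : ℝ} {k j : ℕ} (hj : k + 4 ≤ j)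
    (hc : 0 < c) (hK : 0 < K)
    (hlow : ∀ x, |x - z| < δ → c * |x - z| ^ j ≤ |α x|)
    (hq : ∀ x, |x - z| < δ → |q x| ≤ K * |x - z| ^ (j - (k + 2))) :
    ∃ C, 0 ≤ C ∧ ∀ h, 0 < h → h ≤ 2 * Real.pi → ∀ x, |x - z| < δ →
      degeneracyWeight α q h x ≤ C * h ^ (1 / (k + 3 : ℝ)) := by
  have hjpos : (0 : ℝ) < j := by exact_mod_cast (show 0 < j by omega)
  have hexp : 1 / (k + 3 : ℝ) ≤ (2 * (j - (k + 2) : ℕ) : ℝ) / j := by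
    rw [div_le_div_iff₀ (by positivity) hjpos, Nat.cast_sub (by omega)]
    have : (k + 4 : ℝ) ≤ j := by exact_mod_cast hj
    push_cast
    nlinarith [(Nat.cast_nonneg k : (0 : ℝ) ≤ k)]
  refine ⟨K ^ 2 * (1 + 1 / c ^ 2) * (2 * Real.pi) ^ ((2 * (j - (k + 2) : ℕ) : ℝ) / j
    - 1 / (k + 3 : ℝ)), by positivity, fun h h0 hH x hx => ?_⟩
  have hmain := rpow_le_const_mul_rpow h0 hH hexp
  set η := h ^ (1 / j : ℝ) with hη
  have hη0 : 0 < η := Real.rpow_pos_of_pos h0 _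
  have hηj : η ^ j = h := by
    rw [hη, ← Real.rpow_natCast, ← Real.rpow_mul h0.le, one_div_mul_cancel hjpos.ne',
      Real.rpow_one]
  have hηe : h ^ ((2 * (j - (k + 2) : ℕ) : ℝ) / j) = (η ^ (j - (k + 2))) ^ 2 := by
    rw [← pow_mul, hη, ← Real.rpow_natCast, ← Real.rpow_mul h0.le]
    congr 1
    push_cast
    ring
  rw [hηe] at hmain
  set y := |x - z| with hy
  have hy0 : 0 ≤ y := abs_nonneg _
  have hq2 : q x ^ 2 ≤ K ^ 2 * (y ^ (j - (k + 2))) ^ 2 := by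
    rw [← sq_abs, ← mul_pow]; exact pow_le_pow_left₀ (abs_nonneg _) (hq x hx) 2
  have hkey : degeneracyWeight α q h x ≤ K ^ 2 * (1 + 1 / c ^ 2) * (η ^ (j - (k + 2))) ^ 2 := by
    rw [degeneracyWeight]
    rcases le_total y η with hle | hle
    · have h1 : (y ^ (j - (k + 2))) ^ 2 ≤ (η ^ (j - (k + 2))) ^ 2 := by gcongr
      calc q x ^ 2 * (h ^ 2 / (α x ^ 2 + h ^ 2)) ≤ q x ^ 2 * 1 :=
            mul_le_mul_of_nonneg_left (div_add_sq_le_one _ _) (sq_nonneg _)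
        _ ≤ K ^ 2 * (η ^ (j - (k + 2))) ^ 2 := by
            rw [mul_one]; exact hq2.trans (mul_le_mul_of_nonneg_left h1 (sq_nonneg _))
        _ ≤ _ := by
            have : 0 ≤ K ^ 2 * (1 / c ^ 2) * (η ^ (j - (k + 2))) ^ 2 := by positivity
            nlinarith
    · have hypos : 0 < y := hη0.trans_le hle
      have h2 : (c * y ^ j) ^ 2 ≤ α x ^ 2 := by
        rw [← sq_abs (α x)]; exact pow_le_pow_left₀ (by positivity) (hlow x hx) 2
      have hsplit : ∀ r : ℝ, r ^ j = r ^ (j - (k + 2)) * r ^ (k + 2) := fun r => by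
        rw [← pow_add]; congr 1; omega
      have h3 : h ^ 2 / (α x ^ 2 + h ^ 2) ≤ h ^ 2 / (c * y ^ j) ^ 2 :=
        div_le_div_of_nonneg_left (sq_nonneg _) (by positivity) (by nlinarith [sq_nonneg h])
      calc q x ^ 2 * (h ^ 2 / (α x ^ 2 + h ^ 2))
          ≤ (K ^ 2 * (y ^ (j - (k + 2))) ^ 2) * (h ^ 2 / (c * y ^ j) ^ 2) :=
            mul_le_mul hq2 h3 (by positivity) (by positivity)
        _ = K ^ 2 * (1 / c ^ 2) * (η ^ (j - (k + 2))) ^ 2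
              * ((η ^ (k + 2)) ^ 2 / (y ^ (k + 2)) ^ 2) := by
            rw [← hηj, hsplit y, hsplit η]
            field_simp
        _ ≤ K ^ 2 * (1 / c ^ 2) * (η ^ (j - (k + 2))) ^ 2 * 1 := by
            refine mul_le_mul_of_nonneg_left ?_ (by positivity)
            exact div_le_one_of_le₀ (by gcongr) (by positivity)
        _ ≤ _ := by
            have : 0 ≤ K ^ 2 * (η ^ (j - (k + 2))) ^ 2 := by positivity
            nlinarith
  calc _ ≤ _ := hkey
    _ ≤ K ^ 2 * (1 + 1 / c ^ 2) * ((2 * Real.pi) ^ ((2 * (j - (k + 2) : ℕ) : ℝ) / j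
        - 1 / (k + 3 : ℝ)) * h ^ (1 / (k + 3 : ℝ))) :=
        mul_le_mul_of_nonneg_left hmain (by positivity)
    _ = _ := by ring

/-! ### The total loss of order -/

/-- The size of the derivatives of `α` of order at most `k + 2`, increased by `γ`. -/
def derivSize (α : ℝ → ℝ) (γ : ℝ) (k : ℕ) (x : ℝ) : ℝ :=
  γ + ∑ l ∈ Finset.range (k + 3), |iteratedDeriv l α x|

section

variable {α : ℝ → ℝ} {γ : ℝ} {k m m' : ℕ}

theorem derivSize_nonneg (hγ : 0 ≤ γ) (x : ℝ) : 0 ≤ derivSize α γ k x :=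
  add_nonneg hγ (Finset.sum_nonneg fun _ _ => abs_nonneg _)

theorem continuous_derivSize (hα : ContDiff ℝ ∞ α) : Continuous (derivSize α γ k) := by
  refine continuous_const.add (continuous_finsetSum _ fun l _ => ?_)
  exact (hα.continuous_iteratedDeriv l (by exact_mod_cast le_top)).abs

theorem abs_iteratedDeriv_le_derivSize (hγ : 0 ≤ γ) {l : ℕ} (hl : l ≤ k + 2) (x : ℝ) :
    |iteratedDeriv l α x| ≤ derivSize α γ k x := by
  have := Finset.single_le_sum (f := fun l => |iteratedDeriv l α x|) (fun l _ => abs_nonneg _)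
    (Finset.mem_range.2 (show l < k + 3 by omega))
  exact this.trans (le_add_of_nonneg_left hγ)

theorem exists_derivSize_lipschitz (hα : ContDiff ℝ ∞ α) :
    ∃ K, 0 ≤ K ∧ ∀ x ∈ Icc 0 (2 * Real.pi), ∀ y ∈ Icc 0 (2 * Real.pi),
      |derivSize α γ k x - derivSize α γ k y| ≤ K * |x - y| := by
  have : ∀ l : ℕ, ∃ K, 0 ≤ K ∧ ∀ x ∈ Icc 0 (2 * Real.pi), ∀ y ∈ Icc 0 (2 * Real.pi),
      |(|iteratedDeriv l α x| - |iteratedDeriv l α y|)| ≤ K * |x - y| := by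
    intro l
    have hl : ContDiff ℝ ∞ (iteratedDeriv l α) := by
      rw [iteratedDeriv_eq_iterate]; exact hα.iterate_deriv l
    obtain ⟨Q, hQ, hj⟩ := exists_jetBound_of_contDiff 0 hl
    exact ⟨Q, by linarith, fun x hx y hy => (abs_abs_sub_abs_le _ _).trans (hj.2 x hx y hy)⟩
  choose K hK0 hK using this
  refine ⟨∑ l ∈ Finset.range (k + 3), K l, Finset.sum_nonneg fun l _ => hK0 l,
    fun x hx y hy => ?_⟩
  rw [derivSize, derivSize, add_sub_add_left_eq_sub, ← Finset.sum_sub_distrib, Finset.sum_mul]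
  exact (Finset.abs_sum_le_sum_abs _ _).trans (Finset.sum_le_sum fun l _ => hK l x hx y hy)

theorem continuous_degeneracyWeight {q : ℝ → ℝ} (hα : Continuous α) (hq : Continuous q) {h : ℝ}
    (h0 : 0 < h) : Continuous (degeneracyWeight α q h) := by
  unfold degeneracyWeight
  refine (hq.pow 2).mul (continuous_const.div (by fun_prop) fun x => ?_)
  positivity

theorem measurableSet_abs_sub_lt (z δ : ℝ) : MeasurableSet {x : ℝ | |x - z| < δ} :=
  measurableSet_lt (by fun_prop) measurable_const

/-- The zeros of `α` in a period are finite in number, and the integral of the weight is of the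
order `h ^ (1 / m')`. -/
theorem exists_weight_bound_and_finite_zeros (hα : ContDiff ℝ ∞ α) (hm : HasMaxZeroOrder α m)
    (hm' : 1 ≤ m') (hγ : 0 ≤ γ) (hcase : m ≤ m' ∨ (γ = 0 ∧ m' = k + 3)) :
    (∃ C, 0 ≤ C ∧ ∀ h, 0 < h → h ≤ 2 * Real.pi → ∫⁻ x in Icc 0 (2 * Real.pi),
      ENNReal.ofReal (degeneracyWeight α (derivSize α γ k) h x)
        ≤ ENNReal.ofReal (C * h ^ (1 / m' : ℝ))) ∧
    {x ∈ Icc 0 (2 * Real.pi) | α x = 0}.Finite := by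
  set q := derivSize α γ k with hq
  obtain ⟨W, hW⟩ := (isCompact_Icc (a := (0 : ℝ)) (b := 2 * Real.pi)).exists_bound_of_continuousOn
    (continuous_derivSize (γ := γ) (k := k) hα).continuousOn
  have hm'R : (1 : ℝ) ≤ m' := by exact_mod_cast hm'
  have hp1 : 1 / (m' : ℝ) ≤ 2 := by
    rw [div_le_iff₀ (by linarith)]; linarith
  -- both properties are local on the compact interval
  set P : Set ℝ → Prop := fun S =>
    (∃ C, 0 ≤ C ∧ ∀ h, 0 < h → h ≤ 2 * Real.pi → ∫⁻ x in S ∩ Icc 0 (2 * Real.pi),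
      ENNReal.ofReal (degeneracyWeight α q h x) ≤ ENNReal.ofReal (C * h ^ (1 / m' : ℝ))) ∧
    {x ∈ S ∩ Icc 0 (2 * Real.pi) | α x = 0}.Finite with hP
  suffices hPI : P (Icc 0 (2 * Real.pi)) by
    simpa only [hP, inter_self] using hPI
  refine isCompact_Icc.induction_on (p := P) ?_ ?_ ?_ ?_
  · exact ⟨⟨0, le_rfl, by simp⟩, by simp⟩
  · rintro S S' hS ⟨⟨C, hC, hCb⟩, hfin⟩
    exact ⟨⟨C, hC, fun h h0 hH => (lintegral_mono_set (inter_subset_inter_left _ hS)).trans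
      (hCb h h0 hH)⟩, hfin.subset fun x hx => ⟨⟨hS hx.1.1, hx.1.2⟩, hx.2⟩⟩
  · rintro S S' ⟨⟨C, hC, hCb⟩, hfin⟩ ⟨⟨C', hC', hCb'⟩, hfin'⟩
    refine ⟨⟨C + C', by positivity, fun h h0 hH => ?_⟩, (hfin.union hfin').subset ?_⟩
    · rw [union_inter_distrib_right, add_mul, ENNReal.ofReal_add (by positivity) (by positivity)]
      exact (lintegral_union_le _ _ _).trans (add_le_add (hCb h h0 hH) (hCb' h h0 hH))
    · rintro x ⟨⟨h1 | h1, h2⟩, h3⟩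
      · exact Or.inl ⟨⟨h1, h2⟩, h3⟩
      · exact Or.inr ⟨⟨h1, h2⟩, h3⟩
  · intro z _
    -- it suffices to treat a small ball around each point
    suffices h : ∃ δ > 0, P {x | |x - z| < δ} by
      obtain ⟨δ, hδ, h⟩ := h
      exact ⟨_, mem_nhdsWithin_of_mem_nhds (Metric.ball_mem_nhds z hδ), h⟩
    by_cases hz : α z = 0
    · obtain ⟨j, hjm, hj⟩ := hm.le z hz
      have hj1 : 1 ≤ j := by
        rcases Nat.eq_zero_or_pos j with rfl | h
        · exact absurd (by simpa using hz) hj.2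
        · exact h
      obtain ⟨δ₀, hδ₀, c, hc, K, hK, hb⟩ := hj.exists_bounds hα
      refine ⟨min δ₀ 1, lt_min hδ₀ one_pos, ?_, ?_⟩
      · have hlow : ∀ x, |x - z| < min δ₀ 1 → c * |x - z| ^ j ≤ |α x| := fun x hx =>
          (hb x (hx.trans_le (min_le_left _ _))).1
        by_cases hjm' : j ≤ m'
        · exact exists_lintegral_weight_le_of_order_le hj1 hc hlow hW
            (one_div_le_one_div_of_le (by exact_mod_cast hj1) (by exact_mod_cast hjm'))
        · obtain ⟨hγ0, hmk⟩ := hcase.resolve_left (by omega)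
          have hqb : ∀ x, |x - z| < min δ₀ 1 →
              |q x| ≤ (k + 3) * K * |x - z| ^ (j - (k + 2)) := by
            intro x hx
            rw [abs_of_nonneg (derivSize_nonneg hγ x), derivSize, hγ0, zero_add]
            have hx1 : |x - z| ≤ 1 := (hx.trans_le (min_le_right _ _)).le
            calc _ ≤ ∑ l ∈ Finset.range (k + 3), K * |x - z| ^ (j - (k + 2)) := by
                  refine Finset.sum_le_sum fun l hl => ?_
                  have hl' := Finset.mem_range.1 hl
                  refine ((hb x (hx.trans_le (min_le_left _ _))).2 l (by omega)).trans ?_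
                  refine mul_le_mul_of_nonneg_left ?_ hK.le
                  exact pow_le_pow_of_le_one (abs_nonneg _) hx1 (by omega)
              _ = _ := by simp; ring
          obtain ⟨C, hC, hCb⟩ := exists_weight_le_of_order_gt (k := k) (by omega) hc
            (by positivity) hlow hqb
          refine ⟨2 * Real.pi * C, by positivity, fun h h0 hH => ?_⟩
          refine (lintegral_weight_le_of_pointwise (measurableSet_abs_sub_lt z _)
            fun x hx => hCb h h0 hH x hx.1).trans (le_of_eq ?_)
          rw [hmk]; push_cast; ring_nf
      · refine (finite_singleton z).subset ?_
        rintro x ⟨⟨hx, -⟩, hx0⟩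
        have := (hb x (lt_of_lt_of_le hx (min_le_left _ _))).1
        rw [hx0, abs_zero] at this
        by_contra hne
        have : 0 < c * |x - z| ^ j :=
          mul_pos hc (pow_pos (abs_pos.2 (sub_ne_zero.2 hne)) _)
        linarith
    · set c := |α z| / 2 with hc
      have hc0 : 0 < c := by have := abs_pos.2 hz; positivity
      obtain ⟨δ, hδ, hb⟩ := Metric.eventually_nhds_iff.1
        (hα.continuous.abs.continuousAt.eventually_const_lt
          (show c < |α z| by simp only [hc]; linarith [abs_pos.2 hz]))
      refine ⟨δ, hδ, ⟨2 * Real.pi * (W ^ 2 / c ^ 2 * (2 * Real.pi) ^ (2 - 1 / (m' : ℝ))),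
        by positivity, fun h h0 hH => ?_⟩, ?_⟩
      · refine (lintegral_weight_le_of_pointwise (B := W ^ 2 / c ^ 2 * h ^ 2)
          (measurableSet_abs_sub_lt z _) fun x hx => ?_).trans (ENNReal.ofReal_le_ofReal ?_)
        · have h1 : q x ^ 2 ≤ W ^ 2 := by
            rw [← sq_abs]; exact pow_le_pow_left₀ (abs_nonneg _) (hW x hx.2) 2
          have h2 : c ^ 2 ≤ α x ^ 2 := by
            rw [← sq_abs (α x)]
            exact pow_le_pow_left₀ hc0.le (hb hx.1).le 2
          rw [degeneracyWeight, div_mul_eq_mul_div, mul_div_assoc]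
          exact mul_le_mul h1 (div_le_div_of_nonneg_left (sq_nonneg _) (by positivity)
            (by nlinarith [sq_nonneg h])) (by positivity) (by positivity)
        · have h3 := rpow_le_const_mul_rpow h0 hH hp1
          rw [Real.rpow_two] at h3
          calc _ ≤ 2 * Real.pi * (W ^ 2 / c ^ 2 * ((2 * Real.pi) ^ (2 - 1 / (m' : ℝ))
                * h ^ (1 / (m' : ℝ)))) := by gcongr
            _ = _ := by ring
      · refine (finite_empty).subset ?_
        rintro x ⟨⟨hx, -⟩, hx0⟩
        have := hb (y := x) hx
        rw [hx0, abs_zero] at this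
        linarith

end

/-! ### Sums over the elements of a mesh -/

namespace Mesh

variable {N : ℕ} (M : Mesh N)

theorem left_lt_right (i : Fin N) : M.left i < M.right i :=
  M.strictMono (Fin.castSucc_lt_succ)

theorem len_pos (i : Fin N) : 0 < M.len i := sub_pos.2 (M.left_lt_right i)

theorem node_mem (j : Fin (N + 1)) : M.node j ∈ Icc 0 (2 * Real.pi) := by
  constructor
  · rw [← M.first]; exact M.strictMono.monotone (Fin.zero_le _)
  · rw [← M.last]; exact M.strictMono.monotone (Fin.le_last _)

theorem left_mem (i : Fin N) : M.left i ∈ Icc 0 (2 * Real.pi) := M.node_mem _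

theorem right_mem (i : Fin N) : M.right i ∈ Icc 0 (2 * Real.pi) := M.node_mem _

theorem element_subset (i : Fin N) : Icc (M.left i) (M.right i) ⊆ Icc 0 (2 * Real.pi) :=
  Icc_subset_Icc (M.left_mem i).1 (M.right_mem i).2

theorem len_le_size (i : Fin N) : M.len i ≤ M.size :=
  le_ciSup (f := M.len) (Set.finite_range _).bddAbove i

theorem size_pos [NeZero N] : 0 < M.size := (M.len_pos 0).trans_le (M.len_le_size 0)

theorem size_le [NeZero N] : M.size ≤ 2 * Real.pi :=
  ciSup_le fun i => by
    have h1 := (M.left_mem i).1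
    have h2 := (M.right_mem i).2
    rw [len]; linarith

theorem sum_integral (f : ℝ → ℝ) (hf : Continuous f) :
    ∑ i, ∫ x in (M.left i)..(M.right i), f x = ∫ x in (0 : ℝ)..(2 * Real.pi), f x := by
  set a : ℕ → ℝ := fun n => if h : n < N + 1 then M.node ⟨n, h⟩ else 0 with ha
  have h1 := intervalIntegral.sum_integral_adjacent_intervals (μ := volume) (f := f) (a := a)
    (n := N) (fun i _ => hf.intervalIntegrable _ _)
  have h2 : a 0 = 0 := by simp only [ha, Nat.zero_lt_succ, dif_pos]; exact M.first
  have h3 : a N = 2 * Real.pi := by simp only [ha, Nat.lt_succ_self, dif_pos]; exact M.last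
  rw [h2, h3] at h1
  rw [← h1, Finset.sum_range]
  refine Finset.sum_congr rfl fun i _ => ?_
  have h4 : a i = M.left i := by
    simp only [ha, dif_pos (show (i : ℕ) < N + 1 by omega)]; rfl
  have h5 : a (i + 1) = M.right i := by
    simp only [ha, dif_pos (show (i : ℕ) + 1 < N + 1 by omega)]; rfl
  rw [h4, h5]

theorem sum_len : ∑ i, M.len i = 2 * Real.pi := by
  have := M.sum_integral (fun _ => 1) continuous_const
  simpa [len] using this

theorem sum_len_mul_le {f : ℝ → ℝ} (hf : Continuous f) {c : Fin N → ℝ}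
    (hc : ∀ i, ∀ x ∈ Icc (M.left i) (M.right i), c i ≤ f x) :
    ∑ i, M.len i * c i ≤ ∫ x in (0 : ℝ)..(2 * Real.pi), f x := by
  rw [← M.sum_integral f hf]
  refine Finset.sum_le_sum fun i _ => ?_
  have : M.len i * c i = ∫ _ in (M.left i)..(M.right i), c i := by simp [len]
  rw [this]
  exact intervalIntegral.integral_mono_on (M.left_lt_right i).le (by simp)
    (hf.intervalIntegrable _ _) (hc i)

/-- The element contains a zero of `α`. -/
def HasZero (α : ℝ → ℝ) (i : Fin N) : Prop := ∃ z ∈ Icc (M.left i) (M.right i), α z = 0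

/-- The elements that contain a zero of `α` have total length of the order of the mesh size. -/
theorem exists_sum_len_hasZero_le {α : ℝ → ℝ}
    (hfin : {x ∈ Icc 0 (2 * Real.pi) | α x = 0}.Finite) :
    ∃ C, 0 ≤ C ∧ ∀ (N : ℕ) [NeZero N] (M : Mesh N),
      ∑ i, M.len i * (open Classical in if M.HasZero α i then 1 else 0) ≤ C * M.size := by
  classical
  set Z := hfin.toFinset with hZ
  refine ⟨2 * Real.pi * Z.card, by positivity, fun N _ M => ?_⟩
  have hs := M.size_pos
  calc _ ≤ ∑ i, ∑ z ∈ Z, M.len i * (if z ∈ Icc (M.left i) (M.right i) then 1 else 0) := by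
        refine Finset.sum_le_sum fun i _ => ?_
        have h0 : ∀ z ∈ Z, 0 ≤ M.len i * (if z ∈ Icc (M.left i) (M.right i) then (1 : ℝ) else 0) :=
          fun z _ => mul_nonneg (M.len_pos i).le (by split_ifs <;> norm_num)
        split_ifs with h
        · obtain ⟨z, hz, hz0⟩ := h
          refine le_trans ?_ (Finset.single_le_sum h0 (a := z) ?_)
          · rw [if_pos hz]
          · rw [hZ, Set.Finite.mem_toFinset]
            exact ⟨M.element_subset i hz, hz0⟩
        · rw [mul_zero]; exact Finset.sum_nonneg h0
    _ = ∑ z ∈ Z, ∑ i, M.len i * (if z ∈ Icc (M.left i) (M.right i) then 1 else 0) :=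
        Finset.sum_comm
    _ ≤ ∑ z ∈ Z, 2 * Real.pi * M.size := by
        refine Finset.sum_le_sum fun z _ => ?_
        have hcont : Continuous fun x => 2 * (1 + ((x - z) / M.size) ^ 2)⁻¹ := by
          refine continuous_const.mul (Continuous.inv₀ (by fun_prop) fun x => ?_)
          positivity
        refine (M.sum_len_mul_le hcont fun i x hx => ?_).trans ?_
        · split_ifs with h
          · have : |(x - z) / M.size| ≤ 1 := by
              rw [abs_div, abs_of_pos hs, div_le_one hs]
              refine le_trans ?_ (M.len_le_size i)
              rw [len, abs_le]
              constructor <;> linarith [hx.1, hx.2, h.1, h.2]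
            have h2 : ((x - z) / M.size) ^ 2 ≤ 1 := by
              rw [← sq_abs]; exact pow_le_one₀ (abs_nonneg _) this
            rw [← div_eq_mul_inv, le_div_iff₀ (by positivity)]
            linarith
          · positivity
        · have h1 := lintegral_inv_one_add_sq_le (C := 2) (by norm_num) hs z
          have h2 := ofReal_integral_eq_lintegral_ofReal
            (μ := volume.restrict (Ioc 0 (2 * Real.pi)))
            (hcont.integrableOn_Ioc (μ := volume) (a := 0) (b := 2 * Real.pi))
            (ae_of_all _ fun x => by simp only [Pi.zero_apply]; positivity)
          rw [intervalIntegral.integral_of_le Real.two_pi_pos.le]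
          have h3 := (h2.trans_le (setLIntegral_le_lintegral _ _)).trans_eq h1
          rw [ENNReal.ofReal_le_ofReal_iff (by positivity)] at h3
          linarith
    _ = _ := by rw [Finset.sum_const, nsmul_eq_mul]; ring

/-- The size of the correction function on an element, relative to its coefficient: `h / |α|`
where `|α|` is large compared to the mesh size `h`, and `1` elsewhere. -/
def damping (α : ℝ → ℝ) (K : ℝ) (i : Fin N) : ℝ :=
  if 2 * K * M.size < |α (M.left i)| then M.size / |α (M.left i)| else 1

theorem damping_nonneg (α : ℝ → ℝ) (K : ℝ) (i : Fin N) [NeZero N] : 0 ≤ M.damping α K i := by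
  unfold damping
  have := M.size_pos
  split_ifs <;> positivity

theorem abs_sub_left_le (i : Fin N) {x : ℝ} (hx : x ∈ Icc (M.left i) (M.right i)) :
    |x - M.left i| ≤ M.size := by
  rw [abs_of_nonneg (sub_nonneg.2 hx.1)]
  exact le_trans (by rw [len]; linarith [hx.2]) (M.len_le_size i)

/-- Discrete form of the bound for the weight: derivative size and damping factor are comparable to
their values at the left end all over the element. -/
theorem exists_sum_damping_le {α : ℝ → ℝ} {γ K p C₀ : ℝ} {k : ℕ} (hα : ContDiff ℝ ∞ α)
    (hγ : 0 ≤ γ) (hK : 1 ≤ K)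
    (hKα : ∀ x ∈ Icc 0 (2 * Real.pi), ∀ y ∈ Icc 0 (2 * Real.pi), |α x - α y| ≤ K * |x - y|)
    (hp : p ≤ 2) (hC₀ : 0 ≤ C₀)
    (hw : ∀ h, 0 < h → h ≤ 2 * Real.pi → ∫⁻ x in Icc 0 (2 * Real.pi),
      ENNReal.ofReal (degeneracyWeight α (derivSize α γ k) h x) ≤ ENNReal.ofReal (C₀ * h ^ p)) :
    ∃ C L, 0 ≤ C ∧ 0 ≤ L ∧ ∀ (N : ℕ) [NeZero N] (M : Mesh N),
      (∀ i, ∀ x ∈ Icc (M.left i) (M.right i),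
        derivSize α γ k x ≤ derivSize α γ k (M.left i) + L * M.size) ∧
      ∑ i, M.len i * ((derivSize α γ k (M.left i) + L * M.size) * M.damping α K i) ^ 2
        ≤ C * M.size ^ p := by
  obtain ⟨L, hL, hLq⟩ := exists_derivSize_lipschitz (γ := γ) (k := k) hα
  set q := derivSize α γ k with hq
  set D : ℝ := 2 * (9 * K ^ 2 + 1) with hD
  refine ⟨D * C₀ + 8 * L ^ 2 * (2 * Real.pi) * (2 * Real.pi) ^ (2 - p), L, by positivity, hL,
    fun N _ M => ⟨fun i x hx => ?_, ?_⟩⟩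
  · have h1 := hLq x (M.element_subset i hx) (M.left i) (M.left_mem i)
    have h2 := mul_le_mul_of_nonneg_left (M.abs_sub_left_le i hx) hL
    have h3 := le_abs_self (q x - q (M.left i))
    linarith
  · have hs := M.size_pos
    have hcont := continuous_degeneracyWeight (h := M.size) hα.continuous
      (continuous_derivSize (γ := γ) (k := k) hα) hs
    have hint : ∫ x in (0 : ℝ)..(2 * Real.pi), degeneracyWeight α q M.size x
        ≤ C₀ * M.size ^ p := by
      rw [intervalIntegral.integral_of_le Real.two_pi_pos.le, ← integral_Icc_eq_integral_Ioc]
      have h2 := ofReal_integral_eq_lintegral_ofReal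
        (μ := volume.restrict (Icc 0 (2 * Real.pi)))
        (hcont.integrableOn_Icc (μ := volume) (a := 0) (b := 2 * Real.pi))
        (ae_of_all _ fun x => degeneracyWeight_nonneg α q M.size x)
      have h3 := h2.trans_le (hw M.size hs M.size_le)
      rwa [ENNReal.ofReal_le_ofReal_iff (by positivity)] at h3
    have hcont' : Continuous fun x => D * degeneracyWeight α q M.size x + 8 * L ^ 2 * M.size ^ 2 :=
      (continuous_const.mul hcont).add continuous_const
    refine (M.sum_len_mul_le hcont' fun i x hx => ?_).trans ?_
    · have hxm := M.element_subset i hx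
      have h1 := hLq (M.left i) (M.left_mem i) x hxm
      have h2 := M.abs_sub_left_le i hx
      rw [abs_sub_comm] at h2
      have h3 := mul_le_mul_of_nonneg_left h2 hL
      have h4 := le_abs_self (q (M.left i) - q x)
      have hq0 : 0 ≤ q x := derivSize_nonneg hγ x
      have hql0 : 0 ≤ q (M.left i) := derivSize_nonneg hγ _
      have hLs : 0 ≤ L * M.size := by positivity
      have h5 : (q (M.left i) + L * M.size) ^ 2 ≤ 2 * q x ^ 2 + 8 * (L * M.size) ^ 2 := by
        have : q (M.left i) + L * M.size ≤ q x + 2 * (L * M.size) := by linarith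
        nlinarith [sq_nonneg (q x - 2 * (L * M.size)), pow_le_pow_left₀ (by linarith) this 2]
      have h6 : M.damping α K i ^ 2 ≤ 1 := by
        refine pow_le_one₀ (M.damping_nonneg α K i) ?_
        unfold damping
        split_ifs with h
        · refine div_le_one_of_le₀ ?_ (abs_nonneg _)
          nlinarith
        · exact le_rfl
      -- the damping factor is comparable to the weight all over the element
      have h7 : M.damping α K i ^ 2 ≤ (9 * K ^ 2 + 1) * (M.size ^ 2 / (α x ^ 2 + M.size ^ 2)) := by
        have h8 := hKα x hxm (M.left i) (M.left_mem i)
        have h9 : |x - M.left i| ≤ M.size := M.abs_sub_left_le i hx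
        have h10 := mul_le_mul_of_nonneg_left h9 (by linarith : (0 : ℝ) ≤ K)
        have h11 : |α x| ≤ |α (M.left i)| + K * M.size := by
          have := abs_sub_abs_le_abs_sub (α x) (α (M.left i))
          linarith
        have hKs : 0 < K * M.size := by positivity
        rw [← mul_div_assoc, le_div_iff₀ (by positivity)]
        unfold damping
        split_ifs with h
        · have hpos : 0 < |α (M.left i)| := by nlinarith
          rw [div_pow, div_mul_eq_mul_div, div_le_iff₀ (by positivity)]
          have e1 : |α x| ≤ 2 * |α (M.left i)| := by nlinarith
          have e2 : α x ^ 2 ≤ 4 * |α (M.left i)| ^ 2 := by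
            rw [← sq_abs (α x)]
            nlinarith [pow_le_pow_left₀ (abs_nonneg _) e1 2]
          have e3 : M.size ^ 2 ≤ |α (M.left i)| ^ 2 :=
            pow_le_pow_left₀ hs.le (by nlinarith) 2
          have e4 : α x ^ 2 + M.size ^ 2 ≤ (9 * K ^ 2 + 1) * |α (M.left i)| ^ 2 := by
            nlinarith [sq_nonneg |α (M.left i)|,
              mul_nonneg (sub_nonneg.2 hK) (by linarith : (0:ℝ) ≤ K + 1)]
          nlinarith [mul_le_mul_of_nonneg_left e4 (sq_nonneg M.size)]
        · rw [not_lt] at h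
          have e1 : |α x| ≤ 3 * (K * M.size) := by linarith
          have e2 : α x ^ 2 ≤ 9 * (K * M.size) ^ 2 := by
            rw [← sq_abs (α x)]
            nlinarith [pow_le_pow_left₀ (abs_nonneg _) e1 2]
          nlinarith
      rw [mul_pow, degeneracyWeight]
      have hd0 := sq_nonneg (M.damping α K i)
      calc _ ≤ (2 * q x ^ 2 + 8 * (L * M.size) ^ 2) * M.damping α K i ^ 2 :=
            mul_le_mul_of_nonneg_right h5 hd0
        _ = 2 * q x ^ 2 * M.damping α K i ^ 2 + 8 * (L * M.size) ^ 2 * M.damping α K i ^ 2 := by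
            ring
        _ ≤ 2 * q x ^ 2 * ((9 * K ^ 2 + 1) * (M.size ^ 2 / (α x ^ 2 + M.size ^ 2)))
            + 8 * (L * M.size) ^ 2 * 1 :=
            add_le_add (mul_le_mul_of_nonneg_left h7 (by positivity))
              (mul_le_mul_of_nonneg_left h6 (by positivity))
        _ = _ := by rw [hD]; ring
    · have hDi : IntervalIntegrable (fun x => D * degeneracyWeight α q M.size x) volume 0
          (2 * Real.pi) := (continuous_const.mul hcont).intervalIntegrable _ _
      rw [intervalIntegral.integral_add hDi intervalIntegrable_const,
        intervalIntegral.integral_const_mul, intervalIntegral.integral_const]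
      have h1 := rpow_le_const_mul_rpow hs M.size_le hp
      rw [Real.rpow_two] at h1
      rw [sub_zero, smul_eq_mul, add_mul]
      refine add_le_add ?_ ?_
      · rw [mul_assoc D]; exact mul_le_mul_of_nonneg_left hint (by positivity)
      · calc _ ≤ 2 * Real.pi * (8 * L ^ 2 * ((2 * Real.pi) ^ (2 - p) * M.size ^ p)) := by gcongr
          _ = _ := by ring

end Mesh

/-! ### Integrals of polynomials over the reference element `[-1, 1]` -/

/-- The integral of a polynomial over `[-1, 1]`. -/
def polyInt : ℝ[X] →ₗ[ℝ] ℝ where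
  toFun p := ∫ x in (-1 : ℝ)..1, p.eval x
  map_add' p q := by
    simp only [eval_add]
    exact intervalIntegral.integral_add (p.continuous.intervalIntegrable _ _)
      (q.continuous.intervalIntegrable _ _)
  map_smul' c p := by
    simp only [eval_smul, smul_eq_mul, RingHom.id_apply]
    exact intervalIntegral.integral_const_mul _ _

theorem polyInt_apply (p : ℝ[X]) : polyInt p = ∫ x in (-1 : ℝ)..1, p.eval x := rfl

theorem polyInt_C_mul (c : ℝ) (p : ℝ[X]) : polyInt (C c * p) = c * polyInt p := by
  rw [C_mul', map_smul, smul_eq_mul]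

theorem integral_derivative (p : ℝ[X]) (a b : ℝ) :
    ∫ x in a..b, (derivative p).eval x = p.eval b - p.eval a :=
  intervalIntegral.integral_eq_sub_of_hasDerivAt (fun x _ => p.hasDerivAt x)
    ((derivative p).continuous.intervalIntegrable _ _)

theorem polyInt_derivative_mul (p q : ℝ[X]) :
    polyInt (derivative p * q)
      = p.eval 1 * q.eval 1 - p.eval (-1) * q.eval (-1) - polyInt (p * derivative q) := by
  have h := integral_derivative (p * q) (-1) 1
  rw [← polyInt_apply, derivative_mul, map_add, eval_mul, eval_mul] at h
  linarith

theorem polyInt_iterate_derivative_mul {P : ℝ[X]} {n : ℕ}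
    (hP : ∀ i < n, (derivative^[i] P).eval 1 = 0 ∧ (derivative^[i] P).eval (-1) = 0) (q : ℝ[X]) :
    polyInt (derivative^[n] P * q) = (-1) ^ n * polyInt (P * derivative^[n] q) := by
  induction n generalizing q with
  | zero => simp
  | succ n ih =>
    rw [Function.iterate_succ_apply', polyInt_derivative_mul, (hP n (by omega)).1,
      (hP n (by omega)).2, ih (fun i hi => hP i (by omega)), ← Function.iterate_succ_apply]
    ring

/-! ### Legendre polynomials -/

/-- Orthogonality of the Legendre polynomials, by repeated integration by parts in Rodrigues'
formula. -/
theorem polyInt_legendre_mul {n : ℕ} {q : ℝ[X]} (hq : q.natDegree < n) :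
    polyInt (legendre n * q) = 0 := by
  have hdvd : ∀ a : ℝ, (a = 1 ∨ a = -1) → ∀ i < n,
      (derivative^[i] ((X ^ 2 - 1 : ℝ[X]) ^ n)).eval a = 0 := by
    intro a ha i hi
    have h1 : (X - C a) ∣ (X ^ 2 - 1 : ℝ[X]) := by
      rw [dvd_iff_isRoot]
      rcases ha with rfl | rfl <;> simp
    have h2 := pow_sub_dvd_iterate_derivative_of_pow_dvd i (pow_dvd_pow_of_dvd h1 n)
    have h3 : (X - C a) ∣ derivative^[i] ((X ^ 2 - 1 : ℝ[X]) ^ n) :=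
      (dvd_pow_self _ (by omega)).trans h2
    exact dvd_iff_isRoot.1 h3
  rw [legendre, mul_assoc, polyInt_C_mul, polyInt_iterate_derivative_mul fun i hi =>
    ⟨hdvd 1 (Or.inl rfl) i hi, hdvd (-1) (Or.inr rfl) i hi⟩,
    iterate_derivative_eq_zero hq, mul_zero, map_zero, mul_zero, mul_zero]

theorem natDegree_sq_sub_one_pow (n : ℕ) : ((X ^ 2 - 1 : ℝ[X]) ^ n).natDegree = n + n := by
  have : (X ^ 2 - 1 : ℝ[X]).natDegree = 2 := natDegree_X_pow_sub_C (r := (1 : ℝ))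
  rw [natDegree_pow, this]; ring

theorem natDegree_legendre_le (n : ℕ) : (legendre n).natDegree ≤ n := by
  refine (natDegree_C_mul_le _ _).trans ((natDegree_iterate_derivative _ _).trans ?_)
  rw [natDegree_sq_sub_one_pow]; omega

theorem legendre_coeff_ne_zero (n : ℕ) : (legendre n).coeff n ≠ 0 := by
  have hm : (X ^ 2 - 1 : ℝ[X]).Monic := monic_X_pow_sub_C (1 : ℝ) two_ne_zero
  have h1 : ((X ^ 2 - 1 : ℝ[X]) ^ n).coeff (n + n) = 1 := by
    have := (hm.pow n).coeff_natDegree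
    rwa [natDegree_sq_sub_one_pow] at this
  rw [legendre, coeff_C_mul, coeff_iterate_derivative, h1]
  refine mul_ne_zero (by positivity) ?_
  rw [nsmul_eq_mul, mul_one]
  exact_mod_cast (Nat.descFactorial_pos.2 (by omega)).ne'

/-- A nodal polynomial inherits the orthogonality of a polynomial of the same degree with the
same zeros. -/
theorem polyInt_nodal_mul {ι : Type*} [DecidableEq ι] {P : ℝ[X]} {n d : ℕ} (hP : P.natDegree ≤ n)
    (hPn : P.coeff n ≠ 0) (hort : ∀ q : ℝ[X], q.natDegree < d → polyInt (P * q) = 0)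
    {S : Finset ι} (hS : S.card = n) {v : ι → ℝ} (hv : Set.InjOn v S)
    (h0 : ∀ j ∈ S, P.eval (v j) = 0) {q : ℝ[X]} (hq : q.natDegree < d) :
    polyInt (Lagrange.nodal S v * q) = 0 := by
  have heq : P = C (P.coeff n) * Lagrange.nodal S v := by
    refine Polynomial.eq_of_degree_sub_lt_of_eval_index_eq S hv ?_ fun i hi => by
      rw [h0 i hi, eval_mul, Lagrange.eval_nodal_at_node hi, mul_zero]
    rw [hS, degree_lt_iff_coeff_zero]
    intro l hl
    have hnod : (Lagrange.nodal S v).natDegree = n := by rw [Lagrange.natDegree_nodal, hS]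
    rw [coeff_sub, coeff_C_mul]
    rcases hl.eq_or_lt with rfl | hlt
    · have := (Lagrange.nodal_monic (s := S) (v := v)).coeff_natDegree
      rw [hnod] at this
      rw [this, mul_one, sub_self]
    · rw [coeff_eq_zero_of_natDegree_lt (hP.trans_lt hlt),
        coeff_eq_zero_of_natDegree_lt (hnod.trans_lt hlt), mul_zero, sub_self]
  have := hort q hq
  rw [heq, mul_assoc, polyInt_C_mul] at this
  exact (mul_eq_zero.1 this).resolve_left hPn

section Nodes

variable {k : ℕ} {s : Fin (k + 2) → ℝ}

theorem IsPartition.mem_Icc (hs : IsPartition s) (j : Fin (k + 2)) : s j ∈ Icc (-1 : ℝ) 1 :=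
  ⟨by rw [← hs.first]; exact hs.strictMono.monotone (Fin.zero_le _),
    by rw [← hs.last]; exact hs.strictMono.monotone (Fin.le_last _)⟩

theorem natDegree_lt_of_degree_lt_natCast (hk : 1 ≤ k) {p : ℝ[X]} (h : p.degree < k) :
    p.natDegree < k := by
  rcases eq_or_ne p 0 with rfl | hp
  · rw [natDegree_zero]; omega
  · exact (natDegree_lt_iff_degree_lt hp).2 h

theorem natDegree_legendre_sub_le (k : ℕ) :
    (legendre (k + 1) - legendre k).natDegree ≤ k + 1 :=
  (natDegree_sub_le _ _).trans (max_le (natDegree_legendre_le _)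
    ((natDegree_legendre_le _).trans (by omega)))

theorem natDegree_legendre_add_le (k : ℕ) :
    (legendre (k + 1) + legendre k).natDegree ≤ k + 1 :=
  (natDegree_add_le _ _).trans (max_le (natDegree_legendre_le _)
    ((natDegree_legendre_le _).trans (by omega)))

theorem legendre_sub_coeff_ne_zero (k : ℕ) : (legendre (k + 1) - legendre k).coeff (k + 1) ≠ 0 := by
  rw [coeff_sub, coeff_eq_zero_of_natDegree_lt (p := legendre k)
    ((natDegree_legendre_le k).trans_lt (by omega)), sub_zero]
  exact legendre_coeff_ne_zero _

theorem legendre_add_coeff_ne_zero (k : ℕ) : (legendre (k + 1) + legendre k).coeff (k + 1) ≠ 0 := by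
  rw [coeff_add, coeff_eq_zero_of_natDegree_lt (p := legendre k)
    ((natDegree_legendre_le k).trans_lt (by omega)), add_zero]
  exact legendre_coeff_ne_zero _

theorem IsRightRadau.polyInt_nodal_mul (hs : IsRightRadau s) {q : ℝ[X]} (hq : q.natDegree < k) :
    polyInt (Lagrange.nodal (Finset.univ.erase 0) s * q) = 0 :=
  SpectralVolume.polyInt_nodal_mul (natDegree_legendre_sub_le k) (legendre_sub_coeff_ne_zero k)
    (fun q hq => by
      rw [sub_mul, map_sub, polyInt_legendre_mul (by omega), polyInt_legendre_mul hq, sub_zero])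
    (by simp) hs.1.strictMono.injective.injOn (fun j hj => hs.2 j (Finset.ne_of_mem_erase hj)) hq

theorem IsLeftRadau.polyInt_nodal_mul (hs : IsLeftRadau s) {q : ℝ[X]} (hq : q.natDegree < k) :
    polyInt (Lagrange.nodal (Finset.univ.erase (Fin.last (k + 1))) s * q) = 0 :=
  SpectralVolume.polyInt_nodal_mul (natDegree_legendre_add_le k) (legendre_add_coeff_ne_zero k)
    (fun q hq => by
      rw [add_mul, map_add, polyInt_legendre_mul (by omega), polyInt_legendre_mul hq, add_zero])
    (by simp) hs.1.strictMono.injective.injOn (fun j hj => hs.2 j (Finset.ne_of_mem_erase hj)) hq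

/-- The indices of the interior partition points. -/
def interior (k : ℕ) : Finset (Fin (k + 2)) := (Finset.univ.erase 0).erase (Fin.last (k + 1))

theorem card_interior (k : ℕ) : (interior k).card = k := by
  rw [interior, Finset.card_erase_of_mem, Finset.card_erase_of_mem (Finset.mem_univ _)]
  · simp
  · simp [Fin.ext_iff]

theorem IsGauss.polyInt_nodal_mul (hs : IsGauss s) {q : ℝ[X]} (hq : q.natDegree < k) :
    polyInt (Lagrange.nodal (interior k) s * q) = 0 :=
  SpectralVolume.polyInt_nodal_mul (natDegree_legendre_le k) (legendre_coeff_ne_zero k)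
    (fun q hq => polyInt_legendre_mul hq)
    (card_interior k) hs.1.strictMono.injective.injOn
    (fun j hj => hs.2 j (by simp [interior] at hj; exact hj.2)
      (by simp [interior] at hj; exact hj.1)) hq

theorem nodal_erase_zero (hs : IsPartition s) :
    Lagrange.nodal (Finset.univ.erase 0) s = (X - C 1) * Lagrange.nodal (interior k) s := by
  rw [interior, ← hs.last]
  exact Lagrange.nodal_eq_mul_nodal_erase (by simp [Fin.ext_iff])

theorem nodal_erase_last (hs : IsPartition s) :
    Lagrange.nodal (Finset.univ.erase (Fin.last (k + 1))) s
      = (X - C (-1)) * Lagrange.nodal (interior k) s := by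
  rw [interior, Finset.erase_right_comm, ← hs.first]
  exact Lagrange.nodal_eq_mul_nodal_erase (by simp [Fin.ext_iff])

/-- The nodal polynomial of the interpolation nodes left when the point of index `o` is omitted. -/
def nodalOmit (s : Fin (k + 2) → ℝ) (o : Fin (k + 2)) : ℝ[X] :=
  Lagrange.nodal Finset.univ fun j => s (o.succAbove j)

theorem nodalOmit_eq (o : Fin (k + 2)) :
    nodalOmit s o = Lagrange.nodal (Finset.univ.erase o) s := by
  rw [nodalOmit, Lagrange.nodal, Lagrange.nodal]
  refine Finset.prod_bij (fun j _ => o.succAbove j)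
    (fun j _ => Finset.mem_erase.2 ⟨Fin.succAbove_ne o j, Finset.mem_univ _⟩)
    (fun a _ b _ h => Fin.succAbove_right_injective h) (fun j hj => ?_) (fun _ _ => rfl)
  obtain ⟨a, ha⟩ := Fin.exists_succAbove_eq (Finset.ne_of_mem_erase hj)
  exact ⟨a, Finset.mem_univ _, ha⟩

theorem IsRightRadau.polyInt_nodalOmit (hk : 1 ≤ k) (hs : IsRightRadau s) :
    polyInt (nodalOmit s 0) = 0 := by
  have := hs.polyInt_nodal_mul (q := 1) (by rw [natDegree_one]; omega)
  rwa [mul_one, ← nodalOmit_eq] at this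

theorem IsLeftRadau.polyInt_nodalOmit (hk : 1 ≤ k) (hs : IsLeftRadau s) :
    polyInt (nodalOmit s (Fin.last (k + 1))) = 0 := by
  have := hs.polyInt_nodal_mul (q := 1) (by rw [natDegree_one]; omega)
  rwa [mul_one, ← nodalOmit_eq] at this

theorem IsGauss.polyInt_nodalOmit_zero (hk : 2 ≤ k) (hs : IsGauss s) :
    polyInt (nodalOmit s 0) = 0 := by
  rw [nodalOmit_eq, nodal_erase_zero hs.1, mul_comm]
  exact hs.polyInt_nodal_mul (by rw [natDegree_X_sub_C]; omega)

theorem IsGauss.polyInt_nodalOmit_last (hk : 2 ≤ k) (hs : IsGauss s) :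
    polyInt (nodalOmit s (Fin.last (k + 1))) = 0 := by
  rw [nodalOmit_eq, nodal_erase_last hs.1, mul_comm]
  exact hs.polyInt_nodal_mul (by rw [natDegree_X_sub_C]; omega)

end Nodes

/-! ### The energy form of the reference element -/

/-- The energy form on polynomials of degree at most `k`.  For Radau points `κ = 0`, and for Gauss
points `κ` makes up for the error of the quadrature rule. -/
def energyForm (κ : ℝ) (k : ℕ) (w v : ℝ[X]) : ℝ := polyInt (w * v) + κ * (w.coeff k * v.coeff k)

section Energy

variable {k : ℕ} {s : Fin (k + 2) → ℝ} {κ : ℝ}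

/-- The Lagrange basis polynomials of all the partition points. -/
def basisAll (s : Fin (k + 2) → ℝ) (j : Fin (k + 2)) : ℝ[X] := Lagrange.basis Finset.univ s j

theorem natDegree_basisAll (hs : IsPartition s) (j : Fin (k + 2)) :
    (basisAll s j).natDegree = k + 1 := by
  rw [basisAll, Lagrange.natDegree_basis hs.strictMono.injective.injOn (Finset.mem_univ _)]
  simp

theorem eval_basisAll_self (hs : IsPartition s) (j : Fin (k + 2)) : (basisAll s j).eval (s j) = 1 :=
  Lagrange.eval_basis_self hs.strictMono.injective.injOn (Finset.mem_univ _)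

theorem eval_basisAll_of_ne {i j : Fin (k + 2)} (h : i ≠ j) : (basisAll s i).eval (s j) = 0 :=
  Lagrange.eval_basis_of_ne h (Finset.mem_univ _)

/-- The coefficient of the nodal polynomial in a Lagrange basis polynomial. -/
def basisCoeff (s : Fin (k + 2) → ℝ) (j : Fin (k + 2)) : ℝ :=
  ∏ l ∈ Finset.univ.erase j, (s j - s l)⁻¹

theorem basisAll_eq (j : Fin (k + 2)) :
    basisAll s j = C (basisCoeff s j) * Lagrange.nodal (Finset.univ.erase j) s := by
  rw [basisAll, Lagrange.basis, basisCoeff, map_prod, Lagrange.nodal, ← Finset.prod_mul_distrib]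
  rfl

theorem coeff_derivative_basisAll (j : Fin (k + 2)) :
    (derivative (basisAll s j)).coeff k = basisCoeff s j * (k + 1) := by
  rw [coeff_derivative, basisAll_eq, coeff_C_mul]
  have hn : (Lagrange.nodal (Finset.univ.erase j) s).natDegree = k + 1 := by
    rw [Lagrange.natDegree_nodal]; simp
  have := (Lagrange.nodal_monic (s := Finset.univ.erase j) (v := s)).coeff_natDegree
  rw [hn] at this
  rw [this, mul_one]

theorem natDegree_derivative_lt {v : ℝ[X]} (hk : 1 ≤ k) (hv : v.natDegree ≤ k) :
    (derivative v).natDegree < k :=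
  lt_of_le_of_lt (natDegree_derivative_le v) (by omega)

/-- Tested with the derivative of the Lagrange basis polynomial of the left end, the form
reproduces the value there. -/
def LeftExact (s : Fin (k + 2) → ℝ) (κ : ℝ) : Prop := ∀ v : ℝ[X], v.natDegree ≤ k →
  energyForm κ k (derivative (basisAll s 0)) v = -v.eval (-1)

/-- Tested with the derivative of the Lagrange basis polynomial of the right end, the form
reproduces the value there. -/
def RightExact (s : Fin (k + 2) → ℝ) (κ : ℝ) : Prop := ∀ v : ℝ[X], v.natDegree ≤ k →
  energyForm κ k (derivative (basisAll s (Fin.last (k + 1)))) v = v.eval 1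

theorem energyForm_derivative_basis_zero (hs : IsPartition s) (v : ℝ[X]) :
    energyForm κ k (derivative (basisAll s 0)) v = -v.eval (-1)
      + basisCoeff s 0 * (κ * (k + 1) * v.coeff k
        - polyInt (Lagrange.nodal (Finset.univ.erase 0) s * derivative v)) := by
  have h1 : (basisAll s 0).eval 1 = 0 := by
    rw [← hs.last]; exact eval_basisAll_of_ne (by simp [Fin.ext_iff])
  have h2 : (basisAll s 0).eval (-1) = 1 := by rw [← hs.first]; exact eval_basisAll_self hs 0
  rw [energyForm, polyInt_derivative_mul, h1, h2, coeff_derivative_basisAll]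
  nth_rw 1 [basisAll_eq]
  rw [mul_assoc (C _), polyInt_C_mul]
  ring

theorem energyForm_derivative_basis_last (hs : IsPartition s) (v : ℝ[X]) :
    energyForm κ k (derivative (basisAll s (Fin.last (k + 1)))) v = v.eval 1
      + basisCoeff s (Fin.last (k + 1)) * (κ * (k + 1) * v.coeff k
        - polyInt (Lagrange.nodal (Finset.univ.erase (Fin.last (k + 1))) s * derivative v)) := by
  have h1 : (basisAll s (Fin.last (k + 1))).eval (-1) = 0 := by
    rw [← hs.first]; exact eval_basisAll_of_ne (by simp [Fin.ext_iff])
  have h2 : (basisAll s (Fin.last (k + 1))).eval 1 = 1 := by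
    have := eval_basisAll_self hs (Fin.last (k + 1))
    rwa [hs.last] at this
  rw [energyForm, polyInt_derivative_mul, h1, h2, coeff_derivative_basisAll]
  nth_rw 1 [basisAll_eq]
  rw [mul_assoc (C _), polyInt_C_mul]
  ring

/-- The nodal polynomial of the right Radau points is orthogonal to the derivatives of the test
polynomials. -/
theorem IsRightRadau.leftExact (hk : 1 ≤ k) (hs : IsRightRadau s) : LeftExact s 0 := by
  intro v hv
  rw [energyForm_derivative_basis_zero hs.1, hs.polyInt_nodal_mul (natDegree_derivative_lt hk hv)]
  ring

theorem IsLeftRadau.rightExact (hk : 1 ≤ k) (hs : IsLeftRadau s) : RightExact s 0 := by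
  intro v hv
  rw [energyForm_derivative_basis_last hs.1, hs.polyInt_nodal_mul (natDegree_derivative_lt hk hv)]
  ring

/-- The coefficient of the energy form for Gauss points. -/
def gaussCoeff (s : Fin (k + 2) → ℝ) : ℝ :=
  k / (k + 1) * polyInt (Lagrange.nodal (interior k) s * X ^ k)

theorem polyInt_mul_self_nonneg (p : ℝ[X]) : 0 ≤ polyInt (p * p) :=
  intervalIntegral.integral_nonneg (by norm_num) fun x _ => by
    rw [eval_mul]; exact mul_self_nonneg _

/-- Up to the factor, the coefficient is the integral of the square of the nodal polynomial of the
interior points. -/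
theorem IsGauss.gaussCoeff_nonneg (hk : 1 ≤ k) (hs : IsGauss s) : 0 ≤ gaussCoeff s := by
  refine mul_nonneg (by positivity) ?_
  have hn : (Lagrange.nodal (interior k) s).natDegree = k := by
    rw [Lagrange.natDegree_nodal, card_interior]
  have h1 : polyInt
      (Lagrange.nodal (interior k) s * (X ^ k - Lagrange.nodal (interior k) s)) = 0 := by
    refine hs.polyInt_nodal_mul ?_
    have hd : (X ^ k - Lagrange.nodal (interior k) s : ℝ[X]).degree < k := by
      have := degree_sub_lt_left (p := (X ^ k : ℝ[X])) (q := Lagrange.nodal (interior k) s)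
        (by rw [degree_X_pow, Lagrange.degree_nodal, card_interior])
        (pow_ne_zero _ X_ne_zero) (by
          rw [(monic_X_pow k).leadingCoeff, Lagrange.nodal_monic.leadingCoeff])
      rwa [degree_X_pow] at this
    exact natDegree_lt_of_degree_lt_natCast hk hd
  rw [mul_sub, map_sub] at h1
  have := polyInt_mul_self_nonneg (Lagrange.nodal (interior k) s)
  linarith

/-- The top coefficient of the test polynomial is all that remains of the quadrature error. -/
theorem IsGauss.polyInt_nodal_mul_X_mul_derivative (hk : 1 ≤ k) (hs : IsGauss s) {v : ℝ[X]}
    (hv : v.natDegree ≤ k) (a : ℝ) :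
    polyInt ((X - C a) * Lagrange.nodal (interior k) s * derivative v)
      = gaussCoeff s * (k + 1) * v.coeff k := by
  have hk1 : ((k - 1 : ℕ) : ℝ) + 1 = k := by rw [Nat.cast_sub hk]; push_cast; ring
  -- up to terms of lower degree, `x v'(x)` is `k` times the top term of `v`
  have hlow :
      (X * derivative v - C (k * v.coeff k) * X ^ k - C a * derivative v).natDegree < k := by
    refine natDegree_lt_of_degree_lt_natCast hk ?_
    rw [degree_lt_iff_coeff_zero]
    intro l hl
    have hda : (derivative v).coeff l = 0 :=
      coeff_eq_zero_of_natDegree_lt ((natDegree_derivative_lt hk hv).trans_le hl)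
    obtain ⟨l, rfl⟩ : ∃ l', l = l' + 1 := ⟨l - 1, by omega⟩
    rw [coeff_sub, coeff_sub, coeff_X_mul, coeff_C_mul, coeff_C_mul, coeff_X_pow, hda,
      coeff_derivative]
    rcases hl.eq_or_lt with h | h
    · rw [h, if_pos rfl]; push_cast; ring
    · rw [if_neg h.ne', coeff_eq_zero_of_natDegree_lt (hv.trans_lt h)]; ring
  have h0 := hs.polyInt_nodal_mul hlow
  have he : (X - C a) * Lagrange.nodal (interior k) s * derivative v
      = Lagrange.nodal (interior k) s
          * (X * derivative v - C (k * v.coeff k) * X ^ k - C a * derivative v)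
        + C (k * v.coeff k) * (Lagrange.nodal (interior k) s * X ^ k) := by ring
  rw [he, map_add, h0, polyInt_C_mul, gaussCoeff]
  field_simp
  ring

theorem IsGauss.leftExact (hk : 1 ≤ k) (hs : IsGauss s) : LeftExact s (gaussCoeff s) := by
  intro v hv
  rw [energyForm_derivative_basis_zero hs.1, nodal_erase_zero hs.1,
    hs.polyInt_nodal_mul_X_mul_derivative hk hv, sub_self, mul_zero, add_zero]

theorem IsGauss.rightExact (hk : 1 ≤ k) (hs : IsGauss s) : RightExact s (gaussCoeff s) := by
  intro v hv
  rw [energyForm_derivative_basis_last hs.1, nodal_erase_last hs.1,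
    hs.polyInt_nodal_mul_X_mul_derivative hk hv, sub_self, mul_zero, add_zero]

end Energy

/-! ### Equivalence of norms on polynomials of bounded degree -/

/-- The `L²` norm of a polynomial on `[-1, 1]`. -/
def l2norm (p : ℝ[X]) : ℝ := √(polyInt (p * p))

theorem l2norm_nonneg (p : ℝ[X]) : 0 ≤ l2norm p := Real.sqrt_nonneg _

theorem l2norm_sq (p : ℝ[X]) : l2norm p ^ 2 = polyInt (p * p) :=
  Real.sq_sqrt (polyInt_mul_self_nonneg p)

theorem polyInt_mul_self_pos {p : ℝ[X]} (hp : p ≠ 0) : 0 < polyInt (p * p) := by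
  obtain ⟨c, hc, hne⟩ : ∃ c ∈ Icc (-1 : ℝ) 1, p.eval c ≠ 0 := by
    by_contra! h
    exact hp (eq_zero_of_infinite_isRoot p ((Icc_infinite (by norm_num)).mono h))
  refine intervalIntegral.integral_pos (by norm_num) (p * p).continuous.continuousOn
    (fun x _ => by rw [eval_mul]; exact mul_self_nonneg _) ⟨c, hc, ?_⟩
  rw [eval_mul]; exact mul_self_pos.2 hne

/-- The polynomial with given coefficients. -/
def ofCoeffs {k : ℕ} (a : Fin (k + 1) → ℝ) : ℝ[X] := ∑ i, C (a i) * X ^ (i : ℕ)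

theorem polyInt_ofCoeffs_mul_self {k : ℕ} (a : Fin (k + 1) → ℝ) :
    polyInt (ofCoeffs a * ofCoeffs a)
      = ∑ i, ∑ j, a i * (a j * polyInt (X ^ (i : ℕ) * X ^ (j : ℕ))) := by
  rw [ofCoeffs, Finset.sum_mul_sum, map_sum]
  refine Finset.sum_congr rfl fun i _ => ?_
  rw [map_sum]
  refine Finset.sum_congr rfl fun j _ => ?_
  rw [← polyInt_C_mul, ← polyInt_C_mul]
  congr 1; ring

theorem ofCoeffs_coeff {k : ℕ} {p : ℝ[X]} (hp : p.natDegree ≤ k) :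
    ofCoeffs (fun i : Fin (k + 1) => p.coeff i) = p := by
  conv_rhs => rw [p.as_sum_range' (k + 1) (by omega)]
  rw [ofCoeffs, Finset.sum_range]
  exact Finset.sum_congr rfl fun i _ => C_mul_X_pow_eq_monomial

theorem coeff_ofCoeffs {k : ℕ} (a : Fin (k + 1) → ℝ) (i : Fin (k + 1)) :
    (ofCoeffs a).coeff i = a i := by
  rw [ofCoeffs, finsetSum_coeff, Finset.sum_eq_single i]
  · simp
  · intro j _ hj
    rw [coeff_C_mul, coeff_X_pow, if_neg (fun h => hj (Fin.ext h.symm)), mul_zero]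
  · simp

/-- By compactness of the unit sphere of the coefficient space. -/
theorem exists_coeff_le (k : ℕ) : ∃ c, 0 < c ∧ ∀ p : ℝ[X], p.natDegree ≤ k →
    ∀ n, |p.coeff n| ≤ c * l2norm p := by
  set f : (Fin (k + 1) → ℝ) → ℝ := fun a => polyInt (ofCoeffs a * ofCoeffs a) with hf
  have hfc : Continuous f := by
    simp only [hf, polyInt_ofCoeffs_mul_self]
    fun_prop
  obtain ⟨a₀, ha₀, hmin⟩ := (isCompact_sphere (0 : Fin (k + 1) → ℝ) 1).exists_isMinOn
    (NormedSpace.sphere_nonempty.2 zero_le_one) hfc.continuousOn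
  have hpos : 0 < f a₀ := by
    refine polyInt_mul_self_pos fun h => ?_
    have : a₀ = 0 := by
      ext i; rw [← coeff_ofCoeffs a₀ i, h]; simp
    rw [this] at ha₀
    simp at ha₀
  refine ⟨1 / √(f a₀), by positivity, fun p hp n => ?_⟩
  rw [one_div, inv_mul_eq_div, le_div_iff₀ (Real.sqrt_pos.2 hpos)]
  rcases eq_or_ne p 0 with rfl | hp0
  · simp [l2norm_nonneg]
  set a : Fin (k + 1) → ℝ := fun i => p.coeff i with ha
  have hpa : ofCoeffs a = p := ofCoeffs_coeff hp
  have ha0 : a ≠ 0 := by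
    intro h
    apply hp0
    rw [← hpa, h, ofCoeffs]
    simp
  have hna : 0 < ‖a‖ := norm_pos_iff.2 ha0
  have h1 : f a₀ ≤ f (‖a‖⁻¹ • a) := hmin (by simp [norm_smul, hna.ne'])
  have h2 : f (‖a‖⁻¹ • a) = ‖a‖⁻¹ ^ 2 * polyInt (p * p) := by
    have : ofCoeffs (‖a‖⁻¹ • a) = C (‖a‖⁻¹) * p := by
      rw [← hpa, ofCoeffs, ofCoeffs, Finset.mul_sum]
      refine Finset.sum_congr rfl fun i _ => ?_
      rw [Pi.smul_apply, smul_eq_mul, C_mul, mul_assoc]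
    simp only [hf]
    rw [this, mul_mul_mul_comm, ← C_mul, polyInt_C_mul]
    ring
  have h3 : |p.coeff n| ≤ ‖a‖ := by
    rcases lt_or_ge n (k + 1) with h | h
    · exact norm_le_pi_norm a ⟨n, h⟩
    · rw [coeff_eq_zero_of_natDegree_lt (by omega), abs_zero]; exact hna.le
  have h4 : ‖a‖ * √(f a₀) ≤ l2norm p := by
    rw [h2, inv_pow, inv_mul_eq_div, le_div_iff₀ (by positivity)] at h1
    rw [l2norm]
    refine Real.le_sqrt_of_sq_le ?_
    rw [mul_pow, Real.sq_sqrt hpos.le]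
    linarith
  exact (mul_le_mul_of_nonneg_right h3 (Real.sqrt_nonneg _)).trans h4

theorem abs_eval_le_of_coeff_le {k : ℕ} {p : ℝ[X]} (hp : p.natDegree ≤ k) {B : ℝ}
    (hB : ∀ n, |p.coeff n| ≤ B) {x : ℝ} (hx : x ∈ Icc (-1 : ℝ) 1) :
    |p.eval x| ≤ (k + 1) * B := by
  rw [eval_eq_sum_range' (show p.natDegree < k + 1 by omega)]
  refine (Finset.abs_sum_le_sum_abs _ _).trans ?_
  have hx1 : |x| ≤ 1 := abs_le.2 hx
  calc _ ≤ ∑ _ ∈ Finset.range (k + 1), B := by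
        refine Finset.sum_le_sum fun i _ => ?_
        rw [abs_mul, abs_pow]
        exact (mul_le_of_le_one_right (abs_nonneg _) (pow_le_one₀ (abs_nonneg _) hx1)).trans (hB i)
    _ = _ := by simp

/-- `K` bounds the values on `[-1, 1]` and the coefficients of `p` and of its derivative. -/
structure PolyBound (K : ℝ) (p : ℝ[X]) : Prop where
  eval : ∀ x ∈ Icc (-1 : ℝ) 1, |p.eval x| ≤ K
  eval_derivative : ∀ x ∈ Icc (-1 : ℝ) 1, |(derivative p).eval x| ≤ K
  coeff : ∀ n, |p.coeff n| ≤ K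
  coeff_derivative : ∀ n, |(derivative p).coeff n| ≤ K

theorem PolyBound.mono {K K' : ℝ} (h : K ≤ K') {p : ℝ[X]} (hp : PolyBound K p) : PolyBound K' p :=
  ⟨fun x hx => (hp.eval x hx).trans h, fun x hx => (hp.eval_derivative x hx).trans h,
    fun n => (hp.coeff n).trans h, fun n => (hp.coeff_derivative n).trans h⟩

theorem polyBound_of_coeff_le {k : ℕ} {p : ℝ[X]} (hp : p.natDegree ≤ k) {B : ℝ}
    (hB : ∀ n, |p.coeff n| ≤ B) : PolyBound ((k + 1) ^ 2 * B) p := by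
  have hB0 : 0 ≤ B := (abs_nonneg _).trans (hB 0)
  have hk : (0 : ℝ) ≤ k := Nat.cast_nonneg k
  have hd : ∀ n, |(derivative p).coeff n| ≤ (k + 1) * B := by
    intro n
    rw [Polynomial.coeff_derivative, abs_mul]
    rcases le_or_gt (n + 1) k with h | h
    · have h1 : |(n : ℝ) + 1| ≤ k + 1 := by
        rw [abs_of_nonneg (by positivity)]
        have : ((n + 1 : ℕ) : ℝ) ≤ k := by exact_mod_cast h
        push_cast at this; linarith
      rw [mul_comm]
      exact mul_le_mul h1 (hB _) (abs_nonneg _) (by positivity)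
    · rw [coeff_eq_zero_of_natDegree_lt (by omega), abs_zero, zero_mul]; positivity
  have h1 : (k + 1) * B ≤ (k + 1) ^ 2 * B := by nlinarith [mul_nonneg hk hB0]
  refine ⟨fun x hx => (abs_eval_le_of_coeff_le hp hB hx).trans h1, fun x hx => ?_, fun n => ?_,
    fun n => (hd n).trans h1⟩
  · have := abs_eval_le_of_coeff_le ((natDegree_derivative_le p).trans (by omega : _ ≤ k)) hd hx
    exact this.trans (le_of_eq (by ring))
  · refine (hB n).trans ?_
    nlinarith [mul_nonneg hk hB0]

theorem exists_polyBound_l2norm (k : ℕ) : ∃ c, 1 ≤ c ∧ ∀ p : ℝ[X], p.natDegree ≤ k →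
    PolyBound (c * l2norm p) p := by
  obtain ⟨c, hc, h⟩ := exists_coeff_le k
  refine ⟨1 + (k + 1) ^ 2 * c, by simp; positivity, fun p hp => ?_⟩
  refine (polyBound_of_coeff_le hp (h p hp)).mono ?_
  have := l2norm_nonneg p
  nlinarith

theorem exists_polyBound (p : ℝ[X]) : ∃ K, PolyBound K p := by
  obtain ⟨c, -, h⟩ := exists_polyBound_l2norm p.natDegree
  exact ⟨_, h p le_rfl⟩

theorem PolyBound.nonneg {K : ℝ} {p : ℝ[X]} (h : PolyBound K p) : 0 ≤ K :=
  (abs_nonneg _).trans (h.coeff 0)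

/-- Bounds that depend monotonically on a constant hold uniformly over a finite set. -/
theorem exists_uniform_const {ι : Type*} {S : Set ι} (hS : S.Finite) {P : ι → ℝ → Prop}
    (hmono : ∀ i K K', K ≤ K' → P i K → P i K') (h : ∀ i ∈ S, ∃ K, P i K) :
    ∃ K, 1 ≤ K ∧ ∀ i ∈ S, P i K := by
  classical
  choose! K hK using h
  refine ⟨1 + ∑ i ∈ hS.toFinset, |K i|, ?_, fun i hi => hmono i _ _ ?_ (hK i hi)⟩
  · have : 0 ≤ ∑ i ∈ hS.toFinset, |K i| := Finset.sum_nonneg fun _ _ => abs_nonneg _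
    linarith
  · have := Finset.single_le_sum (f := fun i => |K i|) (fun i _ => abs_nonneg (K i))
      (hS.mem_toFinset.2 hi)
    linarith [le_abs_self (K i)]

section Nodes

variable {k : ℕ} {s : Fin (k + 2) → ℝ}

/-- The Lagrange basis polynomials of the nodes left when the point of index `o` is omitted. -/
def basisOmit (s : Fin (k + 2) → ℝ) (o : Fin (k + 2)) (j : Fin (k + 1)) : ℝ[X] :=
  Lagrange.basis Finset.univ (fun j => s (o.succAbove j)) j

/-- `K` bounds all polynomials attached to the partition `s`. -/
structure RefBound (s : Fin (k + 2) → ℝ) (K : ℝ) : Prop where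
  basisAll : ∀ j, PolyBound K (basisAll s j)
  basisOmit : ∀ o j, PolyBound K (basisOmit s o j)
  nodalOmit : ∀ o, PolyBound K (nodalOmit s o)
  gaussCoeff : |gaussCoeff s| ≤ K

theorem RefBound.mono {K K' : ℝ} (h : K ≤ K') (hs : RefBound s K) : RefBound s K' :=
  ⟨fun j => (hs.basisAll j).mono h, fun o j => (hs.basisOmit o j).mono h,
    fun o => (hs.nodalOmit o).mono h, hs.gaussCoeff.trans h⟩

theorem exists_refBound (s : Fin (k + 2) → ℝ) : ∃ K, RefBound s K := by
  obtain ⟨K₁, -, h₁⟩ := exists_uniform_const (Set.finite_univ (α := Fin (k + 2)))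
    (P := fun j K => PolyBound K (basisAll s j)) (fun _ _ _ h hp => hp.mono h)
    fun j _ => exists_polyBound _
  obtain ⟨K₂, -, h₂⟩ := exists_uniform_const (Set.finite_univ (α := Fin (k + 2) × Fin (k + 1)))
    (P := fun j K => PolyBound K (basisOmit s j.1 j.2)) (fun _ _ _ h hp => hp.mono h)
    fun j _ => exists_polyBound _
  obtain ⟨K₃, -, h₃⟩ := exists_uniform_const (Set.finite_univ (α := Fin (k + 2)))
    (P := fun j K => PolyBound K (nodalOmit s j)) (fun _ _ _ h hp => hp.mono h)
    fun j _ => exists_polyBound _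
  refine ⟨max (max K₁ K₂) (max K₃ |gaussCoeff s|), fun j => (h₁ j trivial).mono ?_,
    fun o j => (h₂ (o, j) trivial).mono ?_, fun o => (h₃ o trivial).mono ?_, ?_⟩
  · exact (le_max_left _ _).trans (le_max_left _ _)
  · exact (le_max_right _ _).trans (le_max_left _ _)
  · exact (le_max_left _ _).trans (le_max_right _ _)
  · exact (le_max_right _ _).trans (le_max_right _ _)

/-- Gauss or Radau partitions. -/
def IsAdmissible (s : Fin (k + 2) → ℝ) : Prop := IsGauss s ∨ IsRightRadau s ∨ IsLeftRadau s

theorem IsAdmissible.isPartition (hs : IsAdmissible s) : IsPartition s := by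
  rcases hs with h | h | h <;> exact h.1

/-- There are only finitely many Gauss or Radau partitions with a given number of points. -/
theorem finite_isAdmissible (k : ℕ) : {s : Fin (k + 2) → ℝ | IsAdmissible s}.Finite := by
  have hne1 : legendre k ≠ 0 := fun h => legendre_coeff_ne_zero k (by rw [h, coeff_zero])
  have hne2 : legendre (k + 1) - legendre k ≠ 0 := fun h =>
    legendre_sub_coeff_ne_zero k (by rw [h, coeff_zero])
  have hne3 : legendre (k + 1) + legendre k ≠ 0 := fun h =>
    legendre_add_coeff_ne_zero k (by rw [h, coeff_zero])
  set R : Set ℝ := {-1, 1} ∪ ({x | (legendre k).IsRoot x} ∪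
    ({x | (legendre (k + 1) - legendre k).IsRoot x} ∪
      {x | (legendre (k + 1) + legendre k).IsRoot x})) with hR
  have hRf : R.Finite := (Set.toFinite _).union ((finite_setOfPred_isRoot hne1).union
    ((finite_setOfPred_isRoot hne2).union (finite_setOfPred_isRoot hne3)))
  refine (Set.Finite.pi' fun _ : Fin (k + 2) => hRf).subset fun s hs j => ?_
  by_cases h0 : j = 0
  · rw [h0, hs.isPartition.first]; exact Or.inl (Or.inl rfl)
  by_cases h1 : j = Fin.last (k + 1)
  · rw [h1, hs.isPartition.last]; exact Or.inl (Or.inr rfl)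
  rcases hs with h | h | h
  · exact Or.inr (Or.inl (h.2 j h0 h1))
  · exact Or.inr (Or.inr (Or.inl (h.2 j h0)))
  · exact Or.inr (Or.inr (Or.inr (h.2 j h1)))

theorem exists_uniform_refBound (k : ℕ) : ∃ K, 1 ≤ K ∧ ∀ s : Fin (k + 2) → ℝ, IsAdmissible s →
    RefBound s K :=
  exists_uniform_const (finite_isAdmissible k) (fun _ _ _ h hs => hs.mono h)
    fun s _ => exists_refBound s

/-- A polynomial of degree at most `k + 1` is the combination of the Lagrange basis polynomials. -/
theorem eq_sum_basisAll (hs : IsPartition s) {p : ℝ[X]} (hp : p.natDegree ≤ k + 1) :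
    p = ∑ j, C (p.eval (s j)) * basisAll s j := by
  have h := Lagrange.eq_interpolate (s := Finset.univ) (v := s) (f := p)
    hs.strictMono.injective.injOn (by
      rw [Finset.card_univ, Fintype.card_fin]
      exact (natDegree_le_iff_degree_le.1 hp).trans_lt (by exact_mod_cast Nat.lt_succ_self _))
  rw [Lagrange.interpolate_apply] at h
  exact h

end Nodes

section Form

variable {k : ℕ} {κ c K : ℝ}

theorem energyForm_add_left (κ : ℝ) (k : ℕ) (p q v : ℝ[X]) :
    energyForm κ k (p + q) v = energyForm κ k p v + energyForm κ k q v := by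
  simp only [energyForm, add_mul, map_add, coeff_add]; ring

theorem energyForm_C_mul_left (κ : ℝ) (k : ℕ) (a : ℝ) (p v : ℝ[X]) :
    energyForm κ k (C a * p) v = a * energyForm κ k p v := by
  simp only [energyForm, mul_assoc, polyInt_C_mul, coeff_C_mul]; ring

theorem energyForm_sum_left (κ : ℝ) (k : ℕ) {ι : Type*} (S : Finset ι) (p : ι → ℝ[X]) (v : ℝ[X]) :
    energyForm κ k (∑ i ∈ S, p i) v = ∑ i ∈ S, energyForm κ k (p i) v := by
  classical
  induction S using Finset.induction_on with
  | empty => simp [energyForm]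
  | insert a S ha ih => rw [Finset.sum_insert ha, Finset.sum_insert ha, energyForm_add_left, ih]

theorem energyForm_comm (κ : ℝ) (k : ℕ) (p v : ℝ[X]) : energyForm κ k p v = energyForm κ k v p := by
  rw [energyForm, energyForm, mul_comm p v]; ring

theorem l2norm_sq_le_energyForm (hκ : 0 ≤ κ) (v : ℝ[X]) : l2norm v ^ 2 ≤ energyForm κ k v v := by
  rw [l2norm_sq, energyForm]
  exact le_add_of_nonneg_right (mul_nonneg hκ (mul_self_nonneg _))

theorem abs_polyInt_le {p : ℝ[X]} {B : ℝ} (h : ∀ x ∈ Icc (-1 : ℝ) 1, |p.eval x| ≤ B) :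
    |polyInt p| ≤ 2 * B := by
  have := intervalIntegral.norm_integral_le_of_norm_le_const (a := -1) (b := 1) (f := p.eval)
    (C := B) fun x hx => h x (by
      rw [uIoc_of_le (by norm_num)] at hx; exact Ioc_subset_Icc_self hx)
  rw [polyInt_apply]
  refine this.trans (le_of_eq ?_)
  norm_num; ring

theorem abs_energyForm_le (hκ : 0 ≤ κ) {w v : ℝ[X]} {a b : ℝ}
    (hw : ∀ x ∈ Icc (-1 : ℝ) 1, |w.eval x| ≤ a) (hwc : |w.coeff k| ≤ a)
    (hv : ∀ x ∈ Icc (-1 : ℝ) 1, |v.eval x| ≤ b) (hvc : |v.coeff k| ≤ b) :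
    |energyForm κ k w v| ≤ (2 + κ) * (a * b) := by
  have ha : 0 ≤ a := (abs_nonneg _).trans hwc
  have h1 : |polyInt (w * v)| ≤ 2 * (a * b) := abs_polyInt_le fun x hx => by
    rw [eval_mul, abs_mul]; exact mul_le_mul (hw x hx) (hv x hx) (abs_nonneg _) ha
  have h2 : |κ * (w.coeff k * v.coeff k)| ≤ κ * (a * b) := by
    rw [abs_mul, abs_mul, abs_of_nonneg hκ]
    exact mul_le_mul_of_nonneg_left (mul_le_mul hwc hvc (abs_nonneg _) ha) hκ
  rw [energyForm]
  exact (abs_add_le _ _).trans (by linarith)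

theorem energyForm_self_le (hκ : 0 ≤ κ) {v : ℝ[X]} (hv : PolyBound (c * l2norm v) v) :
    energyForm κ k v v ≤ (2 + κ) * c ^ 2 * l2norm v ^ 2 := by
  refine (le_abs_self _).trans ((abs_energyForm_le hκ hv.eval (hv.coeff k) hv.eval
    (hv.coeff k)).trans (le_of_eq (by ring)))

/-- The derivative of a polynomial of degree at most `k` has no coefficient of order `k`, so
that the extra term of the form does not contribute. -/
theorem energyForm_derivative_self {v : ℝ[X]} (hv : v.natDegree ≤ k) :
    energyForm κ k (derivative v) v = (v.eval 1 ^ 2 - v.eval (-1) ^ 2) / 2 := by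
  have h1 := polyInt_derivative_mul v v
  have h2 : (derivative v).coeff k = 0 := by
    rw [coeff_derivative, coeff_eq_zero_of_natDegree_lt (by omega), zero_mul]
  rw [energyForm, h2]
  rw [mul_comm v (derivative v)] at h1
  linarith

end Form

/-! ### The energy estimate on an element -/

section Element

variable {k : ℕ} {s : Fin (k + 2) → ℝ} {κ c K : ℝ}

theorem natDegree_sum_basisAll_le (hs : IsPartition s) (F : Fin (k + 2) → ℝ) :
    (∑ j, C (F j) * basisAll s j).natDegree ≤ k + 1 :=
  natDegree_sum_le_of_forall_le _ _ fun j _ =>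
    (natDegree_C_mul_le _ _).trans (natDegree_basisAll hs j).le

theorem eval_sum_basisAll (hs : IsPartition s) (F : Fin (k + 2) → ℝ) (l : Fin (k + 2)) :
    (∑ j, C (F j) * basisAll s j).eval (s l) = F l := by
  rw [eval_finsetSum, Finset.sum_eq_single l]
  · rw [eval_mul, eval_C, eval_basisAll_self hs, mul_one]
  · intro j _ hj
    rw [eval_mul, eval_basisAll_of_ne hj, mul_zero]
  · simp

theorem energyForm_derivative_sum_basisAll (F : Fin (k + 2) → ℝ) (v : ℝ[X]) :
    energyForm κ k (derivative (∑ j, C (F j) * basisAll s j)) v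
      = ∑ j, F j * energyForm κ k (derivative (basisAll s j)) v := by
  rw [derivative_sum, energyForm_sum_left]
  refine Finset.sum_congr rfl fun j _ => ?_
  rw [derivative_C_mul, energyForm_C_mul_left]

theorem abs_energyForm_basisAll_le (hκ : 0 ≤ κ) (hκK : κ ≤ K) (hK : RefBound s K) {v : ℝ[X]}
    (hv : PolyBound (c * l2norm v) v) (j : Fin (k + 2)) :
    |energyForm κ k (derivative (basisAll s j)) v| ≤ (2 + K) * K * c * l2norm v := by
  have h := abs_energyForm_le (k := k) hκ (hK.basisAll j).eval_derivative
    ((hK.basisAll j).coeff_derivative k) hv.eval (hv.coeff k)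
  refine h.trans ?_
  have hK0 : 0 ≤ K := (hK.basisAll j).nonneg
  have := mul_le_mul_of_nonneg_right hκK (mul_nonneg hK0 hv.nonneg)
  linarith

/-- The energy form tested against a polynomial is controlled by the integrals of that polynomial
over the control volumes. -/
theorem abs_energyForm_le_of_controlVolume (hs : IsPartition s) (hκ : 0 ≤ κ) (hκK : κ ≤ K)
    (hK : RefBound s K) {v R : ℝ[X]} (hv : PolyBound (c * l2norm v) v) (hR : R.natDegree ≤ k)
    {b : ℝ} (hb : ∀ j : Fin (k + 1), |∫ x in (s j.castSucc)..(s j.succ), R.eval x| ≤ b) :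
    |energyForm κ k R v| ≤ (k + 2) * (k + 1) * ((2 + K) * K * c) * (b * l2norm v) := by
  have hb0 : 0 ≤ b := (abs_nonneg _).trans (hb 0)
  set P := primitive R - C ((primitive R).eval (-1)) with hP
  have hPd : derivative P = R := by
    rw [hP, derivative_sub, derivative_C, sub_zero, derivative_primitive]
  have hPn : P.natDegree ≤ k + 1 := by
    rw [hP, natDegree_sub_C]; exact (natDegree_primitive_le R).trans (by omega)
  have hval : ∀ j : Fin (k + 2), |P.eval (s j)| ≤ (j : ℕ) * b := by
    intro j
    induction j using Fin.induction with
    | zero => rw [hs.first, hP]; simp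
    | succ j ih =>
      have h1 := integral_derivative P (s j.castSucc) (s j.succ)
      rw [hPd] at h1
      have h2 := hb j
      rw [h1] at h2
      have h3 := abs_add_le (P.eval (s j.succ) - P.eval (s j.castSucc)) (P.eval (s j.castSucc))
      rw [sub_add_cancel] at h3
      rw [Fin.val_castSucc] at ih
      rw [Fin.val_succ]; push_cast
      linarith
  have hsum : energyForm κ k R v
      = ∑ j, P.eval (s j) * energyForm κ k (derivative (basisAll s j)) v := by
    rw [← energyForm_derivative_sum_basisAll, ← eq_sum_basisAll hs hPn, hPd]
  rw [hsum]
  calc _ ≤ ∑ j : Fin (k + 2), ((k + 1) * b) * ((2 + K) * K * c * l2norm v) := by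
        refine (Finset.abs_sum_le_sum_abs _ _).trans (Finset.sum_le_sum fun j _ => ?_)
        rw [abs_mul]
        refine mul_le_mul ((hval j).trans ?_) (abs_energyForm_basisAll_le hκ hκK hK hv j)
          (abs_nonneg _) (by positivity)
        have : ((j : ℕ) : ℝ) ≤ k + 1 := by exact_mod_cast Nat.lt_succ_iff.1 j.2
        exact mul_le_mul_of_nonneg_right this hb0
    _ = _ := by
        rw [Finset.sum_const, Finset.card_univ, Fintype.card_fin, nsmul_eq_mul]; push_cast; ring

theorem sum_eq_ends {f : Fin (k + 2) → ℝ} (h : ∀ j, j ≠ 0 → j ≠ Fin.last (k + 1) → f j = 0) :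
    ∑ j, f j = f 0 + f (Fin.last (k + 1)) :=
  Finset.sum_eq_add (0 : Fin (k + 2)) (Fin.last (k + 1)) (by simp [Fin.ext_iff])
    (fun j _ hj => h j hj.1 hj.2) (by simp) (by simp)

/-- The constant in the energy estimate of an element. -/
def elementConst (k : ℕ) (K c L : ℝ) : ℝ :=
  (k + 2) * (k + 1) * ((2 + K) * K * c) + (k + 2) * (L * c * ((2 + K) * K * c)) + L * c ^ 2

/-- Energy estimate on one element.  The fluxes are `a v` at the interior points and arbitrary at
the two ends. -/
theorem element_energy_le (hs : IsPartition s) (hκ : 0 ≤ κ) (hκK : κ ≤ K) (hK : RefBound s K)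
    {v vt : ℝ[X]} (hvk : v.natDegree ≤ k) (hvt : vt.natDegree ≤ k)
    (hv : PolyBound (c * l2norm v) v) {F a : Fin (k + 2) → ℝ} {H L β : ℝ} (hH : 0 < H)
    (hL : 0 ≤ L) (hc : 0 ≤ c) (hβ : 0 ≤ β)
    (hF : ∀ j, j ≠ 0 → j ≠ Fin.last (k + 1) → F j = a j * v.eval (s j))
    (ha : ∀ i j, |a i - a j| ≤ L * H)
    (hb : ∀ j : Fin (k + 1), |H * (∫ x in (s j.castSucc)..(s j.succ), vt.eval x)
      + F j.succ - F j.castSucc| ≤ H * β) :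
    H * energyForm κ k vt v ≤
      (a (Fin.last (k + 1)) / 2 * v.eval 1 ^ 2 - F (Fin.last (k + 1)) * v.eval 1)
      - (a 0 / 2 * v.eval (-1) ^ 2 - F 0 * v.eval (-1))
      + elementConst k K c L * H * (l2norm v ^ 2 + β * l2norm v)
      + |F 0 - a 0 * v.eval (-1)|
        * |energyForm κ k (derivative (basisAll s 0)) v + v.eval (-1)|
      + |F (Fin.last (k + 1)) - a (Fin.last (k + 1)) * v.eval 1|
        * |energyForm κ k (derivative (basisAll s (Fin.last (k + 1)))) v - v.eval 1| := by
  have hK0 : 0 ≤ K := hκ.trans hκK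
  set r := l2norm v with hr
  have hr0 : 0 ≤ r := l2norm_nonneg v
  set D := (2 + K) * K * c with hD
  have hD0 : 0 ≤ D := by positivity
  set e : Fin (k + 2) → ℝ := fun j => energyForm κ k (derivative (basisAll s j)) v with he
  have hej : ∀ j, |e j| ≤ D * r := fun j => abs_energyForm_basisAll_le hκ hκK hK hv j
  set Φ := ∑ j, C (F j) * basisAll s j with hΦ
  set R := C H * vt + derivative Φ with hR
  have hRk : R.natDegree ≤ k := by
    refine (natDegree_add_le _ _).trans (max_le ((natDegree_C_mul_le _ _).trans hvt) ?_)
    have h1 := natDegree_derivative_le Φ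
    have h2 : Φ.natDegree ≤ k + 1 := natDegree_sum_basisAll_le hs F
    omega
  have h1 : |energyForm κ k R v| ≤ (k + 2) * (k + 1) * D * ((H * β) * r) := by
    refine abs_energyForm_le_of_controlVolume hs hκ hκK hK hv hRk fun j => ?_
    have : ∫ x in (s j.castSucc)..(s j.succ), R.eval x
        = H * (∫ x in (s j.castSucc)..(s j.succ), vt.eval x) + F j.succ - F j.castSucc := by
      have h2 := integral_derivative Φ (s j.castSucc) (s j.succ)
      rw [hΦ, eval_sum_basisAll hs, eval_sum_basisAll hs, ← hΦ] at h2
      simp only [hR, eval_add, eval_mul, eval_C]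
      have hi : IntervalIntegrable (fun x => H * vt.eval x) volume (s j.castSucc) (s j.succ) :=
        (continuous_const.mul vt.continuous).intervalIntegrable _ _
      rw [intervalIntegral.integral_add hi
        ((derivative Φ).continuous.intervalIntegrable _ _), intervalIntegral.integral_const_mul,
        h2]
      ring
    rw [this]; exact hb j
  have h2 : energyForm κ k R v = H * energyForm κ k vt v + ∑ j, F j * e j := by
    rw [hR, energyForm_add_left, energyForm_C_mul_left, hΦ, energyForm_derivative_sum_basisAll]
  -- split the fluxes into the central part, the variation of `a`, and the upwind corrections
  have h3 : ∑ j, F j * e j = a 0 * energyForm κ k (derivative v) v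
      + ∑ j, (a j - a 0) * v.eval (s j) * e j + ∑ j, (F j - a j * v.eval (s j)) * e j := by
    have h4 : energyForm κ k (derivative v) v = ∑ j, v.eval (s j) * e j := by
      conv_lhs => rw [eq_sum_basisAll hs (hvk.trans (Nat.le_succ k))]
      rw [energyForm_derivative_sum_basisAll]
      rw [← eq_sum_basisAll hs (hvk.trans (Nat.le_succ k))]
    rw [h4, Finset.mul_sum, ← Finset.sum_add_distrib, ← Finset.sum_add_distrib]
    exact Finset.sum_congr rfl fun j _ => by ring
  have h5 : ∑ j, (F j - a j * v.eval (s j)) * e j = (F 0 - a 0 * v.eval (-1)) * e 0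
      + (F (Fin.last (k + 1)) - a (Fin.last (k + 1)) * v.eval 1) * e (Fin.last (k + 1)) := by
    rw [sum_eq_ends fun j hj0 hj1 => by rw [hF j hj0 hj1, sub_self, zero_mul], hs.first, hs.last]
  have h6 : |∑ j, (a j - a 0) * v.eval (s j) * e j| ≤ (k + 2) * (L * c * D) * H * r ^ 2 := by
    calc _ ≤ ∑ j : Fin (k + 2), (L * H) * (c * r) * (D * r) := by
          refine (Finset.abs_sum_le_sum_abs _ _).trans (Finset.sum_le_sum fun j _ => ?_)
          rw [abs_mul, abs_mul]
          exact mul_le_mul (mul_le_mul (ha j 0) (hv.eval _ (hs.mem_Icc j)) (abs_nonneg _)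
            (by positivity)) (hej j) (abs_nonneg _) (by positivity)
      _ = _ := by
          rw [Finset.sum_const, Finset.card_univ, Fintype.card_fin, nsmul_eq_mul]
          push_cast; ring
  have h7 : |(a 0 - a (Fin.last (k + 1))) * v.eval 1 ^ 2| ≤ L * c ^ 2 * H * r ^ 2 := by
    rw [abs_mul, abs_pow]
    have := pow_le_pow_left₀ (abs_nonneg _) (hv.eval 1 (by norm_num)) 2
    calc _ ≤ (L * H) * (c * r) ^ 2 := mul_le_mul (ha _ _) this (by positivity) (by positivity)
      _ = _ := by ring
  rw [energyForm_derivative_self hvk] at h3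
  have h8 := abs_mul (F 0 - a 0 * v.eval (-1)) (e 0 + v.eval (-1))
  have h9 := abs_mul (F (Fin.last (k + 1)) - a (Fin.last (k + 1)) * v.eval 1)
    (e (Fin.last (k + 1)) - v.eval 1)
  rw [← h8, ← h9]
  have g1 := le_abs_self (energyForm κ k R v)
  have g2 := neg_abs_le (∑ j, (a j - a 0) * v.eval (s j) * e j)
  have g3 := neg_abs_le ((a 0 - a (Fin.last (k + 1))) * v.eval 1 ^ 2)
  have g4 := neg_abs_le ((F 0 - a 0 * v.eval (-1)) * (e 0 + v.eval (-1)))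
  have g5 := neg_abs_le ((F (Fin.last (k + 1)) - a (Fin.last (k + 1)) * v.eval 1)
    * (e (Fin.last (k + 1)) - v.eval 1))
  have g6 : elementConst k K c L * H * (r ^ 2 + β * r)
      = (k + 2) * (k + 1) * D * ((H * β) * r) + (k + 2) * (L * c * D) * H * r ^ 2
        + L * c ^ 2 * H * r ^ 2 + ((k + 2) * (k + 1) * D * H * r ^ 2
        + ((k + 2) * (L * c * D) + L * c ^ 2) * (H * (β * r))) := by
    rw [elementConst]; ring
  have g7 : 0 ≤ (k + 2) * (k + 1) * D * H * r ^ 2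
        + ((k + 2) * (L * c * D) + L * c ^ 2) * (H * (β * r)) := by positivity
  have g8 : 0 ≤ L * c ^ 2 * H * r ^ 2 := by positivity
  rw [g6]
  rw [h3, h5] at h2
  linarith

end Element

/-! ### Global stability -/

section Points

variable {N k : ℕ} {M : Mesh N} {s : Fin N → Fin (k + 2) → ℝ}

theorem Mesh.toElement_neg_one (M : Mesh N) (i : Fin N) : M.toElement i (-1) = M.left i := by
  rw [Mesh.toElement, Mesh.len]; ring

theorem Mesh.toElement_one (M : Mesh N) (i : Fin N) : M.toElement i 1 = M.right i := by
  rw [Mesh.toElement, Mesh.len]; ring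

theorem Mesh.toElement_mem (M : Mesh N) (i : Fin N) {x : ℝ} (hx : x ∈ Icc (-1 : ℝ) 1) :
    M.toElement i x ∈ Icc (M.left i) (M.right i) := by
  have := M.len_pos i
  rw [← M.toElement_neg_one, ← M.toElement_one]
  simp only [Mesh.toElement]
  constructor <;> nlinarith [hx.1, hx.2]

theorem point_zero {i : Fin N} (hs : IsPartition (s i)) : point M s i 0 = M.left i := by
  rw [point, hs.first, M.toElement_neg_one]

theorem point_last {i : Fin N} (hs : IsPartition (s i)) :
    point M s i (Fin.last (k + 1)) = M.right i := by
  rw [point, hs.last, M.toElement_one]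

theorem point_mem {i : Fin N} (hs : IsPartition (s i)) (j : Fin (k + 2)) :
    point M s i j ∈ Icc (M.left i) (M.right i) := M.toElement_mem i (hs.mem_Icc j)

end Points

section Stability

variable {N k : ℕ} [NeZero N] (α : ℝ → ℝ) (M : Mesh N)

theorem Mesh.left_add_one (i : Fin N) :
    M.left (i + 1) = M.right i ∨ (M.left (i + 1) = 0 ∧ M.right i = 2 * Real.pi) := by
  have hN : N ≠ 0 := NeZero.ne N
  rcases lt_or_ge ((i : ℕ) + 1) N with h | h
  · left
    have h1 : ((i + 1 : Fin N) : ℕ) = i + 1 := by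
      rw [Fin.val_add, Fin.val_one', Nat.add_mod_mod, Nat.mod_eq_of_lt h]
    rw [Mesh.left, Mesh.right]
    congr 1
    exact Fin.ext (by simp [h1])
  · right
    have h0 : (i : ℕ) + 1 = N := by omega
    have h1 : ((i + 1 : Fin N) : ℕ) = 0 := by
      rw [Fin.val_add, Fin.val_one', Nat.add_mod_mod, h0, Nat.mod_self]
    constructor
    · rw [Mesh.left, ← M.first]
      congr 1
      exact Fin.ext (by simp [h1])
    · rw [Mesh.right, ← M.last]
      congr 1
      exact Fin.ext (by simp [h0])

theorem Mesh.apply_left_add_one {φ : ℝ → ℝ} (hφ : φ 0 = φ (2 * Real.pi)) (i : Fin N) :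
    φ (M.left (i + 1)) = φ (M.right i) := by
  rcases M.left_add_one i with h | ⟨h, h'⟩
  · rw [h]
  · rw [h, h', hφ]

theorem Function.Periodic.apply_zero {α : ℝ → ℝ} (h : Function.Periodic α (2 * Real.pi)) :
    α 0 = α (2 * Real.pi) := by
  have := h 0
  rw [zero_add] at this
  exact this.symm

/-- The upwind value at the right end of an element, for polynomials on the reference element. -/
def refUpwind (V : Fin N → ℝ[X]) (i : Fin N) : ℝ :=
  if 0 < α (M.right i) then (V i).eval 1 else (V (i + 1)).eval (-1)

/-- The numerical flux at a partition point, for polynomials on the reference element. -/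
def refFlux (s : Fin N → Fin (k + 2) → ℝ) (V : Fin N → ℝ[X]) (i : Fin N) (j : Fin (k + 2)) : ℝ :=
  α (point M s i j) * if j = 0 then refUpwind α M V (i - 1)
    else if j = Fin.last (k + 1) then refUpwind α M V i else (V i).eval (s i j)

variable {α M} {s : Fin N → Fin (k + 2) → ℝ}

/-- An element for which the energy form `κ` is compatible with the upwind fluxes: at
either end it reproduces the end value, or the upwind value there is that of the element itself, or
`α` is small there. -/
structure StableElement (α : ℝ → ℝ) (M : Mesh N) (K L : ℝ) (i : Fin N) (s : Fin (k + 2) → ℝ)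
    (κ : ℝ) : Prop where
  isPartition : IsPartition s
  nonneg : 0 ≤ κ
  le : κ ≤ K
  refBound : RefBound s K
  left : LeftExact s κ ∨ α (M.left i) ≤ 0 ∨ |α (M.left i)| ≤ L * M.len i
  right : RightExact s κ ∨ 0 ≤ α (M.right i) ∨ |α (M.right i)| ≤ L * M.len i

theorem sum_add_one (f : Fin N → ℝ) : ∑ i, f (i + 1) = ∑ i, f i :=
  Equiv.sum_comp (Equiv.addRight (1 : Fin N)) f

theorem sum_sub_one (f : Fin N → ℝ) : ∑ i, f (i - 1) = ∑ i, f i :=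
  Equiv.sum_comp (Equiv.subRight (1 : Fin N)) f

theorem refFlux_zero {V : Fin N → ℝ[X]} {i : Fin N} (hs : IsPartition (s i)) :
    refFlux α M s V i 0 = α (M.left i) * refUpwind α M V (i - 1) := by
  rw [refFlux, if_pos rfl, point_zero hs]

theorem refFlux_last {V : Fin N → ℝ[X]} {i : Fin N} (hs : IsPartition (s i)) :
    refFlux α M s V i (Fin.last (k + 1)) = α (M.right i) * refUpwind α M V i := by
  rw [refFlux, if_neg (by simp [Fin.ext_iff]), if_pos rfl, point_last hs]

/-- The constant in the energy estimate of the whole mesh. -/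
def globalConst (k : ℕ) (K c L ρ : ℝ) : ℝ :=
  2 * elementConst k K c (2 * L) + 4 * (4 * L * c * ((2 + K) * K * c + c)) * (1 + ρ)

/-- The total energy estimate at a fixed time.  The jumps at the interfaces enter with a sign,
thanks to the upwind values. -/
theorem sum_energy_le {K c L ρ : ℝ} (hα : α 0 = α (2 * Real.pi)) (hL : 0 ≤ L)
    (hLα : ∀ x ∈ Icc 0 (2 * Real.pi), ∀ y ∈ Icc 0 (2 * Real.pi), |α x - α y| ≤ L * |x - y|)
    (hρ : 0 ≤ ρ) (hM : M.IsRegular ρ) {κ : Fin N → ℝ} (hK : 0 ≤ K)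
    (hst : ∀ i, StableElement α M K L i (s i) (κ i)) (hc : 0 ≤ c)
    (hcb : ∀ p : ℝ[X], p.natDegree ≤ k → PolyBound (c * l2norm p) p)
    {V Vt : Fin N → ℝ[X]} (hV : ∀ i, (V i).natDegree ≤ k) (hVt : ∀ i, (Vt i).natDegree ≤ k)
    {β : Fin N → ℝ} (hβ : ∀ i, 0 ≤ β i)
    (hb : ∀ i, ∀ j : Fin (k + 1),
      |M.len i / 2 * (∫ x in (s i j.castSucc)..(s i j.succ), (Vt i).eval x)
        + refFlux α M s V i j.succ - refFlux α M s V i j.castSucc| ≤ M.len i / 2 * β i) :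
    ∑ i, M.len i / 2 * energyForm (κ i) k (Vt i) (V i)
      ≤ globalConst k K c L ρ
        * (∑ i, M.len i / 2 * l2norm (V i) ^ 2 + ∑ i, M.len i / 2 * β i ^ 2) := by
  set D := (2 + K) * K * c with hD
  set E := elementConst k K c (2 * L) with hE
  have hE0 : 0 ≤ E := by rw [hE, elementConst]; positivity
  have hH : ∀ i, 0 < M.len i / 2 := fun i => half_pos (M.len_pos i)
  set A : Fin N → ℝ := fun i =>
    α (M.right i) / 2 * (V i).eval 1 ^ 2 - α (M.right i) * refUpwind α M V i * (V i).eval 1 with hA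
  set B : Fin N → ℝ := fun i => α (M.left i) / 2 * (V i).eval (-1) ^ 2
    - α (M.left i) * refUpwind α M V (i - 1) * (V i).eval (-1) with hB
  set r : Fin N → ℝ := fun i => l2norm (V i) with hr
  have hr0 : ∀ i, 0 ≤ r i := fun i => l2norm_nonneg _
  have hv1 : ∀ i, |(V i).eval 1| ≤ c * r i := fun i => (hcb _ (hV i)).eval 1 (by norm_num)
  have hv2 : ∀ i, |(V i).eval (-1)| ≤ c * r i := fun i => (hcb _ (hV i)).eval (-1) (by norm_num)
  set G := 2 * (4 * L * c * (D + c)) with hG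
  have hG0 : 0 ≤ G := by positivity
  have hright : ∀ i, α (M.left (i + 1)) = α (M.right i) := fun i => M.apply_left_add_one hα i
  have hleft : ∀ i, α (M.right (i - 1)) = α (M.left i) := fun i => by
    rw [← hright, sub_add_cancel]
  have heb : ∀ i j, |energyForm (κ i) k (derivative (basisAll (s i) j)) (V i)| ≤ D * r i :=
    fun i j => abs_energyForm_basisAll_le (hst i).nonneg (hst i).le (hst i).refBound
      (hcb _ (hV i)) j
  have hup : ∀ i, |refUpwind α M V i| ≤ c * (r i + r (i + 1)) := by
    intro i
    rw [refUpwind, mul_add]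
    split_ifs
    · exact (hv1 i).trans (le_add_of_nonneg_right (mul_nonneg hc (hr0 _)))
    · exact (hv2 _).trans (le_add_of_nonneg_left (mul_nonneg hc (hr0 _)))
  have hprod : ∀ i a b x y p q, |a| ≤ L * M.len i → |x| ≤ c * (p + q) → |y| ≤ c * q → 0 ≤ p →
      0 ≤ q → |b| ≤ (D + c) * q →
      |a * x - a * y| * |b| ≤ G * (M.len i / 2) * (q ^ 2 + p ^ 2) := by
    intro i a b x y p q ha hx hy hp hq hb
    have hlen := (M.len_pos i).le
    have h1 : |x - y| ≤ c * (p + 2 * q) := by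
      have := abs_sub x y
      linarith
    rw [← mul_sub, abs_mul]
    calc |a| * |x - y| * |b| ≤ (L * M.len i) * (c * (p + 2 * q)) * ((D + c) * q) :=
          mul_le_mul (mul_le_mul ha h1 (abs_nonneg _) (by positivity)) hb (abs_nonneg _)
            (by positivity)
      _ = (L * M.len i * c * (D + c)) * ((p + 2 * q) * q) := by ring
      _ ≤ (L * M.len i * c * (D + c)) * (4 * (q ^ 2 + p ^ 2)) := by
          refine mul_le_mul_of_nonneg_left ?_ (by positivity)
          nlinarith [sq_nonneg (p - q), sq_nonneg p, sq_nonneg q]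
      _ = _ := by rw [hG]; ring
  -- the corrections of the boundary fluxes are harmless, since `α` is small where they occur
  have hXL : ∀ i, |α (M.left i) * refUpwind α M V (i - 1) - α (M.left i) * (V i).eval (-1)|
      * |energyForm (κ i) k (derivative (basisAll (s i) 0)) (V i) + (V i).eval (-1)|
      ≤ G * (M.len i / 2) * (r i ^ 2 + r (i - 1) ^ 2) := by
    intro i
    have hnn : 0 ≤ G * (M.len i / 2) * (r i ^ 2 + r (i - 1) ^ 2) := by
      have := (hH i).le; positivity
    rcases (hst i).left with h | h | h
    · rw [h _ (hV i), neg_add_cancel, abs_zero, mul_zero]; exact hnn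
    · rw [refUpwind, if_neg (by rw [hleft]; exact not_lt.2 h), sub_add_cancel, sub_self, abs_zero,
        zero_mul]; exact hnn
    · have h1 := hup (i - 1)
      rw [sub_add_cancel] at h1
      refine hprod i _ _ _ _ _ _ h h1 (hv2 i) (hr0 _) (hr0 _) ?_
      rw [add_mul]
      exact (abs_add_le _ _).trans (add_le_add (heb i 0) (hv2 i))
  have hXR : ∀ i, |α (M.right i) * refUpwind α M V i - α (M.right i) * (V i).eval 1|
      * |energyForm (κ i) k (derivative (basisAll (s i) (Fin.last (k + 1)))) (V i)
        - (V i).eval 1|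
      ≤ G * (M.len i / 2) * (r i ^ 2 + r (i + 1) ^ 2) := by
    intro i
    have hnn : 0 ≤ G * (M.len i / 2) * (r i ^ 2 + r (i + 1) ^ 2) := by
      have := (hH i).le; positivity
    rcases (hst i).right with h | h | h
    · rw [h _ (hV i), sub_self, abs_zero, mul_zero]; exact hnn
    · rcases h.eq_or_lt with h | h
      · rw [← h]; simpa using hnn
      · rw [refUpwind, if_pos h, sub_self, abs_zero, zero_mul]; exact hnn
    · have h1 := hup i
      rw [add_comm] at h1
      refine hprod i _ _ _ _ _ _ h h1 (hv1 i) (hr0 _) (hr0 _) ?_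
      rw [add_mul]
      exact (abs_sub _ _).trans (add_le_add (heb i _) (hv1 i))
  have helem : ∀ i, M.len i / 2 * energyForm (κ i) k (Vt i) (V i) ≤ A i - B i
      + E * (M.len i / 2) * (r i ^ 2 + β i * r i)
      + G * (M.len i / 2) * (r i ^ 2 + r (i - 1) ^ 2)
      + G * (M.len i / 2) * (r i ^ 2 + r (i + 1) ^ 2) := by
    intro i
    have hp := (hst i).isPartition
    have h := element_energy_le (a := fun j => α (point M s i j)) (F := refFlux α M s V i)
      (L := 2 * L) hp (hst i).nonneg (hst i).le (hst i).refBound (hV i)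
      (hVt i) (hcb _ (hV i)) (hH i) (by positivity) hc (hβ i)
      (fun j hj0 hj1 => by rw [refFlux, if_neg hj0, if_neg hj1]) (fun j l => by
        refine (hLα _ (M.element_subset i (point_mem hp j)) _
          (M.element_subset i (point_mem hp l))).trans ?_
        have h1 := point_mem (M := M) (s := s) hp j
        have h2 := point_mem (M := M) (s := s) hp l
        have : |point M s i j - point M s i l| ≤ M.len i := by
          rw [Mesh.len, abs_le]; constructor <;> linarith [h1.1, h1.2, h2.1, h2.2]
        nlinarith) (hb i)
    simp only [refFlux_zero hp, refFlux_last hp, point_zero hp, point_last hp] at h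
    change _ ≤ A i - B i + E * (M.len i / 2) * (r i ^ 2 + β i * r i) + _ + _ at h
    exact h.trans (add_le_add (add_le_add le_rfl (hXL i)) (hXR i))
  -- the interface terms have a sign thanks to upwinding
  have hface : ∑ i, (A i - B i) ≤ 0 := by
    rw [Finset.sum_sub_distrib, ← sum_add_one B, ← Finset.sum_sub_distrib]
    refine Finset.sum_nonpos fun i _ => ?_
    simp only [hA, hB, hright, add_sub_cancel_right, refUpwind]
    split_ifs with h
    · nlinarith [mul_nonneg h.le (sq_nonneg ((V i).eval 1 - (V (i + 1)).eval (-1)))]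
    · nlinarith [mul_nonneg (neg_nonneg.2 (not_lt.1 h))
        (sq_nonneg ((V i).eval 1 - (V (i + 1)).eval (-1)))]
  have hHH : ∀ i j, M.len i / 2 ≤ ρ * (M.len j / 2) := fun i j => by
    have := (M.len_le_size i).trans (hM j)
    linarith
  set S := ∑ i, M.len i / 2 * r i ^ 2 with hS
  have hm : ∑ i, M.len i / 2 * r (i - 1) ^ 2 ≤ ρ * S := by
    rw [hS, ← sum_sub_one fun i => M.len i / 2 * r i ^ 2, Finset.mul_sum]
    refine Finset.sum_le_sum fun i _ => ?_
    rw [← mul_assoc]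
    exact mul_le_mul_of_nonneg_right (hHH _ _) (sq_nonneg _)
  have hp : ∑ i, M.len i / 2 * r (i + 1) ^ 2 ≤ ρ * S := by
    rw [hS, ← sum_add_one fun i => M.len i / 2 * r i ^ 2, Finset.mul_sum]
    refine Finset.sum_le_sum fun i _ => ?_
    rw [← mul_assoc]
    exact mul_le_mul_of_nonneg_right (hHH _ _) (sq_nonneg _)
  set S' := ∑ i, M.len i / 2 * β i ^ 2 with hS'
  have hS0 : 0 ≤ S := Finset.sum_nonneg fun i _ => mul_nonneg (hH i).le (sq_nonneg _)
  have hS0' : 0 ≤ S' := Finset.sum_nonneg fun i _ => mul_nonneg (hH i).le (sq_nonneg _)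
  calc _ ≤ ∑ i, ((A i - B i) + 2 * E * (M.len i / 2 * r i ^ 2) + 2 * E * (M.len i / 2 * β i ^ 2)
        + G * (2 * (M.len i / 2 * r i ^ 2) + M.len i / 2 * r (i - 1) ^ 2
          + M.len i / 2 * r (i + 1) ^ 2)) := by
        refine Finset.sum_le_sum fun i _ => (helem i).trans ?_
        have : E * (M.len i / 2) * (r i ^ 2 + β i * r i)
            ≤ E * (M.len i / 2) * (2 * r i ^ 2 + 2 * β i ^ 2) := by
          refine mul_le_mul_of_nonneg_left ?_ (mul_nonneg hE0 (hH i).le)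
          nlinarith [sq_nonneg (r i - β i), sq_nonneg (r i), sq_nonneg (β i)]
        linarith
    _ = (∑ i, (A i - B i)) + 2 * E * S + 2 * E * S' + G * (2 * S
          + (∑ i, M.len i / 2 * r (i - 1) ^ 2) + ∑ i, M.len i / 2 * r (i + 1) ^ 2) := by
        simp only [Finset.sum_add_distrib, ← Finset.mul_sum, hS, hS']
    _ ≤ 0 + 2 * E * S + 2 * E * S' + G * (2 * S + ρ * S + ρ * S) := by gcongr
    _ ≤ _ := by
        rw [globalConst, ← hE, ← hD]
        have h1 : 0 ≤ G * (1 + ρ) * S' := by positivity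
        have h2 : 4 * (4 * L * c * (D + c)) * (1 + ρ) = 2 * (G * (1 + ρ)) := by rw [hG]; ring
        rw [h2]
        linarith

end Stability

/-! ### Stability in time -/

theorem energyForm_sum_sum {k : ℕ} (κ : ℝ) {s : Fin (k + 2) → ℝ} (hs : IsPartition s) {p q : ℝ[X]}
    (hp : p.natDegree ≤ k) (hq : q.natDegree ≤ k) :
    energyForm κ k p q = ∑ j, ∑ l, p.eval (s j) * q.eval (s l)
      * energyForm κ k (basisAll s j) (basisAll s l) := by
  conv_lhs => rw [eq_sum_basisAll hs (hp.trans (Nat.le_succ k)), energyForm_sum_left]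
  refine Finset.sum_congr rfl fun j _ => ?_
  conv_lhs => rw [energyForm_C_mul_left, energyForm_comm,
    eq_sum_basisAll hs (hq.trans (Nat.le_succ k)), energyForm_sum_left, Finset.mul_sum]
  refine Finset.sum_congr rfl fun l _ => ?_
  rw [energyForm_C_mul_left, energyForm_comm]
  ring

theorem hasDerivWithinAt_energyForm {k : ℕ} (κ : ℝ) {s : Fin (k + 2) → ℝ} (hs : IsPartition s)
    {V : ℝ → ℝ[X]} {Vt : ℝ[X]} {S : Set ℝ} {t : ℝ} (ht : t ∈ S)
    (hV : ∀ τ ∈ S, (V τ).natDegree ≤ k) (hVt : Vt.natDegree ≤ k)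
    (hd : ∀ x ∈ Icc (-1 : ℝ) 1, HasDerivWithinAt (fun τ => (V τ).eval x) (Vt.eval x) S t) :
    HasDerivWithinAt (fun τ => energyForm κ k (V τ) (V τ)) (2 * energyForm κ k Vt (V t)) S t := by
  have h1 : ∀ τ ∈ S, energyForm κ k (V τ) (V τ) = ∑ j, ∑ l, (V τ).eval (s j) * (V τ).eval (s l)
      * energyForm κ k (basisAll s j) (basisAll s l) := fun τ hτ =>
    energyForm_sum_sum κ hs (hV τ hτ) (hV τ hτ)
  have h2 : HasDerivWithinAt (fun τ => ∑ j, ∑ l, (V τ).eval (s j) * (V τ).eval (s l)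
      * energyForm κ k (basisAll s j) (basisAll s l))
      (∑ j, ∑ l, (Vt.eval (s j) * (V t).eval (s l) + (V t).eval (s j) * Vt.eval (s l))
      * energyForm κ k (basisAll s j) (basisAll s l)) S t :=
    HasDerivWithinAt.fun_sum fun j _ => HasDerivWithinAt.fun_sum fun l _ =>
      ((hd _ (hs.mem_Icc j)).mul (hd _ (hs.mem_Icc l))).mul_const _
  refine (h2.congr h1 (h1 t ht)).congr_deriv ?_
  simp only [add_mul, Finset.sum_add_distrib]
  rw [← energyForm_sum_sum κ hs hVt (hV t ht), ← energyForm_sum_sum κ hs (hV t ht) hVt,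
    energyForm_comm κ k (V t)]
  ring

section Stability

variable {N k : ℕ} [NeZero N] {α : ℝ → ℝ} {M : Mesh N} {s : Fin N → Fin (k + 2) → ℝ}

omit [NeZero N] in
/-- The Gauss and the Radau partitions lead to a stable scheme. -/
theorem exists_stableElement (hk : 1 ≤ k) {K L : ℝ} (hK : 1 ≤ K)
    (href : ∀ s : Fin (k + 2) → ℝ, IsAdmissible s → RefBound s K)
    (hLα : ∀ x ∈ Icc 0 (2 * Real.pi), ∀ y ∈ Icc 0 (2 * Real.pi), |α x - α y| ≤ L * |x - y|)
    (hs : IsRSV α M s ∨ IsLSV s) (i : Fin N) : ∃ κ, StableElement α M K L i (s i) κ := by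
  have hdiff : |α (M.left i) - α (M.right i)| ≤ L * M.len i := by
    have := hLα _ (M.left_mem i) _ (M.right_mem i)
    rwa [abs_sub_comm (M.left i), abs_of_pos (sub_pos.2 (M.left_lt_right i))] at this
  rcases hs with hs | hs
  · obtain ⟨hR, hL, hRL⟩ := hs i
    rcases hRL with h | h
    · refine ⟨0, h.1, le_rfl, by linarith, href _ (Or.inr (Or.inr h)), ?_, Or.inl (h.rightExact hk)⟩
      rcases le_or_gt (α (M.left i)) 0 with h0 | h0
      · exact Or.inr (Or.inl h0)
      rcases lt_or_ge 0 (α (M.right i)) with h1 | h1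
      · exact Or.inl ((hR h0 h1).leftExact hk)
      · refine Or.inr (Or.inr (le_trans ?_ hdiff))
        rw [abs_of_pos h0, abs_of_nonneg (by linarith)]; linarith
    · refine ⟨0, h.1, le_rfl, by linarith, href _ (Or.inr (Or.inl h)), Or.inl (h.leftExact hk), ?_⟩
      rcases le_or_gt 0 (α (M.right i)) with h0 | h0
      · exact Or.inr (Or.inl h0)
      rcases lt_or_ge (α (M.left i)) 0 with h1 | h1
      · exact Or.inl ((hL h1 h0).rightExact hk)
      · refine Or.inr (Or.inr (le_trans ?_ hdiff))
        rw [abs_of_neg h0, abs_of_nonneg (by linarith)]; linarith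
  · have h := hs i
    have hb := href _ (Or.inl h)
    exact ⟨gaussCoeff (s i), h.1, h.gaussCoeff_nonneg hk, (le_abs_self _).trans hb.gaussCoeff, hb,
      Or.inl (h.leftExact hk), Or.inl (h.rightExact hk)⟩

/-- The constant in the stability estimate. -/
def stabilityConst (k : ℕ) (K c L ρ T : ℝ) : ℝ :=
  ((2 + K) * c ^ 2 + 1) * Real.exp (2 * globalConst k K c L ρ * T)

/-- Stability of the scheme in `L²`, with residuals `β` of the control volume equations. -/
theorem sum_l2norm_sq_le {K c L ρ T : ℝ} (hα : α 0 = α (2 * Real.pi)) (hL : 0 ≤ L)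
    (hLα : ∀ x ∈ Icc 0 (2 * Real.pi), ∀ y ∈ Icc 0 (2 * Real.pi), |α x - α y| ≤ L * |x - y|)
    (hρ : 0 ≤ ρ) (hM : M.IsRegular ρ) {κ : Fin N → ℝ} (hK : 0 ≤ K)
    (hst : ∀ i, StableElement α M K L i (s i) (κ i)) (hc : 0 ≤ c)
    (hcb : ∀ p : ℝ[X], p.natDegree ≤ k → PolyBound (c * l2norm p) p)
    {V Vt : ℝ → Fin N → ℝ[X]} (hV : ∀ t ∈ Icc 0 T, ∀ i, (V t i).natDegree ≤ k)
    (hVt : ∀ t ∈ Icc 0 T, ∀ i, (Vt t i).natDegree ≤ k)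
    (hder : ∀ t ∈ Icc 0 T, ∀ i, ∀ x ∈ Icc (-1 : ℝ) 1,
      HasDerivWithinAt (fun τ => (V τ i).eval x) ((Vt t i).eval x) (Icc 0 T) t)
    {β : Fin N → ℝ} (hβ : ∀ i, 0 ≤ β i)
    (hb : ∀ t ∈ Icc 0 T, ∀ i, ∀ j : Fin (k + 1),
      |M.len i / 2 * (∫ x in (s i j.castSucc)..(s i j.succ), (Vt t i).eval x)
        + refFlux α M s (V t) i j.succ - refFlux α M s (V t) i j.castSucc|
          ≤ M.len i / 2 * β i) {t : ℝ} (ht : t ∈ Icc 0 T) :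
    ∑ i, M.len i / 2 * l2norm (V t i) ^ 2 ≤ stabilityConst k K c L ρ T
      * (∑ i, M.len i / 2 * l2norm (V 0 i) ^ 2 + ∑ i, M.len i / 2 * β i ^ 2) := by
  have hH : ∀ i, 0 < M.len i / 2 := fun i => half_pos (M.len_pos i)
  set G := globalConst k K c L ρ with hG
  have hG0 : 0 ≤ G := by rw [hG, globalConst, elementConst]; positivity
  set S := ∑ i, M.len i / 2 * β i ^ 2 with hS
  have hS0 : 0 ≤ S := Finset.sum_nonneg fun i _ => mul_nonneg (hH i).le (sq_nonneg _)
  set E : ℝ → ℝ := fun τ => ∑ i, M.len i / 2 * energyForm (κ i) k (V τ i) (V τ i) with hE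
  have hEd : ∀ τ ∈ Icc 0 T, HasDerivWithinAt E
      (∑ i, M.len i / 2 * (2 * energyForm (κ i) k (Vt τ i) (V τ i))) (Icc 0 T) τ := fun τ hτ =>
    HasDerivWithinAt.fun_sum fun i _ =>
      (hasDerivWithinAt_energyForm (κ i) (hst i).isPartition hτ (fun τ hτ => hV τ hτ i)
        (hVt τ hτ i) (hder τ hτ i)).const_mul _
  have hlow : ∀ τ, ∑ i, M.len i / 2 * l2norm (V τ i) ^ 2 ≤ E τ := fun τ =>
    Finset.sum_le_sum fun i _ => mul_le_mul_of_nonneg_left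
      (l2norm_sq_le_energyForm (hst i).nonneg _) (hH i).le
  have hle : ∀ τ ∈ Icc 0 T, ∑ i, M.len i / 2 * (2 * energyForm (κ i) k (Vt τ i) (V τ i))
      ≤ 2 * G * (E τ + S) := by
    intro τ hτ
    have h := sum_energy_le hα hL hLα hρ hM hK hst hc hcb (hV τ hτ) (hVt τ hτ) hβ (hb τ hτ)
    rw [← hG, ← hS] at h
    calc _ = 2 * ∑ i, M.len i / 2 * energyForm (κ i) k (Vt τ i) (V τ i) := by
          rw [Finset.mul_sum]; exact Finset.sum_congr rfl fun i _ => by ring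
      _ ≤ 2 * (G * (E τ + S)) := by
          refine mul_le_mul_of_nonneg_left (h.trans ?_) (by norm_num)
          exact mul_le_mul_of_nonneg_left (add_le_add (hlow τ) le_rfl) hG0
      _ = _ := by ring
  -- Gronwall's inequality
  set φ : ℝ → ℝ := fun τ => Real.exp (-(2 * G * τ)) * (E τ + S) with hφ
  have hφd : ∀ τ ∈ Icc 0 T, HasDerivWithinAt φ (Real.exp (-(2 * G * τ)) * (-(2 * G)) * (E τ + S)
      + Real.exp (-(2 * G * τ))
        * ∑ i, M.len i / 2 * (2 * energyForm (κ i) k (Vt τ i) (V τ i))) (Icc 0 T) τ := by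
    intro τ hτ
    have h1 : HasDerivWithinAt (fun τ : ℝ => Real.exp (-(2 * G * τ)))
        (Real.exp (-(2 * G * τ)) * (-(2 * G))) (Icc 0 T) τ := by
      have : HasDerivAt (fun τ : ℝ => -(2 * G * τ)) (-(2 * G)) τ := by
        simpa using ((hasDerivAt_id' τ).const_mul (2 * G)).fun_neg
      exact this.exp.hasDerivWithinAt
    exact h1.mul ((hEd τ hτ).add_const S)
  have hanti : AntitoneOn φ (Icc 0 T) := by
    refine antitoneOn_of_deriv_nonpos (convex_Icc _ _) (fun τ hτ => (hφd τ hτ).continuousWithinAt)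
      (fun τ hτ => ((hφd τ (interior_subset hτ)).mono interior_subset).differentiableWithinAt)
      fun τ hτ => ?_
    have hτ' := interior_subset hτ
    rw [interior_Icc] at hτ
    rw [((hφd τ hτ').hasDerivAt (Icc_mem_nhds hτ.1 hτ.2)).deriv]
    have := mul_le_mul_of_nonneg_left (hle τ hτ') (Real.exp_pos (-(2 * G * τ))).le
    linarith
  have h0T : (0 : ℝ) ∈ Icc 0 T := ⟨le_rfl, ht.1.trans ht.2⟩
  have h1 := hanti h0T ht ht.1
  simp only [hφ, mul_zero, neg_zero, Real.exp_zero, one_mul] at h1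
  have hE0 : E 0 ≤ (2 + K) * c ^ 2 * ∑ i, M.len i / 2 * l2norm (V 0 i) ^ 2 := by
    rw [Finset.mul_sum]
    refine Finset.sum_le_sum fun i _ => ?_
    have h2 := energyForm_self_le (k := k) (hst i).nonneg (hcb _ (hV 0 h0T i))
    have h3 : (2 + κ i) * c ^ 2 * l2norm (V 0 i) ^ 2 ≤ (2 + K) * c ^ 2 * l2norm (V 0 i) ^ 2 := by
      have := (hst i).le
      gcongr
    calc _ ≤ M.len i / 2 * ((2 + K) * c ^ 2 * l2norm (V 0 i) ^ 2) :=
          mul_le_mul_of_nonneg_left (h2.trans h3) (hH i).le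
      _ = _ := by ring
  have h2 : E t + S ≤ Real.exp (2 * G * t) * (E 0 + S) := by
    have h3 := mul_le_mul_of_nonneg_left h1 (Real.exp_pos (2 * G * t)).le
    rwa [← mul_assoc, ← Real.exp_add, add_neg_cancel, Real.exp_zero, one_mul] at h3
  set S₀ := ∑ i, M.len i / 2 * l2norm (V 0 i) ^ 2 with hS₀
  have hS₀0 : 0 ≤ S₀ := Finset.sum_nonneg fun i _ => mul_nonneg (hH i).le (sq_nonneg _)
  have hexp : Real.exp (2 * G * t) ≤ Real.exp (2 * G * T) :=
    Real.exp_le_exp.2 (mul_le_mul_of_nonneg_left ht.2 (by positivity))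
  have hKc : 0 ≤ (2 + K) * c ^ 2 := by positivity
  calc _ ≤ E t := hlow t
    _ ≤ Real.exp (2 * G * t) * (E 0 + S) := by linarith
    _ ≤ Real.exp (2 * G * t) * (((2 + K) * c ^ 2 + 1) * (S₀ + S)) := by
        refine mul_le_mul_of_nonneg_left ?_ (Real.exp_pos _).le
        nlinarith [mul_nonneg hKc hS0]
    _ ≤ Real.exp (2 * G * T) * (((2 + K) * c ^ 2 + 1) * (S₀ + S)) :=
        mul_le_mul_of_nonneg_right hexp (by positivity)
    _ = _ := by rw [stabilityConst]; ring

end Stability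

/-! ### Interpolation on the reference element -/

section RefInterp

variable {k : ℕ} {s : Fin (k + 2) → ℝ} {o : Fin (k + 2)} {K : ℝ}

/-- The interpolant of degree at most `k` at the partition points other than `s o`. -/
def refInterp (s : Fin (k + 2) → ℝ) (o : Fin (k + 2)) (f : ℝ → ℝ) : ℝ[X] :=
  ∑ j, C (f (s (o.succAbove j))) * basisOmit s o j

theorem IsPartition.injOn_succAbove (hs : IsPartition s) (o : Fin (k + 2)) (S : Set (Fin (k + 1))) :
    Set.InjOn (fun j => s (o.succAbove j)) S := fun _ _ _ _ h =>
  Fin.succAbove_right_injective (hs.strictMono.injective h)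

theorem natDegree_basisOmit (hs : IsPartition s) (o : Fin (k + 2)) (j : Fin (k + 1)) :
    (basisOmit s o j).natDegree = k := by
  rw [basisOmit, Lagrange.natDegree_basis (hs.injOn_succAbove o _) (Finset.mem_univ _)]
  simp

theorem natDegree_refInterp_le (hs : IsPartition s) (o : Fin (k + 2)) (f : ℝ → ℝ) :
    (refInterp s o f).natDegree ≤ k :=
  natDegree_sum_le_of_forall_le _ _ fun j _ =>
    (natDegree_C_mul_le _ _).trans (natDegree_basisOmit hs o j).le

theorem eval_refInterp (hs : IsPartition s) (f : ℝ → ℝ) {j : Fin (k + 2)} (hj : j ≠ o) :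
    (refInterp s o f).eval (s j) = f (s j) := by
  obtain ⟨l, rfl⟩ := Fin.exists_succAbove_eq hj
  rw [refInterp, eval_finsetSum, Finset.sum_eq_single l]
  · rw [eval_mul, eval_C, basisOmit]
    have := Lagrange.eval_basis_self
      (hs.injOn_succAbove o ((Finset.univ : Finset (Fin (k + 1))) : Set (Fin (k + 1))))
      (Finset.mem_univ l)
    rw [this, mul_one]
  · intro i _ hi
    rw [eval_mul, basisOmit]
    have := Lagrange.eval_basis_of_ne (s := Finset.univ) (v := fun j => s (o.succAbove j)) hi
      (Finset.mem_univ l)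
    rw [this, mul_zero]
  · simp

/-- A polynomial of degree at most `k` is determined by its values at the nodes. -/
theorem eq_refInterp (hs : IsPartition s) {p : ℝ[X]} (hp : p.natDegree ≤ k) {f : ℝ → ℝ}
    (h : ∀ j, j ≠ o → p.eval (s j) = f (s j)) : p = refInterp s o f := by
  refine Polynomial.eq_of_degrees_lt_of_eval_index_eq (Finset.univ : Finset (Fin (k + 1)))
    (hs.injOn_succAbove o _) ?_ ?_ fun j _ => ?_
  · rw [Finset.card_univ, Fintype.card_fin]
    exact (natDegree_le_iff_degree_le.1 hp).trans_lt (by exact_mod_cast Nat.lt_succ_self _)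
  · rw [Finset.card_univ, Fintype.card_fin]
    exact (natDegree_le_iff_degree_le.1 (natDegree_refInterp_le hs o f)).trans_lt
      (by exact_mod_cast Nat.lt_succ_self _)
  · rw [eval_refInterp hs f (Fin.succAbove_ne o j), h _ (Fin.succAbove_ne o j)]

theorem refInterp_sub (f g : ℝ → ℝ) :
    refInterp s o (fun x => f x - g x) = refInterp s o f - refInterp s o g := by
  rw [refInterp, refInterp, refInterp, ← Finset.sum_sub_distrib]
  exact Finset.sum_congr rfl fun j _ => by rw [C_sub, sub_mul]

theorem abs_eval_refInterp_le (hs : IsPartition s) (hK : RefBound s K) {f : ℝ → ℝ} {ε : ℝ}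
    (hf : ∀ x ∈ Icc (-1 : ℝ) 1, |f x| ≤ ε) {x : ℝ} (hx : x ∈ Icc (-1 : ℝ) 1) :
    |(refInterp s o f).eval x| ≤ (k + 1) * K * ε := by
  have hε : 0 ≤ ε := (abs_nonneg _).trans (hf x hx)
  rw [refInterp, eval_finsetSum]
  calc _ ≤ ∑ _j : Fin (k + 1), ε * K := by
        refine (Finset.abs_sum_le_sum_abs _ _).trans (Finset.sum_le_sum fun j _ => ?_)
        rw [eval_mul, eval_C, abs_mul]
        exact mul_le_mul (hf _ (hs.mem_Icc _)) ((hK.basisOmit o j).eval x hx) (abs_nonneg _) hε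
    _ = _ := by
        rw [Finset.sum_const, Finset.card_univ, Fintype.card_fin, nsmul_eq_mul]; push_cast; ring

theorem abs_eval_derivative_refInterp_le (hs : IsPartition s) (hK : RefBound s K) {f : ℝ → ℝ}
    {ε : ℝ} (hf : ∀ x ∈ Icc (-1 : ℝ) 1, |f x| ≤ ε) {x : ℝ} (hx : x ∈ Icc (-1 : ℝ) 1) :
    |(derivative (refInterp s o f)).eval x| ≤ (k + 1) * K * ε := by
  have hε : 0 ≤ ε := (abs_nonneg _).trans (hf x hx)
  rw [refInterp, derivative_sum, eval_finsetSum]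
  calc _ ≤ ∑ _j : Fin (k + 1), ε * K := by
        refine (Finset.abs_sum_le_sum_abs _ _).trans (Finset.sum_le_sum fun j _ => ?_)
        rw [derivative_C_mul, eval_mul, eval_C, abs_mul]
        exact mul_le_mul (hf _ (hs.mem_Icc _)) ((hK.basisOmit o j).eval_derivative x hx)
          (abs_nonneg _) hε
    _ = _ := by
        rw [Finset.sum_const, Finset.card_univ, Fintype.card_fin, nsmul_eq_mul]; push_cast; ring

theorem natDegree_nodalOmit (o : Fin (k + 2)) : (nodalOmit s o).natDegree = k + 1 := by
  rw [nodalOmit, Lagrange.natDegree_nodal]; simp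

theorem eval_nodalOmit {j : Fin (k + 2)} (hj : j ≠ o) : (nodalOmit s o).eval (s j) = 0 := by
  rw [nodalOmit_eq]
  exact Lagrange.eval_nodal_at_node (Finset.mem_erase.2 ⟨hj, Finset.mem_univ _⟩)

/-- The interpolation error of a polynomial of degree `k + 1` is a multiple of the nodal
polynomial. -/
theorem sub_refInterp_eq (hs : IsPartition s) {p : ℝ[X]} (hp : p.natDegree ≤ k + 1) :
    p - refInterp s o (fun x => p.eval x) = C (p.coeff (k + 1)) * nodalOmit s o := by
  have hmon : (nodalOmit s o).coeff (k + 1) = 1 := by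
    have := (Lagrange.nodal_monic (s := Finset.univ)
      (v := fun j => s (o.succAbove j))).coeff_natDegree
    rwa [← nodalOmit, natDegree_nodalOmit] at this
  have hq : (p - C (p.coeff (k + 1)) * nodalOmit s o).natDegree ≤ k := by
    rw [natDegree_le_iff_coeff_eq_zero]
    intro n hn
    rw [coeff_sub, coeff_C_mul]
    rcases (Nat.succ_le_of_lt hn).eq_or_lt with h | h
    · rw [← h]
      change p.coeff (k + 1) - p.coeff (k + 1) * (nodalOmit s o).coeff (k + 1) = 0
      rw [hmon, mul_one, sub_self]
    · rw [coeff_eq_zero_of_natDegree_lt (hp.trans_lt h),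
        coeff_eq_zero_of_natDegree_lt (p := nodalOmit s o)
          (by rw [natDegree_nodalOmit]; exact h), mul_zero, sub_self]
  rw [← eq_refInterp (o := o) hs hq (f := fun x => p.eval x) fun j hj => by
    rw [eval_sub, eval_mul, eval_nodalOmit hj, mul_zero, sub_zero]]
  ring

/-- Interpolation error of a function close to a polynomial of degree `k + 1`. -/
theorem abs_sub_refInterp_le (hs : IsPartition s) (hK : RefBound s K) {f : ℝ → ℝ} {p : ℝ[X]}
    (hp : p.natDegree ≤ k + 1) {ε : ℝ} (hf : ∀ x ∈ Icc (-1 : ℝ) 1, |f x - p.eval x| ≤ ε) {x : ℝ}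
    (hx : x ∈ Icc (-1 : ℝ) 1) :
    |f x - (refInterp s o f).eval x - p.coeff (k + 1) * (nodalOmit s o).eval x|
      ≤ (1 + (k + 1) * K) * ε := by
  have h1 := congrArg (fun q => q.eval x) (sub_refInterp_eq (o := o) hs hp)
  simp only [eval_sub, eval_mul, eval_C] at h1
  have h2 := abs_eval_refInterp_le (o := o) hs hK hf hx
  rw [refInterp_sub f fun x => p.eval x, eval_sub] at h2
  have h3 : f x - (refInterp s o f).eval x - p.coeff (k + 1) * (nodalOmit s o).eval x
      = (f x - p.eval x)
        - ((refInterp s o f).eval x - (refInterp s o fun x => p.eval x).eval x) := by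
    rw [← h1]; ring
  rw [h3]
  exact (abs_sub _ _).trans (by linarith [hf x hx])

/-- Error of the derivative of the interpolant. -/
theorem abs_deriv_sub_refInterp_le (hs : IsPartition s) (hK : RefBound s K) {f : ℝ → ℝ} {p : ℝ[X]}
    (hp : p.natDegree ≤ k + 1) {ε ε' y : ℝ} (hf : ∀ x ∈ Icc (-1 : ℝ) 1, |f x - p.eval x| ≤ ε)
    {x : ℝ} (hx : x ∈ Icc (-1 : ℝ) 1) (hy : |y - (derivative p).eval x| ≤ ε') :
    |y - (derivative (refInterp s o f)).eval x
        - p.coeff (k + 1) * (derivative (nodalOmit s o)).eval x| ≤ ε' + (k + 1) * K * ε := by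
  have h1 := congrArg (fun q => (derivative q).eval x) (sub_refInterp_eq (o := o) hs hp)
  simp only [derivative_sub, derivative_C_mul, eval_sub, eval_mul, eval_C] at h1
  have h2 := abs_eval_derivative_refInterp_le (o := o) hs hK hf hx
  rw [refInterp_sub f fun x => p.eval x, derivative_sub, eval_sub] at h2
  have h3 : y - (derivative (refInterp s o f)).eval x
        - p.coeff (k + 1) * (derivative (nodalOmit s o)).eval x
      = (y - (derivative p).eval x) - ((derivative (refInterp s o f)).eval x
        - (derivative (refInterp s o fun x => p.eval x)).eval x) := by
    rw [← h1]; ring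
  rw [h3]
  exact (abs_sub _ _).trans (by linarith)

end RefInterp

/-! ### Leading coefficients from point values -/

/-- Points of `[-1, 1]` from whose values the leading coefficient is computed. -/
def leadNode (n : ℕ) (j : Fin (n + 1)) : ℝ := (j : ℕ) / (n + 1)

/-- The weights of the values in the formula for the leading coefficient. -/
def leadWeight (n : ℕ) (j : Fin (n + 1)) : ℝ :=
  (Lagrange.basis Finset.univ (leadNode n) j).coeff n

/-- The coefficient of order `n` of the polynomial of degree at most `n` that interpolates `f` at
the points `leadNode n`. -/
def leadCoeff (n : ℕ) (f : ℝ → ℝ) : ℝ := ∑ j, leadWeight n j * f (leadNode n j)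

/-- The norm of the functional `leadCoeff n`. -/
def leadConst (n : ℕ) : ℝ := ∑ j, |leadWeight n j|

theorem leadConst_nonneg (n : ℕ) : 0 ≤ leadConst n := Finset.sum_nonneg fun _ _ => abs_nonneg _

theorem leadNode_mem (n : ℕ) (j : Fin (n + 1)) : leadNode n j ∈ Icc (-1 : ℝ) 1 := by
  have h : ((j : ℕ) : ℝ) ≤ n := by exact_mod_cast Nat.lt_succ_iff.1 j.2
  have h0 : (0 : ℝ) ≤ leadNode n j := by unfold leadNode; positivity
  refine ⟨by linarith, ?_⟩
  rw [leadNode, div_le_one (by positivity)]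
  linarith

theorem leadNode_injective (n : ℕ) : Function.Injective (leadNode n) := by
  intro i j h
  have hn : (n : ℝ) + 1 ≠ 0 := by positivity
  rw [leadNode, leadNode, div_left_inj' hn] at h
  exact Fin.ext (by exact_mod_cast h)

/-- The functional is exact on polynomials. -/
theorem leadCoeff_eval {n : ℕ} {p : ℝ[X]} (hp : p.natDegree ≤ n) :
    leadCoeff n (fun x => p.eval x) = p.coeff n := by
  have h := Lagrange.eq_interpolate (s := Finset.univ) (v := leadNode n) (f := p)
    (leadNode_injective n).injOn (by
      rw [Finset.card_univ, Fintype.card_fin]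
      exact (natDegree_le_iff_degree_le.1 hp).trans_lt (by exact_mod_cast Nat.lt_succ_self _))
  conv_rhs => rw [h, Lagrange.interpolate_apply, finsetSum_coeff]
  exact Finset.sum_congr rfl fun j _ => by rw [coeff_C_mul, mul_comm]; rfl

theorem abs_leadCoeff_sub_le {n : ℕ} {p : ℝ[X]} (hp : p.natDegree ≤ n) {f : ℝ → ℝ} {ε : ℝ}
    (hf : ∀ x ∈ Icc (-1 : ℝ) 1, |f x - p.eval x| ≤ ε) :
    |leadCoeff n f - p.coeff n| ≤ leadConst n * ε := by
  rw [← leadCoeff_eval hp, leadCoeff, leadCoeff, ← Finset.sum_sub_distrib, leadConst,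
    Finset.sum_mul]
  refine (Finset.abs_sum_le_sum_abs _ _).trans (Finset.sum_le_sum fun j _ => ?_)
  rw [← mul_sub, abs_mul]
  exact mul_le_mul_of_nonneg_left (hf _ (leadNode_mem n j)) (abs_nonneg _)

theorem hasDerivWithinAt_leadCoeff {n : ℕ} {f : ℝ → ℝ → ℝ} {f' : ℝ → ℝ} {S : Set ℝ} {t : ℝ}
    (h : ∀ x ∈ Icc (-1 : ℝ) 1, HasDerivWithinAt (fun τ => f τ x) (f' x) S t) :
    HasDerivWithinAt (fun τ => leadCoeff n (f τ)) (leadCoeff n f') S t :=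
  HasDerivWithinAt.fun_sum fun j _ => (h _ (leadNode_mem n j)).const_mul _

/-! ### Transformation to the reference element -/

section Transform

variable {N k n : ℕ} (M : Mesh N) (i : Fin N)

/-- The affine map onto an element, as a polynomial. -/
def Mesh.affine : ℝ[X] := C (M.len i / 2) * X + C ((M.left i + M.right i) / 2)

theorem Mesh.eval_comp_affine (p : ℝ[X]) (x : ℝ) :
    (p.comp (M.affine i)).eval x = p.eval (M.toElement i x) := by
  rw [eval_comp, affine, toElement]; simp

theorem Mesh.eval_derivative_comp_affine (p : ℝ[X]) (x : ℝ) :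
    (derivative (p.comp (M.affine i))).eval x
      = M.len i / 2 * (derivative p).eval (M.toElement i x) := by
  have h : derivative (M.affine i) = C (M.len i / 2) := by rw [affine]; simp
  rw [derivative_comp, eval_mul, M.eval_comp_affine, h, eval_C]

theorem Mesh.natDegree_comp_affine_le {p : ℝ[X]} (hp : p.natDegree ≤ n) :
    (p.comp (M.affine i)).natDegree ≤ n := by
  have h : (M.affine i).natDegree ≤ 1 := natDegree_linear_le
  calc _ ≤ p.natDegree * (M.affine i).natDegree := natDegree_comp_le
    _ ≤ n * 1 := Nat.mul_le_mul hp h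
    _ = n := mul_one n

variable {M i}

theorem JetBound.exists_poly_ref {F : ℝ → ℝ} {Q : ℝ}
    (h : JetBound (Icc (M.left i) (M.right i)) n F Q) :
    ∃ p : ℝ[X], p.natDegree ≤ n ∧ ∀ x ∈ Icc (-1 : ℝ) 1,
      |F (M.toElement i x) - p.eval x| ≤ Q * M.len i ^ (n + 1) := by
  obtain ⟨p, hp, h⟩ := h.exists_poly (M.left_lt_right i).le
  refine ⟨_, M.natDegree_comp_affine_le i hp, fun x hx => ?_⟩
  rw [M.eval_comp_affine]
  exact h _ (M.toElement_mem i hx)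

theorem JetBound.exists_poly_deriv_ref {F F' : ℝ → ℝ} {Q : ℝ}
    (hF : ∀ x ∈ Icc (M.left i) (M.right i),
      HasDerivWithinAt F (F' x) (Icc (M.left i) (M.right i)) x)
    (h : JetBound (Icc (M.left i) (M.right i)) n F' Q) :
    ∃ p : ℝ[X], p.natDegree ≤ n + 1 ∧ ∀ x ∈ Icc (-1 : ℝ) 1,
      |F (M.toElement i x) - p.eval x| ≤ Q * M.len i ^ (n + 2) ∧
      |M.len i / 2 * F' (M.toElement i x) - (derivative p).eval x|
        ≤ M.len i / 2 * (Q * M.len i ^ (n + 1)) := by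
  obtain ⟨p, hp, h, h'⟩ := JetBound.exists_poly_deriv (M.left_lt_right i).le hF h
  refine ⟨_, M.natDegree_comp_affine_le i hp, fun x hx => ⟨?_, ?_⟩⟩
  · rw [M.eval_comp_affine]
    exact h _ (M.toElement_mem i hx)
  · rw [M.eval_derivative_comp_affine, ← mul_sub, abs_mul, abs_of_pos (half_pos (M.len_pos i))]
    exact mul_le_mul_of_nonneg_left (h' _ (M.toElement_mem i hx)) (half_pos (M.len_pos i)).le

theorem interp_comp_affine {α : ℝ → ℝ} {s : Fin N → Fin (k + 2) → ℝ} (hs : IsPartition (s i))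
    (φ : ℝ → ℝ) : (interp α M s φ i).comp (M.affine i)
      = refInterp (s i) (omitted α M k i) fun x => φ (M.toElement i x) := by
  have hinj : Set.InjOn (interpNode α M s i) (Finset.univ : Finset (Fin (k + 1))) := by
    intro a _ b _ h
    simp only [interpNode, point, Mesh.toElement, add_left_inj] at h
    exact Fin.succAbove_right_injective
      (hs.strictMono.injective (mul_left_cancel₀ (half_pos (M.len_pos i)).ne' h))
  have hd : (interp α M s φ i).natDegree ≤ k := by
    rw [natDegree_le_iff_degree_le]
    refine (Lagrange.degree_interpolate_le (r := fun j => φ (interpNode α M s i j)) hinj).trans ?_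
    rw [Finset.card_univ, Fintype.card_fin, Nat.add_sub_cancel]
  refine eq_refInterp hs (M.natDegree_comp_affine_le i hd) fun j hj => ?_
  obtain ⟨l, rfl⟩ := Fin.exists_succAbove_eq hj
  rw [M.eval_comp_affine]
  exact Lagrange.eval_interpolate_at_node _ hinj (Finset.mem_univ l)

end Transform

/-! ### The interpolation defect of the time derivative -/

section Defect

variable {N k : ℕ} (M : Mesh N) (i : Fin N)

/-- The coefficient of the nodal polynomial in the leading part of the interpolation error of
`g - F'` on an element.  It is computed from point values of `g` and `F` only, so that for
`F = α u` it can be differentiated in time. -/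
def defectCoeff (k : ℕ) (g F : ℝ → ℝ) : ℝ :=
  leadCoeff (k + 1) (fun x => g (M.toElement i x))
    - (k + 2) / (M.len i / 2) * leadCoeff (k + 2) (fun x => F (M.toElement i x))

/-- The constant in the bounds for `defectCoeff`. -/
def defectConst (k : ℕ) : ℝ := leadConst (k + 1) + 2 * (k + 2) * leadConst (k + 2)

theorem defectConst_nonneg (k : ℕ) : 0 ≤ defectConst k := by
  have h1 := leadConst_nonneg (k + 1)
  have h2 := leadConst_nonneg (k + 2)
  unfold defectConst
  positivity

variable {M i}

theorem abs_defect_le {x y G B : ℝ} (hG : 0 ≤ G) (hB : 0 ≤ B) {n : ℕ}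
    (hx : |x| ≤ leadConst (k + 1) * (G * M.len i ^ n))
    (hy : |y| ≤ leadConst (k + 2) * (B * M.len i ^ (n + 1))) :
    |x - (k + 2) / (M.len i / 2) * y| ≤ defectConst k * (G + B) * M.len i ^ n := by
  have hl := M.len_pos i
  have h1 := leadConst_nonneg (k + 1)
  have h2 := leadConst_nonneg (k + 2)
  have h3 : |(k + 2) / (M.len i / 2) * y| ≤ 2 * (k + 2) * leadConst (k + 2) * B * M.len i ^ n := by
    rw [abs_mul, abs_of_nonneg (by positivity : (0 : ℝ) ≤ (k + 2) / (M.len i / 2))]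
    refine (mul_le_mul_of_nonneg_left hy (by positivity)).trans (le_of_eq ?_)
    field_simp
    ring
  refine (abs_sub _ _).trans ((add_le_add hx h3).trans ?_)
  have h4 : 0 ≤ leadConst (k + 1) * B * M.len i ^ n := by positivity
  have h5 : 0 ≤ 2 * (k + 2) * leadConst (k + 2) * G * M.len i ^ n := by positivity
  rw [defectConst]
  linarith

theorem abs_defectCoeff_le {g F : ℝ → ℝ} {G B : ℝ} (hG0 : 0 ≤ G) (hB0 : 0 ≤ B)
    (hg : JetBound (Icc (M.left i) (M.right i)) k g G)
    (hF : JetBound (Icc (M.left i) (M.right i)) (k + 1) F B) :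
    |defectCoeff M i k g F| ≤ defectConst k * (G + B) * M.len i ^ (k + 1) := by
  obtain ⟨p, hp, hgp⟩ := hg.exists_poly_ref
  obtain ⟨q, hq, hFq⟩ := hF.exists_poly_ref
  have h1 := abs_leadCoeff_sub_le (hp.trans (Nat.le_succ k)) hgp
  have h2 := abs_leadCoeff_sub_le (hq.trans (Nat.le_succ (k + 1))) hFq
  rw [coeff_eq_zero_of_natDegree_lt (by omega), sub_zero] at h1 h2
  exact abs_defect_le hG0 hB0 h1 h2

/-- The constant in the bound for the interpolation error without its leading part. -/
def consistencyConst (k : ℕ) (K : ℝ) : ℝ := 1 + (k + 1) * K + defectConst k * K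

theorem consistencyConst_nonneg (k : ℕ) {K : ℝ} (hK : 0 ≤ K) : 0 ≤ consistencyConst k K := by
  have := defectConst_nonneg k
  unfold consistencyConst
  positivity

/-- The interpolation error of `g - F'` is a multiple of the nodal polynomial up to a term of one
order more. -/
theorem abs_sub_refInterp_sub_defect_le {s : Fin (k + 2) → ℝ} (hs : IsPartition s) {K : ℝ}
    (hK : RefBound s K) (o : Fin (k + 2)) {g F F' : ℝ → ℝ} {G B : ℝ} (hG0 : 0 ≤ G) (hB0 : 0 ≤ B)
    (hg : JetBound (Icc (M.left i) (M.right i)) (k + 1) g G)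
    (hF : ∀ x ∈ Icc (M.left i) (M.right i),
      HasDerivWithinAt F (F' x) (Icc (M.left i) (M.right i)) x)
    (hF' : JetBound (Icc (M.left i) (M.right i)) (k + 1) F' B) {x : ℝ}
    (hx : x ∈ Icc (-1 : ℝ) 1) :
    |(g (M.toElement i x) - F' (M.toElement i x))
        - (refInterp s o fun x => g (M.toElement i x) - F' (M.toElement i x)).eval x
        - defectCoeff M i k g F * (nodalOmit s o).eval x|
      ≤ consistencyConst k K * (G + B) * M.len i ^ (k + 2) := by
  have hl := M.len_pos i
  obtain ⟨p, hp, hgp⟩ := hg.exists_poly_ref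
  obtain ⟨q, hq, hFq⟩ := hF'.exists_poly_deriv_ref hF
  set r := p - C (1 / (M.len i / 2)) * derivative q with hr
  have hrk : r.natDegree ≤ k + 1 := by
    refine (natDegree_sub_le _ _).trans (max_le hp ((natDegree_C_mul_le _ _).trans ?_))
    exact (natDegree_derivative_le q).trans (by omega)
  have hrc : r.coeff (k + 1) = p.coeff (k + 1) - (k + 2) / (M.len i / 2) * q.coeff (k + 2) := by
    rw [hr, coeff_sub, coeff_C_mul, coeff_derivative]
    push_cast
    ring
  have hrf : ∀ x ∈ Icc (-1 : ℝ) 1, |g (M.toElement i x) - F' (M.toElement i x) - r.eval x|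
      ≤ (G + B) * M.len i ^ (k + 2) := by
    intro x hx
    have h1 := hgp x hx
    have h2 := (hFq x hx).2
    have h3 : g (M.toElement i x) - F' (M.toElement i x) - r.eval x
        = (g (M.toElement i x) - p.eval x)
          - 1 / (M.len i / 2) * (M.len i / 2 * F' (M.toElement i x) - (derivative q).eval x) := by
      rw [hr, eval_sub, eval_mul, eval_C]
      field_simp
      ring
    have h4 : |1 / (M.len i / 2) * (M.len i / 2 * F' (M.toElement i x) - (derivative q).eval x)|
        ≤ B * M.len i ^ (k + 2) := by
      rw [abs_mul, abs_of_pos (by positivity : 0 < 1 / (M.len i / 2))]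
      refine (mul_le_mul_of_nonneg_left h2 (by positivity)).trans (le_of_eq ?_)
      field_simp
    rw [h3]
    exact (abs_sub _ _).trans (by linarith)
  have h1 := abs_sub_refInterp_le (o := o) hs hK hrk hrf hx
  have h2 := abs_leadCoeff_sub_le hp hgp
  have h3 := abs_leadCoeff_sub_le hq fun x hx => (hFq x hx).1
  have h4 : |defectCoeff M i k g F - r.coeff (k + 1)|
      ≤ defectConst k * (G + B) * M.len i ^ (k + 2) := by
    have := abs_defect_le (k := k) hG0 hB0 h2 h3
    rw [hrc, defectCoeff]
    refine le_of_eq_of_le ?_ this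
    congr 1; ring
  have h5 : |(defectCoeff M i k g F - r.coeff (k + 1)) * (nodalOmit s o).eval x|
      ≤ defectConst k * (G + B) * M.len i ^ (k + 2) * K := by
    rw [abs_mul]
    exact mul_le_mul h4 ((hK.nodalOmit o).eval x hx) (abs_nonneg _)
      ((abs_nonneg _).trans h4)
  have h6 := abs_sub (g (M.toElement i x) - F' (M.toElement i x)
        - (refInterp s o fun x => g (M.toElement i x) - F' (M.toElement i x)).eval x
        - r.coeff (k + 1) * (nodalOmit s o).eval x)
      ((defectCoeff M i k g F - r.coeff (k + 1)) * (nodalOmit s o).eval x)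
  refine le_trans (le_of_eq ?_) (h6.trans ((add_le_add h1 h5).trans (le_of_eq ?_)))
  · congr 1; ring
  · rw [consistencyConst]; ring

theorem hasDerivWithinAt_defectCoeff {g F : ℝ → ℝ → ℝ} {g' F' : ℝ → ℝ} {S : Set ℝ} {t : ℝ}
    (hg : ∀ x ∈ Icc (M.left i) (M.right i), HasDerivWithinAt (fun τ => g τ x) (g' x) S t)
    (hF : ∀ x ∈ Icc (M.left i) (M.right i), HasDerivWithinAt (fun τ => F τ x) (F' x) S t) :
    HasDerivWithinAt (fun τ => defectCoeff M i k (g τ) (F τ)) (defectCoeff M i k g' F') S t :=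
  (hasDerivWithinAt_leadCoeff fun _ hx => hg _ (M.toElement_mem i hx)).sub
    ((hasDerivWithinAt_leadCoeff fun _ hx => hF _ (M.toElement_mem i hx)).const_mul _)

end Defect

/-! ### Elements without a zero of `α` -/

section Omitted

variable {N k : ℕ} {α : ℝ → ℝ} {M : Mesh N} {s : Fin N → Fin (k + 2) → ℝ}

/-- The two families of schemes for which the nodal polynomials have mean zero. -/
def IsSuperconvergent (α : ℝ → ℝ) (M : Mesh N) (s : Fin N → Fin (k + 2) → ℝ) : Prop :=
  IsRSV α M s ∨ (IsLSV s ∧ 2 ≤ k)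

theorem IsSuperconvergent.isAdmissible (hs : IsSuperconvergent α M s) (i : Fin N) :
    IsAdmissible (s i) := by
  rcases hs with hs | hs
  · rcases (hs i).2.2 with h | h
    · exact Or.inr (Or.inr h)
    · exact Or.inr (Or.inl h)
  · exact Or.inl (hs.1 i)

theorem IsSuperconvergent.isPartition (hs : IsSuperconvergent α M s) (i : Fin N) :
    IsPartition (s i) := (hs.isAdmissible i).isPartition

theorem omitted_of_pos {i : Fin N} (hL : 0 < α (M.left i)) (hR : 0 < α (M.right i)) :
    omitted α M k i = 0 := by
  rw [omitted, if_pos ⟨hL.le, hR⟩]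

theorem omitted_of_neg {i : Fin N} (hL : α (M.left i) < 0) (hR : α (M.right i) < 0) :
    omitted α M k i = Fin.last (k + 1) := by
  rw [omitted, if_neg (fun h => (h.1.trans_lt hL).false), if_pos ⟨hL.le, hR⟩]

/-- On an element without a zero of `α`, the omitted point is the inflow end. -/
theorem sign_of_not_hasZero (hα : Continuous α) {i : Fin N} (h : ¬ M.HasZero α i) :
    (0 < α (M.left i) ∧ 0 < α (M.right i)) ∨ (α (M.left i) < 0 ∧ α (M.right i) < 0) := by
  have hlr := (M.left_lt_right i).le
  have hL : α (M.left i) ≠ 0 := fun h0 => h ⟨_, left_mem_Icc.2 hlr, h0⟩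
  have hR : α (M.right i) ≠ 0 := fun h0 => h ⟨_, right_mem_Icc.2 hlr, h0⟩
  rcases hL.lt_or_gt with h1 | h1 <;> rcases hR.lt_or_gt with h2 | h2
  · exact Or.inr ⟨h1, h2⟩
  · obtain ⟨z, hz, hz0⟩ := intermediate_value_Icc hlr hα.continuousOn ⟨h1.le, h2.le⟩
    exact (h ⟨z, hz, hz0⟩).elim
  · obtain ⟨z, hz, hz0⟩ := intermediate_value_Icc' hlr hα.continuousOn ⟨h2.le, h1.le⟩
    exact (h ⟨z, hz, hz0⟩).elim
  · exact Or.inl ⟨h1, h2⟩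

/-- The nodal polynomial has mean zero on an element without a zero of `α`: the interpolation nodes
are Radau points, or Gauss points and an end point, and then `2 ≤ k` is needed. -/
theorem IsSuperconvergent.polyInt_nodalOmit (hk : 1 ≤ k) (hα : Continuous α)
    (hs : IsSuperconvergent α M s) {i : Fin N} (h : ¬ M.HasZero α i) :
    polyInt (nodalOmit (s i) (omitted α M k i)) = 0 := by
  rcases sign_of_not_hasZero hα h with ⟨h1, h2⟩ | ⟨h1, h2⟩
  · rw [omitted_of_pos h1 h2]
    rcases hs with hs | ⟨hs, hk2⟩
    · exact ((hs i).1 h1 h2).polyInt_nodalOmit hk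
    · exact (hs i).polyInt_nodalOmit_zero hk2
  · rw [omitted_of_neg h1 h2]
    rcases hs with hs | ⟨hs, hk2⟩
    · exact ((hs i).2.1 h1 h2).polyInt_nodalOmit hk
    · exact (hs i).polyInt_nodalOmit_last hk2

/-- The outflow end of an element is an interpolation node. -/
theorem last_ne_omitted {i : Fin N} (h : 0 < α (M.right i)) :
    Fin.last (k + 1) ≠ omitted α M k i := by
  rw [omitted]
  split_ifs with h1 h2
  · simp [Fin.ext_iff]
  · exact (h2.2.trans h).false.elim
  · simp [Fin.ext_iff]

theorem zero_ne_omitted (hk : 1 ≤ k) {i : Fin N} (h : α (M.left i) < 0) :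
    (0 : Fin (k + 2)) ≠ omitted α M k i := by
  rw [omitted]
  split_ifs with h1 h2
  · exact (h1.1.trans_lt h).false.elim
  · simp [Fin.ext_iff]
  · simp only [ne_eq, Fin.ext_iff, Fin.val_castSucc, Fin.val_last, Fin.val_zero]
    omega

/-- An interior partition point is omitted only if the element contains a zero of `α`. -/
theorem ne_omitted_of_not_hasZero (hα : Continuous α) {i : Fin N} (h : ¬ M.HasZero α i)
    {j : Fin (k + 2)} (h0 : j ≠ 0) (h1 : j ≠ Fin.last (k + 1)) : j ≠ omitted α M k i := by
  rcases sign_of_not_hasZero hα h with ⟨hL, hR⟩ | ⟨hL, hR⟩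
  · rwa [omitted_of_pos hL hR]
  · rwa [omitted_of_neg hL hR]

end Omitted

/-! ### The correction function -/

section Corrector

variable {N k : ℕ} {α : ℝ → ℝ} {M : Mesh N} {s : Fin N → Fin (k + 2) → ℝ} {L K : ℝ}

/-- The function whose flux balances the nodal polynomial in every control volume, on the elements
where `α` is large compared with the mesh size; it is `0` on the other elements. -/
def corrector (α : ℝ → ℝ) (M : Mesh N) (s : Fin N → Fin (k + 2) → ℝ) (L : ℝ) (i : Fin N) :
    ℝ[X] :=
  if 2 * L * M.size < |α (M.left i)| then
    refInterp (s i) (omitted α M k i) fun x => M.len i / 2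
      * (∫ y in (-1)..x, (nodalOmit (s i) (omitted α M k i)).eval y) / α (M.toElement i x)
  else 0

theorem corrector_of_lt {i : Fin N} (h : 2 * L * M.size < |α (M.left i)|) :
    corrector α M s L i = refInterp (s i) (omitted α M k i) fun x => M.len i / 2
      * (∫ y in (-1)..x, (nodalOmit (s i) (omitted α M k i)).eval y) / α (M.toElement i x) :=
  if_pos h

theorem corrector_of_not_lt {i : Fin N} (h : ¬ 2 * L * M.size < |α (M.left i)|) :
    corrector α M s L i = 0 := if_neg h

theorem natDegree_corrector_le {i : Fin N} (hs : IsPartition (s i)) :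
    (corrector α M s L i).natDegree ≤ k := by
  rw [corrector]
  split_ifs
  · exact natDegree_refInterp_le hs _ _
  · simp

theorem abs_left_le_of_lt [NeZero N] (hL : 0 ≤ L)
    (hLα : ∀ x ∈ Icc 0 (2 * Real.pi), ∀ y ∈ Icc 0 (2 * Real.pi), |α x - α y| ≤ L * |x - y|)
    {i : Fin N} (h : 2 * L * M.size < |α (M.left i)|) {x : ℝ}
    (hx : x ∈ Icc (M.left i) (M.right i)) : |α (M.left i)| / 2 ≤ |α x| := by
  have h1 := hLα _ (M.left_mem i) _ (M.element_subset i hx)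
  have h2 := M.abs_sub_left_le i hx
  rw [abs_sub_comm] at h2
  have h3 := mul_le_mul_of_nonneg_left h2 hL
  have h4 := abs_sub_abs_le_abs_sub (α (M.left i)) (α x)
  linarith

theorem not_hasZero_of_lt [NeZero N] (hL : 0 ≤ L)
    (hLα : ∀ x ∈ Icc 0 (2 * Real.pi), ∀ y ∈ Icc 0 (2 * Real.pi), |α x - α y| ≤ L * |x - y|)
    {i : Fin N} (h : 2 * L * M.size < |α (M.left i)|) : ¬ M.HasZero α i := by
  rintro ⟨z, hz, hz0⟩
  have h1 := abs_left_le_of_lt hL hLα h hz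
  rw [hz0, abs_zero] at h1
  have := M.size_pos
  have : 0 ≤ 2 * L * M.size := by positivity
  linarith

theorem abs_integral_eval_le {p : ℝ[X]} {B : ℝ} (h : ∀ x ∈ Icc (-1 : ℝ) 1, |p.eval x| ≤ B)
    {a b : ℝ} (ha : a ∈ Icc (-1 : ℝ) 1) (hb : b ∈ Icc (-1 : ℝ) 1) :
    |∫ y in a..b, p.eval y| ≤ 2 * B := by
  have hB : 0 ≤ B := (abs_nonneg _).trans (h a ha)
  have h1 := intervalIntegral.norm_integral_le_of_norm_le_const (a := a) (b := b) (f := p.eval)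
    (C := B) fun y hy => h y ((uIcc_subset_Icc ha hb) (uIoc_subset_uIcc hy))
  have h2 : |b - a| ≤ 2 := abs_le.2 ⟨by linarith [ha.2, hb.1], by linarith [ha.1, hb.2]⟩
  rw [mul_comm 2]
  exact h1.trans (mul_le_mul_of_nonneg_left h2 hB)

/-- The correction function is small away from the zeros of `α`. -/
theorem abs_eval_corrector_le [NeZero N] (hL : 0 ≤ L)
    (hLα : ∀ x ∈ Icc 0 (2 * Real.pi), ∀ y ∈ Icc 0 (2 * Real.pi), |α x - α y| ≤ L * |x - y|)
    {i : Fin N} (hs : IsPartition (s i)) (hK : RefBound (s i) K) {x : ℝ}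
    (hx : x ∈ Icc (-1 : ℝ) 1) :
    |(corrector α M s L i).eval x| ≤ 2 * (k + 1) * K ^ 2 * M.damping α L i := by
  have hsz := M.size_pos
  have hK0 : 0 ≤ K := (hK.basisAll 0).nonneg
  by_cases h : 2 * L * M.size < |α (M.left i)|
  · rw [corrector_of_lt h, Mesh.damping, if_pos h]
    have hpos : 0 < |α (M.left i)| := lt_of_le_of_lt (by positivity) h
    have h1 := abs_eval_refInterp_le (o := omitted α M k i) hs hK
      (f := fun x => M.len i / 2
        * (∫ y in (-1)..x, (nodalOmit (s i) (omitted α M k i)).eval y) / α (M.toElement i x))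
      (ε := 2 * K * (M.size / |α (M.left i)|)) (fun y hy => ?_) hx
    · exact h1.trans (le_of_eq (by ring))
    · have h2 := abs_left_le_of_lt hL hLα h (M.toElement_mem i hy)
      have h3 := abs_integral_eval_le (hK.nodalOmit (omitted α M k i)).eval
        (left_mem_Icc.2 (by norm_num)) hy
      rw [abs_div, abs_mul, abs_of_pos (half_pos (M.len_pos i)), div_le_iff₀ (by linarith)]
      calc _ ≤ M.size / 2 * (2 * K) :=
            mul_le_mul (by linarith [M.len_le_size i]) h3 (abs_nonneg _) (by positivity)
        _ = 2 * K * (M.size / |α (M.left i)|) * (|α (M.left i)| / 2) := by field_simp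
        _ ≤ _ := mul_le_mul_of_nonneg_left h2 (by positivity)
  · rw [corrector_of_not_lt h, eval_zero, abs_zero]
    have := M.damping_nonneg α L i
    positivity

/-- The flux of the correction function at the partition points. -/
theorem eval_corrector_mul [NeZero N] (hL : 0 ≤ L)
    (hLα : ∀ x ∈ Icc 0 (2 * Real.pi), ∀ y ∈ Icc 0 (2 * Real.pi), |α x - α y| ≤ L * |x - y|)
    (hs : IsSuperconvergent α M s) {i : Fin N} (h : 2 * L * M.size < |α (M.left i)|)
    {j : Fin (k + 2)} (hj : j ≠ omitted α M k i) :
    α (point M s i j) * (corrector α M s L i).eval (s i j)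
      = M.len i / 2 * ∫ y in (-1)..(s i j), (nodalOmit (s i) (omitted α M k i)).eval y := by
  rw [corrector_of_lt h, eval_refInterp (hs.isPartition i) _ hj, point]
  have h1 := not_hasZero_of_lt hL hLα h
  have h2 : α (M.toElement i (s i j)) ≠ 0 := fun h0 =>
    h1 ⟨_, M.toElement_mem i ((hs.isPartition i).mem_Icc j), h0⟩
  field_simp

theorem eval_corrector_one [NeZero N] (hk : 1 ≤ k) (hα : Continuous α) (hL : 0 ≤ L)
    (hLα : ∀ x ∈ Icc 0 (2 * Real.pi), ∀ y ∈ Icc 0 (2 * Real.pi), |α x - α y| ≤ L * |x - y|)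
    (hs : IsSuperconvergent α M s) {i : Fin N} (hR : 0 < α (M.right i)) :
    (corrector α M s L i).eval 1 = 0 := by
  by_cases h : 2 * L * M.size < |α (M.left i)|
  · have h1 := eval_corrector_mul hL hLα hs h (last_ne_omitted (k := k) hR)
    have hp := hs.isPartition i
    rw [point_last hp, hp.last, ← polyInt_apply,
      hs.polyInt_nodalOmit hk hα (not_hasZero_of_lt hL hLα h), mul_zero] at h1
    exact (mul_eq_zero.1 h1).resolve_left hR.ne'
  · rw [corrector_of_not_lt h, eval_zero]

theorem eval_corrector_neg_one [NeZero N] (hk : 1 ≤ k) (hL : 0 ≤ L)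
    (hLα : ∀ x ∈ Icc 0 (2 * Real.pi), ∀ y ∈ Icc 0 (2 * Real.pi), |α x - α y| ≤ L * |x - y|)
    (hs : IsSuperconvergent α M s) {i : Fin N} (hLe : α (M.left i) ≤ 0) :
    (corrector α M s L i).eval (-1) = 0 := by
  by_cases h : 2 * L * M.size < |α (M.left i)|
  · have hne : α (M.left i) ≠ 0 := by
      intro h0
      have := M.size_pos
      rw [h0, abs_zero] at h
      have : 0 ≤ 2 * L * M.size := by positivity
      linarith
    have h1 := eval_corrector_mul hL hLα hs h
      (zero_ne_omitted hk (lt_of_le_of_ne hLe hne))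
    have hp := hs.isPartition i
    rw [point_zero hp, hp.first, intervalIntegral.integral_same, mul_zero] at h1
    exact (mul_eq_zero.1 h1).resolve_left hne
  · rw [corrector_of_not_lt h, eval_zero]

variable [NeZero N]

/-- The correction function vanishes at the outflow ends, the mean of the nodal polynomial being
zero and its primitive starting at the left end. -/
theorem refUpwind_corrector (hk : 1 ≤ k) (hα : Continuous α) (hα0 : α 0 = α (2 * Real.pi))
    (hL : 0 ≤ L)
    (hLα : ∀ x ∈ Icc 0 (2 * Real.pi), ∀ y ∈ Icc 0 (2 * Real.pi), |α x - α y| ≤ L * |x - y|)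
    (hs : IsSuperconvergent α M s) (c : Fin N → ℝ) (i : Fin N) :
    refUpwind α M (fun i => C (c i) * corrector α M s L i) i = 0 := by
  rw [refUpwind]
  split_ifs with h
  · rw [eval_mul, eval_corrector_one hk hα hL hLα hs h, mul_zero]
  · rw [eval_mul, eval_corrector_neg_one hk hL hLα hs
      (by rw [M.apply_left_add_one hα0]; exact not_lt.1 h), mul_zero]

/-- The fluxes of the correction function form a primitive of the nodal polynomial. -/
theorem refFlux_corrector (hk : 1 ≤ k) (hα : Continuous α) (hα0 : α 0 = α (2 * Real.pi))
    (hL : 0 ≤ L)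
    (hLα : ∀ x ∈ Icc 0 (2 * Real.pi), ∀ y ∈ Icc 0 (2 * Real.pi), |α x - α y| ≤ L * |x - y|)
    (hs : IsSuperconvergent α M s) (c : Fin N → ℝ) {i : Fin N}
    (h : 2 * L * M.size < |α (M.left i)|) (j : Fin (k + 2)) :
    refFlux α M s (fun i => C (c i) * corrector α M s L i) i j
      = M.len i / 2 * c i
        * ∫ y in (-1)..(s i j), (nodalOmit (s i) (omitted α M k i)).eval y := by
  have hp := hs.isPartition i
  by_cases h0 : j = 0
  · rw [h0, refFlux_zero hp, refUpwind_corrector hk hα hα0 hL hLα hs, hp.first]; simp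
  by_cases h1 : j = Fin.last (k + 1)
  · rw [h1, refFlux_last hp, refUpwind_corrector hk hα hα0 hL hLα hs, hp.last, ← polyInt_apply,
      hs.polyInt_nodalOmit hk hα (not_hasZero_of_lt hL hLα h)]; simp
  · rw [refFlux, if_neg h0, if_neg h1, eval_mul, eval_C, mul_left_comm,
      eval_corrector_mul hL hLα hs h
        (ne_omitted_of_not_hasZero hα (not_hasZero_of_lt hL hLα h) h0 h1)]
    ring

theorem refFlux_corrector_of_not_lt (hk : 1 ≤ k) (hα : Continuous α)
    (hα0 : α 0 = α (2 * Real.pi)) (hL : 0 ≤ L)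
    (hLα : ∀ x ∈ Icc 0 (2 * Real.pi), ∀ y ∈ Icc 0 (2 * Real.pi), |α x - α y| ≤ L * |x - y|)
    (hs : IsSuperconvergent α M s) (c : Fin N → ℝ) {i : Fin N}
    (h : ¬ 2 * L * M.size < |α (M.left i)|) (j : Fin (k + 2)) :
    refFlux α M s (fun i => C (c i) * corrector α M s L i) i j = 0 := by
  have hp := hs.isPartition i
  by_cases h0 : j = 0
  · rw [h0, refFlux_zero hp, refUpwind_corrector hk hα hα0 hL hLα hs, mul_zero]
  by_cases h1 : j = Fin.last (k + 1)
  · rw [h1, refFlux_last hp, refUpwind_corrector hk hα hα0 hL hLα hs, mul_zero]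
  · rw [refFlux, if_neg h0, if_neg h1, corrector_of_not_lt h, mul_zero, eval_zero, mul_zero]

end Corrector

/-! ### The error equation -/

theorem JetBound.continuousOn {S : Set ℝ} {n : ℕ} {F : ℝ → ℝ} {Q : ℝ}
    (h : JetBound S (n + 1) F Q) : ContinuousOn F S := by
  obtain ⟨-, F', hF, -⟩ := h
  exact fun x hx => (hF x hx).continuousWithinAt

section Transform

variable {N k : ℕ} {α : ℝ → ℝ} {M : Mesh N} {s : Fin N → Fin (k + 2) → ℝ}

theorem Mesh.integral_toElement (M : Mesh N) (i : Fin N) (f : ℝ → ℝ) (a b : ℝ) :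
    M.len i / 2 * ∫ x in a..b, f (M.toElement i x)
      = ∫ x in (M.toElement i a)..(M.toElement i b), f x := by
  simp only [Mesh.toElement]
  exact intervalIntegral.mul_integral_comp_mul_add _ _

theorem Mesh.toElement_monotone (M : Mesh N) (i : Fin N) : Monotone (M.toElement i) := by
  intro a b h
  have := mul_le_mul_of_nonneg_left h (half_pos (M.len_pos i)).le
  simp only [Mesh.toElement]
  linarith

theorem Mesh.continuous_toElement (M : Mesh N) (i : Fin N) : Continuous (M.toElement i) := by
  unfold Mesh.toElement
  fun_prop

/-- The conservation law of the exact solution. -/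
theorem IsSolution.ref_conservation {n : ℕ} {T G B : ℝ} {g u : ℝ → ℝ → ℝ}
    (hu : IsSolution α g T n u) {t : ℝ} (ht : t ∈ Icc 0 T)
    (hg : JetBound (Icc 0 (2 * Real.pi)) (k + 1) (g t) G)
    (hF : JetBound (Icc 0 (2 * Real.pi)) (k + 1) (fluxDeriv α u t) B) (i : Fin N)
    (hs : IsPartition (s i)) (j : Fin (k + 1)) :
    M.len i / 2 * (∫ x in (s i j.castSucc)..(s i j.succ),
        (g t (M.toElement i x) - fluxDeriv α u t (M.toElement i x)))
      + α (point M s i j.succ) * u t (point M s i j.succ)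
      - α (point M s i j.castSucc) * u t (point M s i j.castSucc)
      = ∫ x in (point M s i j.castSucc)..(point M s i j.succ), g t x := by
  have hle : point M s i j.castSucc ≤ point M s i j.succ :=
    M.toElement_monotone i (hs.strictMono.monotone (Fin.castSucc_lt_succ).le)
  have hsub : Icc (point M s i j.castSucc) (point M s i j.succ) ⊆ Icc 0 (2 * Real.pi) :=
    (Icc_subset_Icc (point_mem hs _).1 (point_mem hs _).2).trans (M.element_subset i)
  have hgi : IntervalIntegrable (g t) volume (point M s i j.castSucc) (point M s i j.succ) := by
    refine ContinuousOn.intervalIntegrable ?_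
    rw [uIcc_of_le hle]
    exact hg.continuousOn.mono hsub
  have hFi : IntervalIntegrable (fluxDeriv α u t) volume (point M s i j.castSucc)
      (point M s i j.succ) := by
    refine ContinuousOn.intervalIntegrable ?_
    rw [uIcc_of_le hle]
    exact hF.continuousOn.mono hsub
  have h1 := intervalIntegral.integral_eq_sub_of_hasDerivAt_of_le hle
    (f := fun y => α y * u t y) (f' := fluxDeriv α u t)
    (fun x hx => ((hu.hasDerivWithinAt_flux ht (hsub hx)).mono hsub).continuousWithinAt)
    (fun x hx => ((hu.hasDerivWithinAt_flux ht (hsub (Ioo_subset_Icc_self hx))).mono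
      hsub).hasDerivAt (Icc_mem_nhds hx.1 hx.2)) hFi
  rw [M.integral_toElement i fun x => g t x - fluxDeriv α u t x]
  change (∫ x in (point M s i j.castSucc)..(point M s i j.succ), (g t x - fluxDeriv α u t x))
    + _ - _ = _
  rw [intervalIntegral.integral_sub hgi hFi, h1]
  ring

variable [NeZero N]

theorem upwind_eq_refUpwind (v : Fin N → ℝ[X]) (i : Fin N) :
    upwind α M v i = refUpwind α M (fun i => (v i).comp (M.affine i)) i := by
  simp only [upwind, refUpwind, M.eval_comp_affine, M.toElement_one, M.toElement_neg_one]

theorem mul_fluxValue_eq_refFlux (v : Fin N → ℝ[X]) (i : Fin N) (j : Fin (k + 2)) :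
    α (point M s i j) * fluxValue α M s v i j
      = refFlux α M s (fun i => (v i).comp (M.affine i)) i j := by
  simp only [fluxValue, refFlux, upwind_eq_refUpwind, M.eval_comp_affine]
  rfl

theorem refUpwind_sub (V W : Fin N → ℝ[X]) (i : Fin N) :
    refUpwind α M (fun i => V i - W i) i = refUpwind α M V i - refUpwind α M W i := by
  simp only [refUpwind, eval_sub]
  split_ifs <;> rfl

theorem refFlux_sub (V W : Fin N → ℝ[X]) (i : Fin N) (j : Fin (k + 2)) :
    refFlux α M s (fun i => V i - W i) i j = refFlux α M s V i j - refFlux α M s W i j := by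
  simp only [refFlux, refUpwind_sub, eval_sub]
  split_ifs <;> ring

/-- The interpolant has the exact flux at the ends of the elements. -/
theorem mul_sub_refUpwind_refInterp (hk : 1 ≤ k) (hα : α 0 = α (2 * Real.pi))
    (hs : ∀ i, IsPartition (s i)) {φ : ℝ → ℝ} (hφ : φ 0 = φ (2 * Real.pi)) (i : Fin N) :
    α (M.right i) * (φ (M.right i) - refUpwind α M
      (fun i => refInterp (s i) (omitted α M k i) fun x => φ (M.toElement i x)) i) = 0 := by
  rw [refUpwind]
  split_ifs with h
  · have h1 := eval_refInterp (hs i) (fun x => φ (M.toElement i x)) (last_ne_omitted (k := k) h)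
    rw [(hs i).last, M.toElement_one] at h1
    rw [h1, sub_self, mul_zero]
  · rcases (not_lt.1 h).eq_or_lt with h0 | h0
    · rw [h0, zero_mul]
    · have h1 := eval_refInterp (hs (i + 1)) (fun x => φ (M.toElement (i + 1) x))
        (zero_ne_omitted (α := α) (M := M) hk (i := i + 1) (by rwa [M.apply_left_add_one hα]))
      rw [(hs (i + 1)).first, M.toElement_neg_one, M.apply_left_add_one hφ] at h1
      rw [h1, sub_self, mul_zero]

/-- The flux of the interpolant differs from the exact flux only in elements with a zero of `α`,
where `α` is small. -/
theorem abs_mul_sub_refFlux_refInterp_le (hk : 1 ≤ k) (hα : Continuous α)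
    (hα0 : α 0 = α (2 * Real.pi)) {L : ℝ} (hL : 0 ≤ L)
    (hLα : ∀ x ∈ Icc 0 (2 * Real.pi), ∀ y ∈ Icc 0 (2 * Real.pi), |α x - α y| ≤ L * |x - y|)
    (hs : ∀ i, IsPartition (s i)) {φ : ℝ → ℝ} (hφ : φ 0 = φ (2 * Real.pi)) (i : Fin N) {ε : ℝ}
    (hε : ∀ x ∈ Icc (-1 : ℝ) 1, |φ (M.toElement i x)
      - (refInterp (s i) (omitted α M k i) fun x => φ (M.toElement i x)).eval x| ≤ ε)
    (j : Fin (k + 2)) :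
    |α (point M s i j) * φ (point M s i j) - refFlux α M s
      (fun i => refInterp (s i) (omitted α M k i) fun x => φ (M.toElement i x)) i j|
      ≤ L * M.len i * ε * (open Classical in if M.HasZero α i then 1 else 0) := by
  classical
  have hlen := M.len_pos i
  have hε0 : 0 ≤ ε := (abs_nonneg _).trans (hε 1 (by norm_num))
  have hnn : 0 ≤ L * M.len i * ε * (if M.HasZero α i then (1 : ℝ) else 0) := by
    split_ifs <;> positivity
  by_cases h0 : j = 0
  · have h1 := mul_sub_refUpwind_refInterp (M := M) hk hα0 hs hφ (i - 1)
    rw [← M.apply_left_add_one hα0, ← M.apply_left_add_one hφ, sub_add_cancel, mul_sub] at h1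
    rw [h0, refFlux_zero (hs i), point_zero (hs i), h1, abs_zero]
    exact hnn
  by_cases h1 : j = Fin.last (k + 1)
  · have h2 := mul_sub_refUpwind_refInterp (M := M) hk hα0 hs hφ i
    rw [mul_sub] at h2
    rw [h1, refFlux_last (hs i), point_last (hs i), h2, abs_zero]
    exact hnn
  rw [refFlux, if_neg h0, if_neg h1, ← mul_sub]
  by_cases hz : M.HasZero α i
  · rw [if_pos hz, mul_one, abs_mul]
    obtain ⟨z, hz, hz0⟩ := hz
    have hp := point_mem (M := M) (s := s) (hs i) j
    have h2 := hLα _ (M.element_subset i hp) _ (M.element_subset i hz)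
    rw [hz0, sub_zero] at h2
    have h3 : |point M s i j - z| ≤ M.len i := by
      rw [Mesh.len, abs_le]; constructor <;> linarith [hp.1, hp.2, hz.1, hz.2]
    exact mul_le_mul (h2.trans (mul_le_mul_of_nonneg_left h3 hL)) (hε _ ((hs i).mem_Icc j))
      (abs_nonneg _) (by positivity)
  · have h2 := eval_refInterp (hs i) (fun x => φ (M.toElement i x))
      (ne_omitted_of_not_hasZero (k := k) hα hz h0 h1)
    rw [h2, point, sub_self, mul_zero, abs_zero]
    exact hnn

end Transform

section Scheme

variable {N k : ℕ} [NeZero N] {α : ℝ → ℝ} {M : Mesh N} {s : Fin N → Fin (k + 2) → ℝ} {T : ℝ}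
  {g : ℝ → ℝ → ℝ} {u₀ : ℝ → ℝ} {uh : ℝ → Fin N → ℝ[X]}

/-- The time derivative of a curve of polynomials of degree at most `k`. -/
def timeDeriv (k : ℕ) (T : ℝ) (p : ℝ → ℝ[X]) (t : ℝ) : ℝ[X] :=
  ∑ n ∈ Finset.range (k + 1), C (derivWithin (fun τ => (p τ).coeff n) (Icc 0 T) t) * X ^ n

theorem natDegree_timeDeriv_le (p : ℝ → ℝ[X]) (t : ℝ) : (timeDeriv k T p t).natDegree ≤ k :=
  natDegree_sum_le_of_forall_le _ _ fun _ hn =>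
    (natDegree_C_mul_X_pow_le _ _).trans (Finset.mem_range_succ_iff.1 hn)

theorem hasDerivWithinAt_timeDeriv {p : ℝ → ℝ[X]} (hp : ∀ t ∈ Icc 0 T, (p t).natDegree ≤ k)
    (hd : ∀ n, DifferentiableOn ℝ (fun t => (p t).coeff n) (Icc 0 T)) {t : ℝ} (ht : t ∈ Icc 0 T)
    (x : ℝ) :
    HasDerivWithinAt (fun τ => (p τ).eval x) ((timeDeriv k T p t).eval x) (Icc 0 T) t := by
  have h : HasDerivWithinAt (fun τ => ∑ n ∈ Finset.range (k + 1), (p τ).coeff n * x ^ n)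
      (∑ n ∈ Finset.range (k + 1), derivWithin (fun τ => (p τ).coeff n) (Icc 0 T) t * x ^ n)
      (Icc 0 T) t :=
    HasDerivWithinAt.fun_sum fun n _ => ((hd n t ht).hasDerivWithinAt).mul_const _
  refine (h.congr (fun τ hτ => eval_eq_sum_range' (Nat.lt_succ_of_le (hp τ hτ)) x)
    (eval_eq_sum_range' (Nat.lt_succ_of_le (hp t ht)) x)).congr_deriv ?_
  rw [timeDeriv, eval_finsetSum]
  exact Finset.sum_congr rfl fun n _ => by simp

/-- The conservation law of the scheme on the reference element. -/
theorem IsSVSolution.ref_conservation (hT : 0 < T) (huh : IsSVSolution α M g T s u₀ uh) {t : ℝ}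
    (ht : t ∈ Icc 0 T) (i : Fin N) (j : Fin (k + 1)) :
    M.len i / 2 * (∫ x in (s i j.castSucc)..(s i j.succ),
        ((timeDeriv k T (fun τ => uh τ i) t).comp (M.affine i)).eval x)
      + refFlux α M s (fun i => (uh t i).comp (M.affine i)) i j.succ
      - refFlux α M s (fun i => (uh t i).comp (M.affine i)) i j.castSucc
      = ∫ x in (point M s i j.castSucc)..(point M s i j.succ), g t x := by
  rw [← huh.conservation t ht i j, mul_fluxValue_eq_refFlux, mul_fluxValue_eq_refFlux]
  congr 2
  simp only [M.eval_comp_affine]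
  rw [M.integral_toElement i fun x => (timeDeriv k T (fun τ => uh τ i) t).eval x]
  refine intervalIntegral.integral_congr fun x _ => ?_
  exact ((hasDerivWithinAt_timeDeriv (fun τ hτ => huh.degree τ hτ i) (huh.differentiable i) ht
    x).derivWithin (uniqueDiffOn_Icc hT t ht)).symm

end Scheme

/-! ### The error estimate on a fixed mesh -/

theorem l2norm_sq_le {p : ℝ[X]} {B : ℝ} (h : ∀ x ∈ Icc (-1 : ℝ) 1, |p.eval x| ≤ B) :
    l2norm p ^ 2 ≤ 2 * B ^ 2 := by
  rw [l2norm_sq]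
  refine (le_abs_self _).trans (abs_polyInt_le fun x hx => ?_)
  rw [eval_mul, abs_mul, pow_two]
  exact mul_le_mul (h x hx) (h x hx) (abs_nonneg _) ((abs_nonneg _).trans (h x hx))

theorem l2norm_add_sq_le (p q : ℝ[X]) :
    l2norm (p + q) ^ 2 ≤ 2 * l2norm p ^ 2 + 2 * l2norm q ^ 2 := by
  have h1 := polyInt_mul_self_nonneg (p - q)
  have h2 : (p + q) * (p + q) + (p - q) * (p - q) = p * p + p * p + (q * q + q * q) := by ring
  have h3 := congrArg polyInt h2
  rw [map_add, map_add, map_add, map_add] at h3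
  simp only [l2norm_sq]
  linarith

/-- The indicator of the elements that contain a zero of `α`. -/
def zeroIndicator {N : ℕ} (α : ℝ → ℝ) (M : Mesh N) (i : Fin N) : ℝ :=
  open Classical in if M.HasZero α i then 1 else 0

theorem zeroIndicator_nonneg {N : ℕ} (α : ℝ → ℝ) (M : Mesh N) (i : Fin N) :
    0 ≤ zeroIndicator α M i := by
  unfold zeroIndicator; split_ifs <;> norm_num

theorem zeroIndicator_sq {N : ℕ} (α : ℝ → ℝ) (M : Mesh N) (i : Fin N) :
    zeroIndicator α M i ^ 2 = zeroIndicator α M i := by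
  unfold zeroIndicator; split_ifs <;> norm_num

/-- A solution and its approximation on a mesh, with the bounds that enter the error estimate:
`A` bounds the solution, `Q i` the derivatives of `α` on the `i`-th element, `G γ A` the source and
its time derivative, `B A` the flux derivative, and `K` the polynomials of the partitions. -/
structure ErrorSetting (k : ℕ) (α : ℝ → ℝ) (g gt u : ℝ → ℝ → ℝ) (T A G B L K γ : ℝ) {N : ℕ}
    [NeZero N] (M : Mesh N) (s : Fin N → Fin (k + 2) → ℝ) (uh : ℝ → Fin N → ℝ[X])
    (Q : Fin N → ℝ) : Prop where
  one_le : 1 ≤ k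
  T_pos : 0 < T
  A_nonneg : 0 ≤ A
  G_nonneg : 0 ≤ G
  B_nonneg : 0 ≤ B
  L_nonneg : 0 ≤ L
  γ_nonneg : 0 ≤ γ
  γ_le_one : γ ≤ 1
  γ_le : ∀ i, γ ≤ Q i
  continuous : Continuous α
  ends : α 0 = α (2 * Real.pi)
  lipschitz : ∀ x ∈ Icc 0 (2 * Real.pi), ∀ y ∈ Icc 0 (2 * Real.pi), |α x - α y| ≤ L * |x - y|
  superconvergent : IsSuperconvergent α M s
  refBound : ∀ i, RefBound (s i) K
  solution : IsSolution α g T (k + 3) u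
  scheme : IsSVSolution α M g T s (u 0) uh
  jet_velocity : ∀ i, JetBound (Icc (M.left i) (M.right i)) (k + 1) α (Q i)
  jet_solution : ∀ t ∈ Icc 0 T, JetBound (Icc 0 (2 * Real.pi)) (k + 2) (u t) A
  jet_flux : ∀ t ∈ Icc 0 T, JetBound (Icc 0 (2 * Real.pi)) (k + 1) (fluxDeriv α u t) (B * A)
  source_deriv : ∀ t ∈ Icc 0 T, ∀ x ∈ Icc 0 (2 * Real.pi),
    HasDerivWithinAt (fun τ => g τ x) (gt t x) (Icc 0 T) t
  jet_source : ∀ t ∈ Icc 0 T, JetBound (Icc 0 (2 * Real.pi)) (k + 1) (g t) (G * γ * A)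
  jet_source_deriv : ∀ t ∈ Icc 0 T, JetBound (Icc 0 (2 * Real.pi)) (k + 1) (gt t) (G * γ * A)

/-- The pull-back of `I_h φ` to the reference element. -/
def refInterpolant {N : ℕ} (k : ℕ) (α : ℝ → ℝ) (M : Mesh N) (s : Fin N → Fin (k + 2) → ℝ)
    (φ : ℝ → ℝ) (i : Fin N) : ℝ[X] :=
  refInterp (s i) (omitted α M k i) fun x => φ (M.toElement i x)

/-- The pull-back of the error `u_h - I_h u` to the reference element. -/
def refError {N : ℕ} (k : ℕ) (α : ℝ → ℝ) (M : Mesh N) (s : Fin N → Fin (k + 2) → ℝ)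
    (v : Fin N → ℝ[X]) (φ : ℝ → ℝ) (i : Fin N) : ℝ[X] :=
  (v i).comp (M.affine i) - refInterpolant k α M s φ i

/-- The coefficient of the correction function at time `t`. -/
def defectAt {N : ℕ} (k : ℕ) (α : ℝ → ℝ) (M : Mesh N) (g u : ℝ → ℝ → ℝ) (t : ℝ) (i : Fin N) : ℝ :=
  defectCoeff M i k (g t) fun x => α x * u t x

/-- The time derivative of `defectAt`. -/
def defectDerivAt {N : ℕ} (k : ℕ) (α : ℝ → ℝ) (M : Mesh N) (g gt u : ℝ → ℝ → ℝ) (t : ℝ)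
    (i : Fin N) : ℝ :=
  defectCoeff M i k (gt t) fun x => α x * (g t x - fluxDeriv α u t x)

/-- The constant in the bounds for the coefficient of the correction function. -/
def correctionConst (k : ℕ) (G B : ℝ) : ℝ := defectConst k * (G + 2 ^ (k + 2) * (1 + G + B))

/-- The constant in the bound for the residual of the corrected error. -/
def residualConst (k : ℕ) (G B L K : ℝ) : ℝ :=
  2 * consistencyConst k K * (G + B) + (2 * K + 4 * (k + 1) * K ^ 2) * correctionConst k G B
    + 4 * L * (1 + (k + 1) * K)

namespace ErrorSetting

variable {k : ℕ} {α : ℝ → ℝ} {g gt u : ℝ → ℝ → ℝ} {T A G B L K γ : ℝ} {N : ℕ} [NeZero N]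
  {M : Mesh N} {s : Fin N → Fin (k + 2) → ℝ} {uh : ℝ → Fin N → ℝ[X]} {Q : Fin N → ℝ}

theorem isPartition (E : ErrorSetting k α g gt u T A G B L K γ M s uh Q) (i : Fin N) :
    IsPartition (s i) := E.superconvergent.isPartition i

theorem K_nonneg (E : ErrorSetting k α g gt u T A G B L K γ M s uh Q) : 0 ≤ K :=
  ((E.refBound 0).basisAll 0).nonneg

theorem Q_nonneg (E : ErrorSetting k α g gt u T A G B L K γ M s uh Q) (i : Fin N) : 0 ≤ Q i :=
  E.γ_nonneg.trans (E.γ_le i)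

theorem correctionConst_nonneg (E : ErrorSetting k α g gt u T A G B L K γ M s uh Q) :
    0 ≤ correctionConst k G B := by
  have := defectConst_nonneg k
  have := E.G_nonneg
  have := E.B_nonneg
  unfold correctionConst
  positivity

/-- By Leibniz' rule for `α u`, the coefficient is controlled by the derivatives of `α`. -/
theorem abs_defectAt_le (E : ErrorSetting k α g gt u T A G B L K γ M s uh Q) {t : ℝ}
    (ht : t ∈ Icc 0 T) (i : Fin N) :
    |defectAt k α M g u t i| ≤ correctionConst k G B * (A * Q i) * M.len i ^ (k + 1) := by
  have hA := E.A_nonneg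
  have hG := E.G_nonneg
  have hB := E.B_nonneg
  have hQ := E.Q_nonneg i
  have hγ := E.γ_nonneg
  have hD := defectConst_nonneg k
  have hlen := (M.len_pos i).le
  have hu := ((E.jet_solution t ht).mono_set (M.element_subset i)).pred (convex_Icc _ _)
  have hF := (E.jet_velocity i).mul (convex_Icc _ _) hQ hA hu
  have hg := ((E.jet_source t ht).mono_set (M.element_subset i)).pred (convex_Icc _ _)
  refine (abs_defectCoeff_le (by positivity) (by positivity) hg hF).trans ?_
  refine mul_le_mul_of_nonneg_right ?_ (pow_nonneg hlen _)
  rw [correctionConst, mul_assoc (defectConst k) (G + _)]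
  refine mul_le_mul_of_nonneg_left ?_ hD
  have h1 : G * γ * A ≤ G * Q i * A := by have := E.γ_le i; gcongr
  have h2 : 0 ≤ 2 ^ (k + 2) * (G + B) * (A * Q i) := by positivity
  calc _ ≤ G * Q i * A + 2 ^ (k + 2) * (Q i * A) := by simpa [add_assoc] using h1
    _ ≤ _ := by linarith

theorem abs_defectDerivAt_le (E : ErrorSetting k α g gt u T A G B L K γ M s uh Q) {t : ℝ}
    (ht : t ∈ Icc 0 T) (i : Fin N) :
    |defectDerivAt k α M g gt u t i| ≤ correctionConst k G B * (A * Q i) * M.len i ^ (k + 1) := by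
  have hA := E.A_nonneg
  have hG := E.G_nonneg
  have hB := E.B_nonneg
  have hQ := E.Q_nonneg i
  have hγ := E.γ_nonneg
  have hD := defectConst_nonneg k
  have hlen := (M.len_pos i).le
  have hut := ((E.jet_source t ht).sub (E.jet_flux t ht)).mono_set (M.element_subset i)
  have hF := (E.jet_velocity i).mul (convex_Icc _ _) hQ (by positivity) hut
  have hg := ((E.jet_source_deriv t ht).mono_set (M.element_subset i)).pred (convex_Icc _ _)
  refine (abs_defectCoeff_le (by positivity) (by positivity) hg hF).trans ?_
  refine mul_le_mul_of_nonneg_right ?_ (pow_nonneg hlen _)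
  rw [correctionConst, mul_assoc (defectConst k) (G + _)]
  refine mul_le_mul_of_nonneg_left ?_ hD
  have h1 : G * γ * A ≤ G * Q i * A := by have := E.γ_le i; gcongr
  have h3 : G * γ * A ≤ G * 1 * A := by have := E.γ_le_one; gcongr
  have h2 : 0 ≤ 2 ^ (k + 2) * 1 * (A * Q i) := by positivity
  calc _ ≤ G * Q i * A + 2 ^ (k + 1 + 1) * (Q i * (G * 1 * A + B * A)) := by gcongr
    _ = G * Q i * A + 2 ^ (k + 2) * (G + B) * (A * Q i) := by ring
    _ ≤ _ := by linarith

theorem hasDerivWithinAt_defectAt (E : ErrorSetting k α g gt u T A G B L K γ M s uh Q) {t : ℝ}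
    (ht : t ∈ Icc 0 T) (i : Fin N) :
    HasDerivWithinAt (fun τ => defectAt k α M g u τ i) (defectDerivAt k α M g gt u t i)
      (Icc 0 T) t :=
  hasDerivWithinAt_defectCoeff (fun x hx => E.source_deriv t ht x (M.element_subset i hx))
    fun x hx => (E.solution.hasDerivWithinAt_time ht (M.element_subset i hx)).const_mul (α x)

/-- The interpolation error has the order `k + 1`. -/
theorem abs_sub_refInterpolant_le (E : ErrorSetting k α g gt u T A G B L K γ M s uh Q) {t : ℝ}
    (ht : t ∈ Icc 0 T) (i : Fin N) {x : ℝ} (hx : x ∈ Icc (-1 : ℝ) 1) :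
    |u t (M.toElement i x) - (refInterpolant k α M s (u t) i).eval x|
      ≤ (1 + (k + 1) * K) * (A * M.len i ^ (k + 1)) := by
  obtain ⟨p, hp, hup⟩ := (((E.jet_solution t ht).mono_set (M.element_subset i)).of_le
    (convex_Icc _ _) (show k ≤ k + 2 by omega)).exists_poly_ref
  have h := abs_sub_refInterp_le (o := omitted α M k i) (E.isPartition i) (E.refBound i)
    (hp.trans (Nat.le_succ k)) hup hx
  rwa [coeff_eq_zero_of_natDegree_lt (by omega), zero_mul, sub_zero] at h

/-- The time derivative of the corrected error, by the equation for `u`. -/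
theorem eval_hasDerivWithinAt (E : ErrorSetting k α g gt u T A G B L K γ M s uh Q) {t : ℝ}
    (ht : t ∈ Icc 0 T) (i : Fin N) (x : ℝ) :
    HasDerivWithinAt (fun τ => (refError k α M s (uh τ) (u τ) i
        - C (defectAt k α M g u τ i) * corrector α M s L i).eval x)
      (((timeDeriv k T (fun τ => uh τ i) t).comp (M.affine i)
        - refInterpolant k α M s (fun x => g t x - fluxDeriv α u t x) i
        - C (defectDerivAt k α M g gt u t i) * corrector α M s L i).eval x) (Icc 0 T) t := by
  have h1 := hasDerivWithinAt_timeDeriv (k := k) (fun τ hτ => E.scheme.degree τ hτ i)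
    (E.scheme.differentiable i) ht (M.toElement i x)
  have h2 : HasDerivWithinAt (fun τ => (refInterpolant k α M s (u τ) i).eval x)
      ((refInterpolant k α M s (fun x => g t x - fluxDeriv α u t x) i).eval x) (Icc 0 T) t := by
    simp only [refInterpolant, refInterp, eval_finsetSum, eval_mul, eval_C]
    exact HasDerivWithinAt.fun_sum fun j _ => (E.solution.hasDerivWithinAt_time ht
      (M.element_subset i (M.toElement_mem i ((E.isPartition i).mem_Icc _)))).mul_const _
  have h3 := (E.hasDerivWithinAt_defectAt ht i).mul_const ((corrector α M s L i).eval x)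
  simp only [refError, eval_sub, eval_mul, eval_C, M.eval_comp_affine]
  exact (h1.sub h2).sub h3

/-- The residual of the corrected error in the control volume equations.  It consists of the
interpolation error of `u_t` without its leading part, the leading part on the elements without
correction, the flux error of the interpolant, and the time derivative of the correction. -/
theorem abs_residual_le (E : ErrorSetting k α g gt u T A G B L K γ M s uh Q) {t : ℝ}
    (ht : t ∈ Icc 0 T) (i : Fin N) (j : Fin (k + 1)) :
    |M.len i / 2 * (∫ x in (s i j.castSucc)..(s i j.succ),
        ((timeDeriv k T (fun τ => uh τ i) t).comp (M.affine i)
          - refInterpolant k α M s (fun x => g t x - fluxDeriv α u t x) i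
          - C (defectDerivAt k α M g gt u t i) * corrector α M s L i).eval x)
      + refFlux α M s (fun i => refError k α M s (uh t) (u t) i
          - C (defectAt k α M g u t i) * corrector α M s L i) i j.succ
      - refFlux α M s (fun i => refError k α M s (uh t) (u t) i
          - C (defectAt k α M g u t i) * corrector α M s L i) i j.castSucc|
      ≤ M.len i / 2 * (residualConst k G B L K * A * M.size ^ (k + 1)
        * (M.size + Q i * M.damping α L i + zeroIndicator α M i)) := by
  have hA := E.A_nonneg
  have hG := E.G_nonneg
  have hB := E.B_nonneg
  have hL := E.L_nonneg
  have hQ := E.Q_nonneg i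
  have hγ := E.γ_nonneg
  have hK := E.K_nonneg
  have hD := E.correctionConst_nonneg
  have hCc := consistencyConst_nonneg k hK
  have hlen := M.len_pos i
  have hsz := M.size_pos
  have hls := M.len_le_size i
  have hd := M.damping_nonneg α L i
  have hz := zeroIndicator_nonneg α M i
  have hs := E.isPartition i
  set o := omitted α M k i with ho
  set a := s i j.castSucc with ha
  set b := s i j.succ with hb
  have ham : a ∈ Icc (-1 : ℝ) 1 := hs.mem_Icc _
  have hbm : b ∈ Icc (-1 : ℝ) 1 := hs.mem_Icc _
  have hab : uIcc a b ⊆ Icc (-1 : ℝ) 1 := uIcc_subset_Icc ham hbm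
  set c := defectAt k α M g u t i with hc
  set c' := defectDerivAt k α M g gt u t i with hc'
  set w := corrector α M s L i with hw
  set nod := nodalOmit (s i) o with hnod
  set f : ℝ → ℝ := fun x => g t (M.toElement i x) - fluxDeriv α u t (M.toElement i x) with hf
  set R := refInterpolant k α M s (fun x => g t x - fluxDeriv α u t x) i with hR
  set P := (timeDeriv k T (fun τ => uh τ i) t).comp (M.affine i) with hP
  have hfc : ContinuousOn f (Icc (-1) 1) := by
    have h1 : MapsTo (M.toElement i) (Icc (-1) 1) (Icc 0 (2 * Real.pi)) := fun x hx =>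
      M.element_subset i (M.toElement_mem i hx)
    exact ((E.jet_source t ht).continuousOn.comp (M.continuous_toElement i).continuousOn h1).sub
      ((E.jet_flux t ht).continuousOn.comp (M.continuous_toElement i).continuousOn h1)
  have hfi : IntervalIntegrable f volume a b := (hfc.mono hab).intervalIntegrable
  have hpi : ∀ p : ℝ[X], IntervalIntegrable (fun x => p.eval x) volume a b := fun p =>
    p.continuous.intervalIntegrable _ _
  -- the two conservation laws
  have h1 := E.scheme.ref_conservation E.T_pos ht i j
  have h2 := E.solution.ref_conservation (M := M) ht (E.jet_source t ht) (E.jet_flux t ht) i hs j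
  rw [← h2] at h1
  set δ : Fin (k + 2) → ℝ := fun l => α (point M s i l) * u t (point M s i l)
    - refFlux α M s (refInterpolant k α M s (u t)) i l with hδ
  set W : Fin (k + 2) → ℝ := fun l =>
    refFlux α M s (fun i => C (defectAt k α M g u t i) * corrector α M s L i) i l with hW
  have hflux : ∀ l, refFlux α M s (fun i => refError k α M s (uh t) (u t) i
      - C (defectAt k α M g u t i) * corrector α M s L i) i l
      = refFlux α M s (fun i => (uh t i).comp (M.affine i)) i l
        - refFlux α M s (refInterpolant k α M s (u t)) i l - W l := fun l => by
    rw [refFlux_sub]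
    exact congrArg (· - W l) (refFlux_sub (fun i => (uh t i).comp (M.affine i))
      (refInterpolant k α M s (u t)) i l)
  have hint1 : ∫ x in a..b, (P - R - C c' * w).eval x
      = (∫ x in a..b, P.eval x) - (∫ x in a..b, R.eval x) - c' * ∫ x in a..b, w.eval x := by
    simp only [eval_sub, eval_mul, eval_C]
    rw [intervalIntegral.integral_sub ((hpi P).sub (hpi R)) ((hpi w).const_mul c'),
      intervalIntegral.integral_sub (hpi P) (hpi R), intervalIntegral.integral_const_mul]
  have hint2 : ∫ x in a..b, (f x - R.eval x - c * nod.eval x)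
      = (∫ x in a..b, f x) - (∫ x in a..b, R.eval x) - c * ∫ x in a..b, nod.eval x := by
    rw [intervalIntegral.integral_sub (hfi.sub (hpi R)) ((hpi nod).const_mul c),
      intervalIntegral.integral_sub hfi (hpi R), intervalIntegral.integral_const_mul]
  -- the four parts of the residual
  have hsplit : M.len i / 2 * (∫ x in a..b, (P - R - C c' * w).eval x)
      + (refFlux α M s (fun i => (uh t i).comp (M.affine i)) i j.succ
        - refFlux α M s (refInterpolant k α M s (u t)) i j.succ - W j.succ)
      - (refFlux α M s (fun i => (uh t i).comp (M.affine i)) i j.castSucc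
        - refFlux α M s (refInterpolant k α M s (u t)) i j.castSucc - W j.castSucc)
      = M.len i / 2 * (∫ x in a..b, (f x - R.eval x - c * nod.eval x))
        + (M.len i / 2 * c * (∫ x in a..b, nod.eval x) - (W j.succ - W j.castSucc))
        + (δ j.succ - δ j.castSucc) - M.len i / 2 * (c' * ∫ x in a..b, w.eval x) := by
    rw [hint1, hint2]
    simp only [hδ]
    linear_combination h1
  rw [hflux, hflux, hsplit]
  have hpow : M.len i ^ (k + 1) ≤ M.size ^ (k + 1) := pow_le_pow_left₀ hlen.le hls _
  have hcb : ∀ y : ℝ, |y| ≤ correctionConst k G B * (A * Q i) * M.len i ^ (k + 1) →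
      |y| ≤ correctionConst k G B * (A * Q i) * M.size ^ (k + 1) := fun y hy =>
    hy.trans (mul_le_mul_of_nonneg_left hpow (by positivity))
  -- consistency
  have hp1 : |M.len i / 2 * (∫ x in a..b, (f x - R.eval x - c * nod.eval x))|
      ≤ M.len i / 2 * (2 * consistencyConst k K * (G + B) * (A * M.size ^ (k + 1) * M.size)) := by
    rw [abs_mul, abs_of_pos (half_pos hlen)]
    refine mul_le_mul_of_nonneg_left ?_ (half_pos hlen).le
    have hb : ∀ x ∈ uIoc a b, ‖f x - R.eval x - c * nod.eval x‖
        ≤ consistencyConst k K * (G + B) * (A * M.size ^ (k + 1) * M.size) := by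
      intro x hx
      have h3 := abs_sub_refInterp_sub_defect_le hs (E.refBound i) o (G := G * γ * A) (B := B * A)
        (by positivity) (by positivity)
        ((E.jet_source t ht).mono_set (M.element_subset i)) (fun x hx =>
          (E.solution.hasDerivWithinAt_flux ht (M.element_subset i hx)).mono (M.element_subset i))
        ((E.jet_flux t ht).mono_set (M.element_subset i)) (hab (uIoc_subset_uIcc hx))
      refine h3.trans ?_
      have h4 : G * γ * A + B * A ≤ (G + B) * A := by
        have : G * γ * A ≤ G * 1 * A := by have := E.γ_le_one; gcongr
        linarith
      calc _ ≤ consistencyConst k K * ((G + B) * A) * M.size ^ (k + 2) := by gcongr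
        _ = _ := by ring
    have h5 := intervalIntegral.norm_integral_le_of_norm_le_const hb
    have h6 : |b - a| ≤ 2 := abs_le.2 ⟨by linarith [ham.2, hbm.1], by linarith [ham.1, hbm.2]⟩
    refine h5.trans ((mul_le_mul_of_nonneg_left h6 (by positivity)).trans (le_of_eq (by ring)))
  -- the nodal polynomial, balanced by the flux of the correction function
  have hp2 : |M.len i / 2 * c * (∫ x in a..b, nod.eval x) - (W j.succ - W j.castSucc)|
      ≤ M.len i / 2 * (2 * K * correctionConst k G B * (A * M.size ^ (k + 1)
        * (Q i * M.damping α L i))) := by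
    by_cases h : 2 * L * M.size < |α (M.left i)|
    · simp only [hW]
      rw [refFlux_corrector E.one_le E.continuous E.ends hL E.lipschitz E.superconvergent _ h,
        refFlux_corrector E.one_le E.continuous E.ends hL E.lipschitz E.superconvergent _ h,
        ← mul_sub, intervalIntegral.integral_interval_sub_left
          ((nodalOmit (s i) o).continuous.intervalIntegrable _ _)
          ((nodalOmit (s i) o).continuous.intervalIntegrable _ _), sub_self, abs_zero]
      positivity
    · simp only [hW]
      rw [refFlux_corrector_of_not_lt E.one_le E.continuous E.ends hL E.lipschitz E.superconvergent
          _ h, refFlux_corrector_of_not_lt E.one_le E.continuous E.ends hL E.lipschitz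
          E.superconvergent _ h, sub_self, sub_zero, Mesh.damping, if_neg h, mul_assoc, abs_mul,
        abs_of_pos (half_pos hlen)]
      refine mul_le_mul_of_nonneg_left ?_ (half_pos hlen).le
      rw [abs_mul]
      have h3 := hcb c (E.abs_defectAt_le ht i)
      have h4 := abs_integral_eval_le ((E.refBound i).nodalOmit o).eval ham hbm
      exact (mul_le_mul h3 h4 (abs_nonneg _) (by positivity)).trans (le_of_eq (by ring))
  -- the flux error of the interpolant
  have hp3 : ∀ l, |δ l| ≤ M.len i / 2 * (2 * L * (1 + (k + 1) * K) * (A * M.size ^ (k + 1)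
      * zeroIndicator α M i)) := by
    intro l
    have h3 := abs_mul_sub_refFlux_refInterp_le E.one_le E.continuous E.ends hL E.lipschitz
      E.isPartition (E.solution.periodic t ht) i (fun x hx => E.abs_sub_refInterpolant_le ht i hx) l
    refine h3.trans ?_
    change _ * zeroIndicator α M i ≤ _
    calc _ ≤ L * M.len i * ((1 + (k + 1) * K) * (A * M.size ^ (k + 1))) * zeroIndicator α M i := by
          gcongr
      _ = _ := by ring
  -- the time derivative of the correction function
  have hp4 : |M.len i / 2 * (c' * ∫ x in a..b, w.eval x)|
      ≤ M.len i / 2 * (4 * (k + 1) * K ^ 2 * correctionConst k G B * (A * M.size ^ (k + 1)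
        * (Q i * M.damping α L i))) := by
    rw [abs_mul, abs_of_pos (half_pos hlen), abs_mul]
    refine mul_le_mul_of_nonneg_left ?_ (half_pos hlen).le
    have h3 := hcb c' (E.abs_defectDerivAt_le ht i)
    have h4 := abs_integral_eval_le (fun x hx =>
      abs_eval_corrector_le (M := M) (s := s) hL E.lipschitz hs (E.refBound i) hx) ham hbm
    exact (mul_le_mul h3 h4 (abs_nonneg _) (by positivity)).trans (le_of_eq (by ring))
  have htri : ∀ x₁ x₂ x₃ x₄ x₅ y₁ y₂ y₃ y₄ : ℝ, |x₁| ≤ y₁ → |x₂| ≤ y₂ → |x₃| ≤ y₃ → |x₄| ≤ y₃ →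
      |x₅| ≤ y₄ → |x₁ + x₂ + (x₃ - x₄) - x₅| ≤ y₁ + y₂ + 2 * y₃ + y₄ := by
    intro x₁ x₂ x₃ x₄ x₅ y₁ y₂ y₃ y₄ g1 g2 g3 g4 g5
    rw [abs_le] at *
    constructor <;> linarith
  refine (htri _ _ _ _ _ _ _ _ _ hp1 hp2 (hp3 _) (hp3 _) hp4).trans ?_
  rw [mul_left_comm 2, ← mul_add, ← mul_add, ← mul_add]
  refine mul_le_mul_of_nonneg_left ?_ (half_pos hlen).le
  set X₁ := A * M.size ^ (k + 1) with hX₁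
  have hX : 0 ≤ X₁ := by positivity
  set a₁ := 2 * consistencyConst k K * (G + B) with ha₁
  set a₂ := (2 * K + 4 * (k + 1) * K ^ 2) * correctionConst k G B with ha₂
  set a₃ := 4 * L * (1 + (k + 1) * K) with ha₃
  set q := Q i * M.damping α L i with hq
  set z := zeroIndicator α M i with hz'
  have e1 : residualConst k G B L K = a₁ + a₂ + a₃ := rfl
  have hq0 : 0 ≤ q := by positivity
  have g1 : 0 ≤ a₁ * X₁ * (q + z) := by positivity
  have g2 : 0 ≤ a₂ * X₁ * (M.size + z) := by positivity
  have g3 : 0 ≤ a₃ * X₁ * (M.size + q) := by positivity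
  rw [e1, mul_assoc (a₁ + a₂ + a₃)]
  have e2 : a₁ * (X₁ * M.size) + 2 * K * correctionConst k G B * (X₁ * q)
      + 2 * (2 * L * (1 + (k + 1) * K) * (X₁ * z))
      + 4 * (k + 1) * K ^ 2 * correctionConst k G B * (X₁ * q)
      = a₁ * X₁ * M.size + a₂ * X₁ * q + a₃ * X₁ * z := by
    rw [ha₂, ha₃]; ring
  linarith

end ErrorSetting

/-! ### The error in terms of the local sizes -/

theorem l2norm_neg (p : ℝ[X]) : l2norm (-p) = l2norm p := by
  rw [l2norm, l2norm, neg_mul_neg]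

/-- The constant in the error estimate on a fixed mesh. -/
def errorConst (k : ℕ) (G B L K c ρ T : ℝ) : ℝ :=
  2 * stabilityConst k K c L ρ T
      * (8 * ((k + 1) * K ^ 2 * correctionConst k G B) ^ 2 + 3 * residualConst k G B L K ^ 2)
    + 16 * ((k + 1) * K ^ 2 * correctionConst k G B) ^ 2

/-- The local size of the squared error, relative to `h ^ (2 * (k + 1))`. -/
def localSize {N : ℕ} (α : ℝ → ℝ) (M : Mesh N) (L : ℝ) (Q : Fin N → ℝ) (i : Fin N) : ℝ :=
  M.size ^ 2 + (Q i * M.damping α L i) ^ 2 + zeroIndicator α M i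

namespace ErrorSetting

variable {k : ℕ} {α : ℝ → ℝ} {g gt u : ℝ → ℝ → ℝ} {T A G B L K γ : ℝ} {N : ℕ} [NeZero N]
  {M : Mesh N} {s : Fin N → Fin (k + 2) → ℝ} {uh : ℝ → Fin N → ℝ[X]} {Q : Fin N → ℝ}

theorem l2norm_correction_sq_le (E : ErrorSetting k α g gt u T A G B L K γ M s uh Q) {t : ℝ}
    (ht : t ∈ Icc 0 T) (i : Fin N) :
    l2norm (C (defectAt k α M g u t i) * corrector α M s L i) ^ 2
      ≤ 8 * ((k + 1) * K ^ 2 * correctionConst k G B) ^ 2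
        * (A ^ 2 * (M.size ^ (k + 1)) ^ 2 * localSize α M L Q i) := by
  have hA := E.A_nonneg
  have hQ := E.Q_nonneg i
  have hK := E.K_nonneg
  have hD := E.correctionConst_nonneg
  have hlen := M.len_pos i
  have hd := M.damping_nonneg α L i
  have hz := zeroIndicator_nonneg α M i
  have h1 : ∀ x ∈ Icc (-1 : ℝ) 1,
      |(C (defectAt k α M g u t i) * corrector α M s L i).eval x|
        ≤ correctionConst k G B * (A * Q i) * M.size ^ (k + 1)
          * (2 * (k + 1) * K ^ 2 * M.damping α L i) := by
    intro x hx
    rw [eval_mul, eval_C, abs_mul]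
    refine mul_le_mul ((E.abs_defectAt_le ht i).trans ?_)
      (abs_eval_corrector_le E.L_nonneg E.lipschitz (E.isPartition i) (E.refBound i) hx)
      (abs_nonneg _) (by have := M.size_pos; positivity)
    exact mul_le_mul_of_nonneg_left (pow_le_pow_left₀ hlen.le (M.len_le_size i) _) (by positivity)
  refine (l2norm_sq_le h1).trans ?_
  have h2 : (Q i * M.damping α L i) ^ 2 ≤ localSize α M L Q i := by
    unfold localSize
    have := sq_nonneg M.size
    linarith
  calc _ = 8 * ((k + 1) * K ^ 2 * correctionConst k G B) ^ 2
        * (A ^ 2 * (M.size ^ (k + 1)) ^ 2 * (Q i * M.damping α L i) ^ 2) := by ring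
    _ ≤ _ := by gcongr

/-- The error estimate on a fixed mesh, by stability applied to the corrected error. -/
theorem sum_l2norm_refError_le (E : ErrorSetting k α g gt u T A G B L K γ M s uh Q) {ρ c : ℝ}
    (hρ : 0 ≤ ρ) (hM : M.IsRegular ρ) (hK : 1 ≤ K)
    (href : ∀ s : Fin (k + 2) → ℝ, IsAdmissible s → RefBound s K) (hc : 0 ≤ c)
    (hcb : ∀ p : ℝ[X], p.natDegree ≤ k → PolyBound (c * l2norm p) p) {t : ℝ} (ht : t ∈ Icc 0 T) :
    ∑ i, M.len i / 2 * l2norm (refError k α M s (uh t) (u t) i) ^ 2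
      ≤ errorConst k G B L K c ρ T * (A ^ 2 * (M.size ^ (k + 1)) ^ 2
        * ∑ i, M.len i * localSize α M L Q i) := by
  have hA := E.A_nonneg
  have hsz := M.size_pos
  have hL := E.L_nonneg
  have hd := fun i => M.damping_nonneg α L i
  have hz := zeroIndicator_nonneg α M
  have hCc := consistencyConst_nonneg k E.K_nonneg
  have hD := E.correctionConst_nonneg
  have hG := E.G_nonneg
  have hB := E.B_nonneg
  have hR : 0 ≤ residualConst k G B L K := by
    have := E.K_nonneg
    unfold residualConst
    positivity
  have hls : ∀ i, 0 ≤ localSize α M L Q i := fun i => by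
    have := hz i
    unfold localSize
    positivity
  have h0T : (0 : ℝ) ∈ Icc 0 T := ⟨le_rfl, E.T_pos.le⟩
  have hsc : IsRSV α M s ∨ IsLSV s := E.superconvergent.imp_right And.left
  choose κ hκ using exists_stableElement E.one_le hK href E.lipschitz hsc
  set R := residualConst k G B L K with hRdef
  set P := M.size ^ (k + 1) with hP
  set w : ℝ → Fin N → ℝ[X] := fun τ i => C (defectAt k α M g u τ i) * corrector α M s L i with hw
  set V : ℝ → Fin N → ℝ[X] := fun τ i => refError k α M s (uh τ) (u τ) i - w τ i with hV
  set β : Fin N → ℝ := fun i => R * A * P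
    * (M.size + Q i * M.damping α L i + zeroIndicator α M i) with hβ
  have hwdeg : ∀ τ i, (w τ i).natDegree ≤ k := fun τ i =>
    (natDegree_C_mul_le _ _).trans (natDegree_corrector_le (E.isPartition i))
  have hstab := sum_l2norm_sq_le (c := c) (T := T) E.ends hL E.lipschitz hρ hM E.K_nonneg hκ hc
    hcb (V := V) (β := β)
    (Vt := fun t i => (timeDeriv k T (fun τ => uh τ i) t).comp (M.affine i)
      - refInterpolant k α M s (fun x => g t x - fluxDeriv α u t x) i
      - C (defectDerivAt k α M g gt u t i) * corrector α M s L i)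
    (fun τ hτ i => (natDegree_sub_le _ _).trans (max_le ((natDegree_sub_le _ _).trans (max_le
      (M.natDegree_comp_affine_le i (E.scheme.degree τ hτ i))
      (natDegree_refInterp_le (E.isPartition i) _ _))) (hwdeg τ i)))
    (fun τ hτ i => (natDegree_sub_le _ _).trans (max_le ((natDegree_sub_le _ _).trans (max_le
      (M.natDegree_comp_affine_le i (natDegree_timeDeriv_le _ _))
      (natDegree_refInterp_le (E.isPartition i) _ _)))
      ((natDegree_C_mul_le _ _).trans (natDegree_corrector_le (E.isPartition i)))))
    (fun τ hτ i x _ => E.eval_hasDerivWithinAt hτ i x)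
    (fun i => by have := E.Q_nonneg i; have := hd i; have := hz i; positivity)
    (fun τ hτ i j => E.abs_residual_le hτ i j) ht
  set SC := stabilityConst k K c L ρ T with hSC
  have hSC0 : 0 ≤ SC := by
    rw [hSC, stabilityConst]
    have := E.K_nonneg
    positivity
  set Y := 8 * ((k + 1) * K ^ 2 * correctionConst k G B) ^ 2 with hY
  have hY0 : 0 ≤ Y := by positivity
  set X := A ^ 2 * P ^ 2 with hX
  have hX0 : 0 ≤ X := by positivity
  set S := ∑ i, M.len i * localSize α M L Q i with hS
  -- sums of bounded quantities
  have hsum : ∀ (f : Fin N → ℝ) (Z : ℝ), 0 ≤ Z → (∀ i, f i ≤ Z * (X * localSize α M L Q i)) →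
      ∑ i, M.len i / 2 * f i ≤ Z * (X * S) := by
    intro f Z hZ hf
    rw [hS, Finset.mul_sum, Finset.mul_sum]
    refine Finset.sum_le_sum fun i _ => ?_
    have h1 := M.len_pos i
    have h2 := hls i
    calc M.len i / 2 * f i ≤ M.len i / 2 * (Z * (X * localSize α M L Q i)) :=
          mul_le_mul_of_nonneg_left (hf i) (half_pos h1).le
      _ ≤ M.len i * (Z * (X * localSize α M L Q i)) :=
          mul_le_mul_of_nonneg_right (by linarith) (by positivity)
      _ = _ := by ring
  have hwsum : ∀ τ ∈ Icc 0 T, ∀ i, l2norm (w τ i) ^ 2 ≤ Y * (X * localSize α M L Q i) :=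
    fun τ hτ i => E.l2norm_correction_sq_le hτ i
  have hV0 : ∀ i, l2norm (V 0 i) ^ 2 ≤ Y * (X * localSize α M L Q i) := by
    intro i
    have : V 0 i = -w 0 i := by
      simp only [hV]
      rw [refError, E.scheme.initial, interp_comp_affine (E.isPartition i), refInterpolant,
        sub_self, zero_sub]
    rw [this, l2norm_neg]
    exact hwsum 0 h0T i
  have hβ2 : ∀ i, β i ^ 2 ≤ 3 * R ^ 2 * (X * localSize α M L Q i) := by
    intro i
    have h1 : (M.size + Q i * M.damping α L i + zeroIndicator α M i) ^ 2
        ≤ 3 * localSize α M L Q i := by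
      unfold localSize
      have h2 := zeroIndicator_sq α M i
      set a := M.size
      set b := Q i * M.damping α L i
      set z := zeroIndicator α M i
      nlinarith [sq_nonneg (a - b), sq_nonneg (b - z), sq_nonneg (a - z)]
    calc β i ^ 2 = R ^ 2 * X * (M.size + Q i * M.damping α L i + zeroIndicator α M i) ^ 2 := by
          rw [hβ, hX]; ring
      _ ≤ R ^ 2 * X * (3 * localSize α M L Q i) := mul_le_mul_of_nonneg_left h1 (by positivity)
      _ = _ := by ring
  have h1 := hsum _ Y hY0 hV0
  have h2 := hsum _ (3 * R ^ 2) (by positivity) hβ2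
  have h3 := hsum _ Y hY0 (hwsum t ht)
  have h4 : ∑ i, M.len i / 2 * l2norm (V t i) ^ 2 ≤ SC * (Y * (X * S) + 3 * R ^ 2 * (X * S)) :=
    hstab.trans (mul_le_mul_of_nonneg_left (add_le_add h1 h2) hSC0)
  calc _ ≤ ∑ i, (2 * (M.len i / 2 * l2norm (V t i) ^ 2)
        + 2 * (M.len i / 2 * l2norm (w t i) ^ 2)) := by
        refine Finset.sum_le_sum fun i _ => ?_
        have h5 := l2norm_add_sq_le (V t i) (w t i)
        have h6 : V t i + w t i = refError k α M s (uh t) (u t) i := sub_add_cancel _ _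
        rw [h6] at h5
        have := mul_le_mul_of_nonneg_left h5 (half_pos (M.len_pos i)).le
        linarith
    _ = 2 * (∑ i, M.len i / 2 * l2norm (V t i) ^ 2)
        + 2 * ∑ i, M.len i / 2 * l2norm (w t i) ^ 2 := by
        rw [Finset.sum_add_distrib, ← Finset.mul_sum, ← Finset.mul_sum]
    _ ≤ 2 * (SC * (Y * (X * S) + 3 * R ^ 2 * (X * S))) + 2 * (Y * (X * S)) := by linarith
    _ = _ := by rw [errorConst]; ring

end ErrorSetting

/-! ### Bounds that are uniform in the mesh and the solution -/

theorem sum_len_mul_zeroIndicator_le {α : ℝ → ℝ}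
    (hfin : {x ∈ Icc 0 (2 * Real.pi) | α x = 0}.Finite) :
    ∃ C, 0 ≤ C ∧ ∀ (N : ℕ) [NeZero N] (M : Mesh N),
      ∑ i, M.len i * zeroIndicator α M i ≤ C * M.size :=
  Mesh.exists_sum_len_hasZero_le hfin

/-- The setting of the error estimate is available with constants that depend neither on the mesh
nor on the solution, and the total size of the error is of the order `h ^ (1 / m')`. -/
theorem exists_errorSetting {k m m' : ℕ} (hk : 1 ≤ k) {T : ℝ} (hT : 0 < T) {α : ℝ → ℝ}
    (hα : ContDiff ℝ ∞ α) (hper : Function.Periodic α (2 * Real.pi)) (hm : HasMaxZeroOrder α m)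
    {g : ℝ → ℝ → ℝ}
    (hg : ContDiffOn ℝ ∞ (fun p : ℝ × ℝ => g p.1 p.2) (Icc 0 T ×ˢ Icc 0 (2 * Real.pi)))
    (hm'_min : (m ≤ k + 3 ∨ ∀ t ∈ Icc 0 T, ∀ x ∈ Icc 0 (2 * Real.pi), g t x = 0) →
      m' = min m (k + 3))
    (hm'_else : ¬ (m ≤ k + 3 ∨ ∀ t ∈ Icc 0 T, ∀ x ∈ Icc 0 (2 * Real.pi), g t x = 0) →
      m' = m) {K : ℝ}
    (href : ∀ s : Fin (k + 2) → ℝ, IsAdmissible s → RefBound s K) :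
    1 ≤ m' ∧ ∃ (gt : ℝ → ℝ → ℝ) (G B L γ D : ℝ), 0 ≤ D ∧
      ∀ (N : ℕ) [NeZero N] (M : Mesh N) (s : Fin N → Fin (k + 2) → ℝ), IsSuperconvergent α M s →
      ∀ u : ℝ → ℝ → ℝ, IsSolution α g T (k + 3) u →
      ∀ uh : ℝ → Fin N → ℝ[X], IsSVSolution α M g T s (u 0) uh →
      ∀ A, 0 ≤ A → sobolevNormOn (k + 3) T u < ENNReal.ofReal A →
      ∃ Q, ErrorSetting k α g gt u T A G B L K γ M s uh Q ∧
        ∑ i, M.len i * localSize α M L Q i ≤ D * M.size ^ (1 / m' : ℝ) := by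
  -- the weight `γ` of the source drops out only for a vanishing source
  obtain ⟨γ, hγ0, hγ1, hγg, hm'1, hcase⟩ : ∃ γ : ℝ, 0 ≤ γ ∧ γ ≤ 1 ∧
      (γ = 1 ∨ ∀ t ∈ Icc 0 T, ∀ x ∈ Icc 0 (2 * Real.pi), g t x = 0) ∧ 1 ≤ m' ∧
      (m ≤ m' ∨ (γ = 0 ∧ m' = k + 3)) := by
    have hmpos := hm.pos
    by_cases h : m ≤ k + 3
    · have h1 := hm'_min (Or.inl h)
      rw [min_eq_left h] at h1
      exact ⟨1, zero_le_one, le_rfl, Or.inl rfl, by omega, Or.inl h1.ge⟩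
    by_cases h0 : ∀ t ∈ Icc 0 T, ∀ x ∈ Icc 0 (2 * Real.pi), g t x = 0
    · have h1 := hm'_min (Or.inr h0)
      rw [min_eq_right (by omega)] at h1
      exact ⟨0, le_rfl, zero_le_one, Or.inr h0, by omega, Or.inr ⟨rfl, h1⟩⟩
    · have h1 := hm'_else (not_or.2 ⟨h, h0⟩)
      exact ⟨1, zero_le_one, le_rfl, Or.inl rfl, by omega, Or.inl h1.ge⟩
  refine ⟨hm'1, ?_⟩
  have hm'R : (1 : ℝ) ≤ m' := by exact_mod_cast hm'1
  set p : ℝ := 1 / m' with hp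
  have hp1 : p ≤ 1 := by rw [hp, div_le_one (by linarith)]; exact hm'R
  obtain ⟨⟨C₀, hC₀, hw⟩, hfin⟩ := exists_weight_bound_and_finite_zeros (k := k) hα hm hm'1 hγ0 hcase
  obtain ⟨L, hL, hαL⟩ := exists_jetBound_of_contDiff 0 hα
  obtain ⟨C₁, L', hC₁, hL', hdamp⟩ := Mesh.exists_sum_damping_le hα hγ0 hL hαL.2
    (show p ≤ 2 by linarith) hC₀ hw
  obtain ⟨C₂, hC₂, hzero⟩ := sum_len_mul_zeroIndicator_le hfin
  obtain ⟨Qα, hQα, hαQ⟩ := exists_jetBound_of_contDiff (k + 2) hα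
  obtain ⟨G, hG, gt, hgt, hsrc⟩ := exists_source_jetBound hα hg hT hγg (k + 1) (k + 1)
  have hpi := Real.two_pi_pos
  set c₁ := (2 * Real.pi) ^ (2 - p) with hc₁
  set c₂ := (2 * Real.pi) ^ (1 - p) with hc₂
  have hc₁0 : 0 ≤ c₁ := Real.rpow_nonneg hpi.le _
  have hc₂0 : 0 ≤ c₂ := Real.rpow_nonneg hpi.le _
  refine ⟨gt, G, 2 ^ (k + 3) * Qα, L, γ, 2 * Real.pi * c₁ + C₁ + C₂ * c₂, by positivity,
    fun N _ M s hs u hu uh huh A hA0 hA => ?_⟩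
  obtain ⟨hq, hsum⟩ := hdamp N M
  have hsz := M.size_pos
  refine ⟨fun i => derivSize α γ k (M.left i) + L' * M.size, ?_, ?_⟩
  · exact
    { one_le := hk
      T_pos := hT
      A_nonneg := hA0
      G_nonneg := hG
      B_nonneg := by positivity
      L_nonneg := by linarith
      γ_nonneg := hγ0
      γ_le_one := hγ1
      γ_le := fun i => by
        have h1 : γ ≤ derivSize α γ k (M.left i) :=
          le_add_of_nonneg_right (Finset.sum_nonneg fun _ _ => abs_nonneg _)
        have h2 : 0 ≤ L' * M.size := by positivity
        linarith
      continuous := hα.continuous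
      ends := Function.Periodic.apply_zero hper
      lipschitz := hαL.2
      superconvergent := hs
      refBound := fun i => href _ (hs.isAdmissible i)
      solution := hu
      scheme := huh
      jet_velocity := fun i => JetBound.of_contDiff (convex_Icc _ _) hα fun x hx l hl =>
        (abs_iteratedDeriv_le_derivSize hγ0 hl x).trans (hq i x hx)
      jet_solution := fun t ht => hu.jetBound hA ht
      jet_flux := fun t ht => hu.jetBound_fluxDeriv hQα hαQ hA0 hA ht
      source_deriv := hgt
      jet_source := fun t ht => (hsrc u A hA0 hu hA t ht).1
      jet_source_deriv := fun t ht => (hsrc u A hA0 hu hA t ht).2 }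
  · have h1 : M.size ^ 2 ≤ c₁ * M.size ^ p := by
      have := rpow_le_const_mul_rpow hsz M.size_le (show p ≤ 2 by linarith)
      rwa [Real.rpow_two] at this
    have h2 : M.size ≤ c₂ * M.size ^ p := by
      have := rpow_le_const_mul_rpow hsz M.size_le hp1
      rwa [Real.rpow_one] at this
    simp only [localSize, mul_add, Finset.sum_add_distrib]
    rw [← Finset.sum_mul, M.sum_len]
    calc _ ≤ 2 * Real.pi * (c₁ * M.size ^ p) + C₁ * M.size ^ p + C₂ * (c₂ * M.size ^ p) :=
          add_le_add (add_le_add (mul_le_mul_of_nonneg_left h1 hpi.le) hsum)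
            ((hzero N M).trans (mul_le_mul_of_nonneg_left h2 hC₂))
      _ = _ := by ring

/-! ### The errors at special points -/

section Mean

variable {N : ℕ} [NeZero N] {M : Mesh N} {ρ : ℝ}

/-- On a regular mesh, mean values over the elements are controlled by weighted sums. -/
theorem mean_le_sum (hM : M.IsRegular ρ) {f : Fin N → ℝ} (hf : ∀ i, 0 ≤ f i) :
    1 / N * ∑ i, f i ≤ ρ * ∑ i, M.len i / 2 * f i := by
  have hN : (0 : ℝ) < N := by exact_mod_cast Nat.pos_of_ne_zero (NeZero.ne N)
  have hsz := M.size_pos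
  have h1 : 2 * Real.pi ≤ N * M.size := by
    rw [← M.sum_len]
    refine (Finset.sum_le_sum fun i _ => M.len_le_size i).trans (le_of_eq ?_)
    simp
  have h2 : 1 / (N : ℝ) ≤ M.size / 2 := by
    rw [div_le_iff₀ hN]
    have := Real.pi_gt_three
    linarith
  rw [Finset.mul_sum, Finset.mul_sum]
  refine Finset.sum_le_sum fun i _ => ?_
  have := hM i
  rw [← mul_assoc]
  exact mul_le_mul_of_nonneg_right (by linarith) (hf i)

theorem sum_len_mul_add_one_le (hM : M.IsRegular ρ) {f : Fin N → ℝ} (hf : ∀ i, 0 ≤ f i) :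
    ∑ i, M.len i / 2 * f (i + 1) ≤ ρ * ∑ i, M.len i / 2 * f i := by
  rw [← sum_add_one fun i => M.len i / 2 * f i, Finset.mul_sum]
  refine Finset.sum_le_sum fun i _ => ?_
  have := (M.len_le_size i).trans (hM (i + 1))
  rw [← mul_assoc]
  exact mul_le_mul_of_nonneg_right (by linarith) (hf _)

end Mean

section Critical

variable {N k : ℕ} {α : ℝ → ℝ} {M : Mesh N} {s : Fin N → Fin (k + 2) → ℝ}

theorem prod_erase_const_mul (j : Fin (k + 1)) (a : ℝ) (f : Fin (k + 1) → ℝ) :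
    ∏ l ∈ Finset.univ.erase j, (a * f l) = a ^ k * ∏ l ∈ Finset.univ.erase j, f l := by
  rw [Finset.prod_mul_distrib, Finset.prod_const]
  simp

/-- The zeros of the derivative of a nodal polynomial lie strictly between the extreme nodes. -/
theorem mem_Ioo_of_derivative_nodal_eq_zero {y : Fin (k + 1) → ℝ} (hy : StrictMono y) {z : ℝ}
    (hz : (derivative (Lagrange.nodal Finset.univ y)).eval z = 0) :
    z ∈ Ioo (y 0) (y (Fin.last k)) := by
  rw [Lagrange.derivative_nodal, eval_finsetSum] at hz
  simp only [Lagrange.eval_nodal] at hz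
  constructor
  · by_contra! h
    have h1 : ∀ j l, l ∈ Finset.univ.erase j → 0 ≤ y l - z := fun j l _ =>
      sub_nonneg.2 (h.trans (hy.monotone (Fin.zero_le _)))
    have h2 : ∀ j, ∏ l ∈ Finset.univ.erase j, (z - y l)
        = (-1) ^ k * ∏ l ∈ Finset.univ.erase j, (y l - z) := by
      intro j
      rw [← prod_erase_const_mul]
      exact Finset.prod_congr rfl fun l _ => by ring
    simp only [h2, ← Finset.mul_sum] at hz
    have h3 := (mul_eq_zero.1 hz).resolve_left (pow_ne_zero _ (by norm_num))
    have h4 := (Finset.sum_eq_zero_iff_of_nonneg fun j _ => Finset.prod_nonneg (h1 j)).1 h3 0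
      (Finset.mem_univ _)
    obtain ⟨l, hl, hl0⟩ := Finset.prod_eq_zero_iff.1 h4
    have h5 : y 0 < y l := hy (Fin.pos_of_ne_zero (Finset.ne_of_mem_erase hl))
    linarith
  · by_contra! h
    have h1 : ∀ j l, l ∈ Finset.univ.erase j → 0 ≤ z - y l := fun j l _ =>
      sub_nonneg.2 ((hy.monotone (Fin.le_last _)).trans h)
    have h4 := (Finset.sum_eq_zero_iff_of_nonneg fun j _ => Finset.prod_nonneg (h1 j)).1 hz
      (Fin.last k) (Finset.mem_univ _)
    obtain ⟨l, hl, hl0⟩ := Finset.prod_eq_zero_iff.1 h4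
    have h5 : y l < y (Fin.last k) := hy (Fin.lt_last_iff_ne_last.2 (Finset.ne_of_mem_erase hl))
    linarith

theorem exists_of_mem_criticalPoints {i : Fin N} (hs : IsPartition (s i)) {z : ℝ}
    (hz : z ∈ criticalPoints α M s i) : ∃ x ∈ Ioo (-1 : ℝ) 1, M.toElement i x = z ∧
      (derivative (nodalOmit (s i) (omitted α M k i))).eval x = 0 := by
  have hH := half_pos (M.len_pos i)
  rw [criticalPoints, Multiset.mem_toFinset] at hz
  have hz0 : (derivative (Lagrange.nodal Finset.univ (interpNode α M s i))).eval z = 0 :=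
    (mem_roots'.1 hz).2
  set x := (z - (M.left i + M.right i) / 2) / (M.len i / 2) with hx
  have hxz : M.toElement i x = z := by
    rw [Mesh.toElement, hx, mul_div_cancel₀ _ hH.ne', sub_add_cancel]
  set y : Fin (k + 1) → ℝ := fun j => s i ((omitted α M k i).succAbove j) with hy
  have hmono : StrictMono y := hs.strictMono.comp (Fin.strictMono_succAbove _)
  have h1 : (derivative (Lagrange.nodal Finset.univ y)).eval x = 0 := by
    rw [Lagrange.derivative_nodal, eval_finsetSum] at hz0 ⊢
    simp only [Lagrange.eval_nodal] at hz0 ⊢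
    have h2 : ∀ j, ∏ l ∈ Finset.univ.erase j, (z - interpNode α M s i l)
        = (M.len i / 2) ^ k * ∏ l ∈ Finset.univ.erase j, (x - y l) := by
      intro j
      rw [← prod_erase_const_mul]
      refine Finset.prod_congr rfl fun l _ => ?_
      rw [← hxz, interpNode, point, Mesh.toElement, Mesh.toElement]
      ring
    simp only [h2, ← Finset.mul_sum] at hz0
    exact (mul_eq_zero.1 hz0).resolve_left (pow_ne_zero _ hH.ne')
  have h2 := mem_Ioo_of_derivative_nodal_eq_zero hmono h1
  exact ⟨x, ⟨(hs.mem_Icc _).1.trans_lt h2.1, h2.2.trans_le (hs.mem_Icc _).2⟩, hxz, h1⟩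

theorem card_criticalPoints_le (i : Fin N) : (criticalPoints α M s i).card ≤ k := by
  refine (Multiset.toFinset_card_le _).trans ((card_roots' _).trans ?_)
  refine (natDegree_derivative_le _).trans ?_
  rw [natDegree_prod_of_monic _ _ fun j _ => monic_X_sub_C _]
  simp

end Critical

theorem eval_sub_eq {N k : ℕ} {α : ℝ → ℝ} {M : Mesh N} {s : Fin N → Fin (k + 2) → ℝ}
    {u : ℝ → ℝ → ℝ} {uh : ℝ → Fin N → ℝ[X]} (t : ℝ) (i : Fin N) (x : ℝ) :
    u t (M.toElement i x) - (uh t i).eval (M.toElement i x)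
      = (u t (M.toElement i x) - (refInterpolant k α M s (u t) i).eval x)
        - (refError k α M s (uh t) (u t) i).eval x := by
  rw [refError, eval_sub, M.eval_comp_affine]
  ring

namespace ErrorSetting

variable {k : ℕ} {α : ℝ → ℝ} {g gt u : ℝ → ℝ → ℝ} {T A G B L K γ : ℝ} {N : ℕ} [NeZero N]
  {M : Mesh N} {s : Fin N → Fin (k + 2) → ℝ} {uh : ℝ → Fin N → ℝ[X]} {Q : Fin N → ℝ}

theorem localSize_nonneg (E : ErrorSetting k α g gt u T A G B L K γ M s uh Q) (i : Fin N) :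
    0 ≤ localSize α M L Q i := by
  have := E.L_nonneg
  have := zeroIndicator_nonneg α M i
  unfold localSize
  positivity

theorem errInterp_sq_eq (E : ErrorSetting k α g gt u T A G B L K γ M s uh Q) (t : ℝ) :
    ∑ i, ∫ x in (M.left i)..(M.right i),
        ((uh t i).eval x - (interp α M s (u t) i).eval x) ^ 2
      = ∑ i, M.len i / 2 * l2norm (refError k α M s (uh t) (u t) i) ^ 2 := by
  refine Finset.sum_congr rfl fun i _ => ?_
  have h := M.integral_toElement i
    (fun x => ((uh t i).eval x - (interp α M s (u t) i).eval x) ^ 2) (-1) 1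
  rw [M.toElement_neg_one, M.toElement_one] at h
  rw [← h, l2norm_sq, polyInt_apply]
  congr 1
  refine intervalIntegral.integral_congr fun x _ => ?_
  rw [eval_mul, refError, refInterpolant, ← interp_comp_affine (E.isPartition i), eval_sub,
    M.eval_comp_affine, M.eval_comp_affine, pow_two]

theorem natDegree_refError_le (E : ErrorSetting k α g gt u T A G B L K γ M s uh Q) {t : ℝ}
    (ht : t ∈ Icc 0 T) (i : Fin N) : (refError k α M s (uh t) (u t) i).natDegree ≤ k :=
  (natDegree_sub_le _ _).trans (max_le (M.natDegree_comp_affine_le i (E.scheme.degree t ht i))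
    (natDegree_refInterp_le (E.isPartition i) _ _))

theorem abs_sub_refInterpolant_le_size (E : ErrorSetting k α g gt u T A G B L K γ M s uh Q)
    {t : ℝ} (ht : t ∈ Icc 0 T) (i : Fin N) {x : ℝ} (hx : x ∈ Icc (-1 : ℝ) 1) :
    |u t (M.toElement i x) - (refInterpolant k α M s (u t) i).eval x|
      ≤ (1 + (k + 1) * K) * (A * M.size ^ (k + 1)) := by
  have hA := E.A_nonneg
  have hK := E.K_nonneg
  have hlen := (M.len_pos i).le
  have := M.len_le_size i
  refine (E.abs_sub_refInterpolant_le ht i hx).trans ?_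
  gcongr

variable {c : ℝ}

/-- The upwind value of the interpolant is exact unless `α` vanishes at the node. -/
theorem abs_sub_upwind_le (E : ErrorSetting k α g gt u T A G B L K γ M s uh Q) (hc : 0 ≤ c)
    (hcb : ∀ p : ℝ[X], p.natDegree ≤ k → PolyBound (c * l2norm p) p) {t : ℝ} (ht : t ∈ Icc 0 T)
    (i : Fin N) :
    |u t (M.right i) - upwind α M (uh t) i|
      ≤ (1 + (k + 1) * K) * (A * M.size ^ (k + 1)) * zeroIndicator α M i
        + c * l2norm (refError k α M s (uh t) (u t) i)
        + c * l2norm (refError k α M s (uh t) (u t) (i + 1)) := by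
  have hA := E.A_nonneg
  have hK := E.K_nonneg
  have hsz := M.size_pos
  have hsplit : u t (M.right i) - upwind α M (uh t) i
      = (u t (M.right i) - refUpwind α M (refInterpolant k α M s (u t)) i)
        - refUpwind α M (refError k α M s (uh t) (u t)) i := by
    have h := refUpwind_sub (α := α) (M := M) (fun i => (uh t i).comp (M.affine i))
      (refInterpolant k α M s (u t)) i
    have h' : refUpwind α M (refError k α M s (uh t) (u t)) i = _ := h
    rw [upwind_eq_refUpwind, h']
    ring
  have h1 : |u t (M.right i) - refUpwind α M (refInterpolant k α M s (u t)) i|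
      ≤ (1 + (k + 1) * K) * (A * M.size ^ (k + 1)) * zeroIndicator α M i := by
    have h2 := mul_sub_refUpwind_refInterp (M := M) E.one_le E.ends E.isPartition
      (E.solution.periodic t ht) i
    rcases mul_eq_zero.1 h2 with h3 | h3
    · have hz : zeroIndicator α M i = 1 :=
        if_pos ⟨_, right_mem_Icc.2 (M.left_lt_right i).le, h3⟩
      rw [hz, mul_one, refUpwind, if_neg (by rw [h3]; exact lt_irrefl _),
        ← M.apply_left_add_one (E.solution.periodic t ht), ← M.toElement_neg_one (i + 1)]
      exact E.abs_sub_refInterpolant_le_size ht (i + 1) (left_mem_Icc.2 (by norm_num))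
    · have h4 : u t (M.right i) - refUpwind α M (refInterpolant k α M s (u t)) i = 0 := h3
      rw [h4, abs_zero]
      have := zeroIndicator_nonneg α M i
      positivity
  have h2 : |refUpwind α M (refError k α M s (uh t) (u t)) i|
      ≤ c * l2norm (refError k α M s (uh t) (u t) i)
        + c * l2norm (refError k α M s (uh t) (u t) (i + 1)) := by
    have h3 : ∀ i, 0 ≤ c * l2norm (refError k α M s (uh t) (u t) i) := fun i =>
      mul_nonneg hc (l2norm_nonneg _)
    rw [refUpwind]
    split_ifs
    · have := (hcb _ (E.natDegree_refError_le ht i)).eval 1 (right_mem_Icc.2 (by norm_num))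
      linarith [h3 (i + 1)]
    · have := (hcb _ (E.natDegree_refError_le ht (i + 1))).eval (-1)
        (left_mem_Icc.2 (by norm_num))
      linarith [h3 i]
  rw [hsplit]
  exact (abs_sub _ _).trans (by linarith)

/-- The mean of the interpolation error has one order more on the elements without a zero of
`α`, since the nodal polynomial has mean zero there. -/
theorem abs_average_le (E : ErrorSetting k α g gt u T A G B L K γ M s uh Q)
    (hcb : ∀ p : ℝ[X], p.natDegree ≤ k → PolyBound (c * l2norm p) p) {t : ℝ} (ht : t ∈ Icc 0 T)
    (i : Fin N) :
    |1 / M.len i * ∫ x in (M.left i)..(M.right i), (u t x - (uh t i).eval x)|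
      ≤ (1 + (k + 1) * K) * (A * M.size ^ (k + 1)) * (M.size + zeroIndicator α M i)
        + c * l2norm (refError k α M s (uh t) (u t) i) := by
  have hA := E.A_nonneg
  have hK := E.K_nonneg
  have hsz := M.size_pos
  have hlen := M.len_pos i
  set e := refError k α M s (uh t) (u t) i with he
  set R := refInterpolant k α M s (u t) i with hR
  set f : ℝ → ℝ := fun x => u t (M.toElement i x) with hf
  have hfc : ContinuousOn f (Icc (-1) 1) :=
    (E.solution.continuousOn t ht).comp (M.continuous_toElement i).continuousOn fun x hx =>
      M.element_subset i (M.toElement_mem i hx)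
  have hfi : IntervalIntegrable f volume (-1) 1 := by
    refine ContinuousOn.intervalIntegrable ?_
    rwa [uIcc_of_le (by norm_num)]
  have hpi : ∀ p : ℝ[X], IntervalIntegrable (fun x => p.eval x) volume (-1) 1 := fun p =>
    p.continuous.intervalIntegrable _ _
  have h1 : 1 / M.len i * ∫ x in (M.left i)..(M.right i), (u t x - (uh t i).eval x)
      = 1 / 2 * (∫ x in (-1 : ℝ)..1, (f x - R.eval x)) - 1 / 2 * polyInt e := by
    have h := M.integral_toElement i (fun x => u t x - (uh t i).eval x) (-1) 1
    rw [M.toElement_neg_one, M.toElement_one] at h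
    rw [← h, polyInt_apply, ← mul_sub, ← intervalIntegral.integral_sub (hfi.sub (hpi R)) (hpi e)]
    have h2 : ∫ x in (-1 : ℝ)..1, (u t (M.toElement i x) - (uh t i).eval (M.toElement i x))
        = ∫ x in (-1 : ℝ)..1, (f x - R.eval x - e.eval x) :=
      intervalIntegral.integral_congr fun x _ => eval_sub_eq t i x
    rw [h2]
    field_simp
  have h2 : |polyInt e| ≤ 2 * (c * l2norm e) :=
    abs_polyInt_le (hcb _ (E.natDegree_refError_le ht i)).eval
  have hbound : ∀ (F : ℝ → ℝ) (ε : ℝ), (∀ x ∈ Icc (-1 : ℝ) 1, |F x| ≤ ε) →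
      |∫ x in (-1 : ℝ)..1, F x| ≤ 2 * ε := by
    intro F ε hF
    have h3 := intervalIntegral.norm_integral_le_of_norm_le_const (a := -1) (b := 1) (f := F)
      (C := ε) fun x hx => hF x (by
        rw [uIoc_of_le (by norm_num)] at hx; exact Ioc_subset_Icc_self hx)
    refine h3.trans (le_of_eq ?_)
    norm_num
    ring
  have h3 : |∫ x in (-1 : ℝ)..1, (f x - R.eval x)|
      ≤ 2 * ((1 + (k + 1) * K) * (A * M.size ^ (k + 1)) * (M.size + zeroIndicator α M i)) := by
    by_cases hz : M.HasZero α i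
    · have hz1 : zeroIndicator α M i = 1 := if_pos hz
      refine (hbound _ _ fun x hx => E.abs_sub_refInterpolant_le_size ht i hx).trans ?_
      rw [hz1]
      refine mul_le_mul_of_nonneg_left (le_mul_of_one_le_right (by positivity) (by linarith))
        (by norm_num)
    · have hz0 : zeroIndicator α M i = 0 := if_neg hz
      obtain ⟨p, hp, hup⟩ := ((E.jet_solution t ht).mono_set (M.element_subset i)).pred
        (convex_Icc _ _) |>.exists_poly_ref
      have h4 := hbound (fun x => f x - R.eval x
        - p.coeff (k + 1) * (nodalOmit (s i) (omitted α M k i)).eval x) _ fun x hx =>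
          abs_sub_refInterp_le (o := omitted α M k i) (E.isPartition i) (E.refBound i) hp hup hx
      rw [intervalIntegral.integral_sub (hfi.sub (hpi R)) ((hpi _).const_mul _),
        intervalIntegral.integral_const_mul, ← polyInt_apply,
        E.superconvergent.polyInt_nodalOmit E.one_le E.continuous hz, mul_zero, sub_zero] at h4
      refine h4.trans ?_
      rw [hz0, add_zero]
      have h5 := pow_le_pow_left₀ hlen.le (M.len_le_size i) (k + 2)
      calc _ ≤ 2 * ((1 + (k + 1) * K) * (A * M.size ^ (k + 2))) := by gcongr
        _ = _ := by ring
  rw [h1]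
  refine (abs_sub _ _).trans ?_
  rw [abs_mul, abs_mul, abs_of_pos (by norm_num : (0 : ℝ) < 1 / 2)]
  linarith

/-- The interpolant is exact at the nodes. -/
theorem sub_node_eq (E : ErrorSetting k α g gt u T A G B L K γ M s uh Q) (t : ℝ) (i : Fin N)
    (j : Fin (k + 1)) :
    u t (interpNode α M s i j) - (uh t i).eval (interpNode α M s i j)
      = -(refError k α M s (uh t) (u t) i).eval (s i ((omitted α M k i).succAbove j)) := by
  have h := eval_sub_eq (k := k) (α := α) (u := u) (M := M) (s := s) (uh := uh) t i
    (s i ((omitted α M k i).succAbove j))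
  rw [refInterpolant, eval_refInterp (E.isPartition i) _ (Fin.succAbove_ne _ j), sub_self,
    zero_sub] at h
  exact h

/-- At the zeros of the derivative of the nodal polynomial, the derivative of the interpolation
error has one order more than elsewhere. -/
theorem abs_deriv_sub_le (E : ErrorSetting k α g gt u T A G B L K γ M s uh Q)
    (hcb : ∀ p : ℝ[X], p.natDegree ≤ k → PolyBound (c * l2norm p) p) {t : ℝ} (ht : t ∈ Icc 0 T)
    (i : Fin N) {z : ℝ} (hz : z ∈ criticalPoints α M s i) :
    |deriv (u t) z - (derivative (uh t i)).eval z|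
      ≤ (1 + 2 * (k + 1) * K) * (A * M.size ^ (k + 1))
        + 2 / M.len i * (c * l2norm (refError k α M s (uh t) (u t) i)) := by
  have hA := E.A_nonneg
  have hK := E.K_nonneg
  have hsz := M.size_pos
  have hlen := M.len_pos i
  obtain ⟨x, hx, rfl, hx0⟩ := exists_of_mem_criticalPoints (E.isPartition i) hz
  have hxI := Ioo_subset_Icc_self hx
  obtain ⟨-, u', hu', hj⟩ := E.jet_solution t ht
  have hmem : M.toElement i x ∈ Ioo (M.left i) (M.right i) := by
    have h1 := mul_pos (half_pos hlen) (sub_pos.2 hx.1)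
    have h2 := mul_pos (half_pos hlen) (sub_pos.2 hx.2)
    have h3 := M.toElement_neg_one i
    have h4 := M.toElement_one i
    rw [Mesh.toElement] at h3 h4 ⊢
    constructor <;> linarith
  have hderiv : deriv (u t) (M.toElement i x) = u' (M.toElement i x) :=
    (((hu' _ (M.element_subset i (Ioo_subset_Icc_self hmem))).mono
      (M.element_subset i)).hasDerivAt (Icc_mem_nhds hmem.1 hmem.2)).deriv
  obtain ⟨p, hp, hup⟩ := JetBound.exists_poly_deriv_ref
    (fun y hy => (hu' y (M.element_subset i hy)).mono (M.element_subset i))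
    ((hj.mono_set (M.element_subset i)).pred (convex_Icc _ _))
  have h1 := abs_deriv_sub_refInterp_le (o := omitted α M k i) (E.isPartition i) (E.refBound i)
    hp (fun y hy => (hup y hy).1) hxI (hup x hxI).2
  rw [hx0, mul_zero, sub_zero] at h1
  set e := refError k α M s (uh t) (u t) i with he
  have h2 : |(derivative e).eval x| ≤ c * l2norm e :=
    (hcb _ (E.natDegree_refError_le ht i)).eval_derivative x hxI
  have h3 : M.len i / 2 * (deriv (u t) (M.toElement i x)
        - (derivative (uh t i)).eval (M.toElement i x))
      = (M.len i / 2 * u' (M.toElement i x)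
          - (derivative (refInterpolant k α M s (u t) i)).eval x) - (derivative e).eval x := by
    rw [hderiv, he, refError, derivative_sub, eval_sub, M.eval_derivative_comp_affine]
    ring
  have h4 : M.len i / 2 * |deriv (u t) (M.toElement i x)
        - (derivative (uh t i)).eval (M.toElement i x)|
      ≤ M.len i / 2 * (A * M.len i ^ (k + 1)) + (k + 1) * K * (A * M.len i ^ (k + 2))
        + c * l2norm e := by
    rw [← abs_of_pos (half_pos hlen), ← abs_mul, abs_of_pos (half_pos hlen), h3]
    exact (abs_sub _ _).trans (add_le_add h1 h2)
  have h5 : A * M.len i ^ (k + 1) ≤ A * M.size ^ (k + 1) :=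
    mul_le_mul_of_nonneg_left (pow_le_pow_left₀ hlen.le (M.len_le_size i) _) hA
  rw [← mul_le_mul_iff_right₀ (half_pos hlen)]
  refine h4.trans ?_
  calc _ = M.len i / 2 * ((1 + 2 * (k + 1) * K) * (A * M.len i ^ (k + 1))) + c * l2norm e := by ring
    _ ≤ M.len i / 2 * ((1 + 2 * (k + 1) * K) * (A * M.size ^ (k + 1))) + c * l2norm e := by gcongr
    _ = _ := by field_simp

end ErrorSetting

namespace ErrorSetting

variable {k : ℕ} {α : ℝ → ℝ} {g gt u : ℝ → ℝ → ℝ} {T A G B L K γ : ℝ} {N : ℕ} [NeZero N]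
  {M : Mesh N} {s : Fin N → Fin (k + 2) → ℝ} {uh : ℝ → Fin N → ℝ[X]} {Q : Fin N → ℝ}
  {c ρ Z Y : ℝ}

theorem mean_upwind_sq_le (E : ErrorSetting k α g gt u T A G B L K γ M s uh Q) (hρ : 0 ≤ ρ)
    (hM : M.IsRegular ρ) (hc : 0 ≤ c)
    (hcb : ∀ p : ℝ[X], p.natDegree ≤ k → PolyBound (c * l2norm p) p) {t : ℝ} (ht : t ∈ Icc 0 T)
    (hZ : ∑ i, M.len i * ((A * M.size ^ (k + 1)) ^ 2 * localSize α M L Q i) ≤ Z)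
    (hY : ∑ i, M.len i / 2 * l2norm (refError k α M s (uh t) (u t) i) ^ 2 ≤ Y) :
    1 / N * ∑ i, (u t (M.right i) - upwind α M (uh t) i) ^ 2
      ≤ 3 * ρ * ((1 + (k + 1) * K) ^ 2 * Z + c ^ 2 * (1 + ρ) * Y) := by
  have hK := E.K_nonneg
  set r : Fin N → ℝ := fun i => l2norm (refError k α M s (uh t) (u t) i) ^ 2 with hr
  set X := (A * M.size ^ (k + 1)) ^ 2 with hX
  have hX0 : 0 ≤ X := sq_nonneg _
  have h1 : ∀ i, (u t (M.right i) - upwind α M (uh t) i) ^ 2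
      ≤ 3 * ((1 + (k + 1) * K) ^ 2 * (X * localSize α M L Q i)
        + c ^ 2 * r i + c ^ 2 * r (i + 1)) := by
    intro i
    have h2 := pow_le_pow_left₀ (abs_nonneg _) (E.abs_sub_upwind_le hc hcb ht i) 2
    rw [sq_abs] at h2
    have h3 : zeroIndicator α M i ^ 2 ≤ localSize α M L Q i := by
      rw [zeroIndicator_sq, localSize]
      have := sq_nonneg M.size
      have := sq_nonneg (Q i * M.damping α L i)
      linarith
    set a := (1 + (k + 1) * K) * (A * M.size ^ (k + 1)) * zeroIndicator α M i with ha
    set b := c * l2norm (refError k α M s (uh t) (u t) i) with hb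
    set d := c * l2norm (refError k α M s (uh t) (u t) (i + 1)) with hd
    have h4 : (a + b + d) ^ 2 ≤ 3 * (a ^ 2 + b ^ 2 + d ^ 2) := by
      nlinarith [sq_nonneg (a - b), sq_nonneg (b - d), sq_nonneg (a - d)]
    have h5 : a ^ 2 ≤ (1 + (k + 1) * K) ^ 2 * (X * localSize α M L Q i) := by
      calc a ^ 2 = (1 + (k + 1) * K) ^ 2 * (X * zeroIndicator α M i ^ 2) := by rw [ha, hX]; ring
        _ ≤ _ := by gcongr
    have h6 : b ^ 2 = c ^ 2 * r i := by rw [hb, hr]; ring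
    have h7 : d ^ 2 = c ^ 2 * r (i + 1) := by rw [hd, hr]; ring
    linarith
  have hlen := fun i => (M.len_pos i).le
  have hr0 : ∀ i, 0 ≤ r i := fun i => sq_nonneg _
  have h8 := sum_len_mul_add_one_le hM hr0
  have h9 : ∑ i, M.len i / 2 * (X * localSize α M L Q i) ≤ Z := by
    refine le_trans (Finset.sum_le_sum fun i _ => ?_) hZ
    have := hlen i
    exact mul_le_mul_of_nonneg_right (by linarith) (mul_nonneg hX0 (E.localSize_nonneg i))
  have h10 : ρ * ∑ i, M.len i / 2 * r i ≤ ρ * Y := mul_le_mul_of_nonneg_left hY hρ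
  refine (mean_le_sum hM fun i => sq_nonneg _).trans ?_
  rw [mul_assoc, mul_left_comm]
  refine mul_le_mul_of_nonneg_left ?_ hρ
  calc _ ≤ ∑ i, (3 * (1 + (k + 1) * K) ^ 2 * (M.len i / 2 * (X * localSize α M L Q i))
        + 3 * c ^ 2 * (M.len i / 2 * r i) + 3 * c ^ 2 * (M.len i / 2 * r (i + 1))) := by
        refine Finset.sum_le_sum fun i _ => ?_
        have := mul_le_mul_of_nonneg_left (h1 i) (half_pos (M.len_pos i)).le
        linarith
    _ = 3 * (1 + (k + 1) * K) ^ 2 * (∑ i, M.len i / 2 * (X * localSize α M L Q i))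
        + 3 * c ^ 2 * (∑ i, M.len i / 2 * r i) + 3 * c ^ 2 * ∑ i, M.len i / 2 * r (i + 1) := by
        simp only [Finset.sum_add_distrib, ← Finset.mul_sum]
    _ ≤ 3 * (1 + (k + 1) * K) ^ 2 * Z + 3 * c ^ 2 * Y + 3 * c ^ 2 * (ρ * Y) := by
        gcongr
        exact h8.trans h10
    _ = _ := by ring

theorem mean_average_sq_le (E : ErrorSetting k α g gt u T A G B L K γ M s uh Q) (hρ : 0 ≤ ρ)
    (hM : M.IsRegular ρ)
    (hcb : ∀ p : ℝ[X], p.natDegree ≤ k → PolyBound (c * l2norm p) p) {t : ℝ} (ht : t ∈ Icc 0 T)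
    (hZ : ∑ i, M.len i * ((A * M.size ^ (k + 1)) ^ 2 * localSize α M L Q i) ≤ Z)
    (hY : ∑ i, M.len i / 2 * l2norm (refError k α M s (uh t) (u t) i) ^ 2 ≤ Y) :
    1 / N * ∑ i, (1 / M.len i * ∫ x in (M.left i)..(M.right i), (u t x - (uh t i).eval x)) ^ 2
      ≤ ρ * (2 * (1 + (k + 1) * K) ^ 2 * Z + 2 * c ^ 2 * Y) := by
  have hK := E.K_nonneg
  set r : Fin N → ℝ := fun i => l2norm (refError k α M s (uh t) (u t) i) ^ 2 with hr
  set X := (A * M.size ^ (k + 1)) ^ 2 with hX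
  have hX0 : 0 ≤ X := sq_nonneg _
  refine (mean_le_sum hM fun i => sq_nonneg _).trans (mul_le_mul_of_nonneg_left ?_ hρ)
  calc _ ≤ ∑ i, (2 * (1 + (k + 1) * K) ^ 2 * (M.len i * (X * localSize α M L Q i))
        + 2 * c ^ 2 * (M.len i / 2 * r i)) := by
        refine Finset.sum_le_sum fun i _ => ?_
        have h2 := pow_le_pow_left₀ (abs_nonneg _) (E.abs_average_le hcb ht i) 2
        rw [sq_abs] at h2
        have h3 : (M.size + zeroIndicator α M i) ^ 2 ≤ 2 * localSize α M L Q i := by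
          have h4 := zeroIndicator_sq α M i
          have := sq_nonneg (Q i * M.damping α L i)
          rw [localSize]
          nlinarith [sq_nonneg (M.size - zeroIndicator α M i)]
        set a := (1 + (k + 1) * K) * (A * M.size ^ (k + 1)) * (M.size + zeroIndicator α M i) with ha
        set b := c * l2norm (refError k α M s (uh t) (u t) i) with hb
        have h5 : (a + b) ^ 2 ≤ 2 * (a ^ 2 + b ^ 2) := by nlinarith [sq_nonneg (a - b)]
        have h6 : a ^ 2 ≤ (1 + (k + 1) * K) ^ 2 * (X * (2 * localSize α M L Q i)) := by
          calc a ^ 2 = (1 + (k + 1) * K) ^ 2 * (X * (M.size + zeroIndicator α M i) ^ 2) := by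
                rw [ha, hX]; ring
            _ ≤ _ := by gcongr
        have h7 : b ^ 2 = c ^ 2 * r i := by rw [hb, hr]; ring
        have h8 := mul_le_mul_of_nonneg_left (h2.trans h5) (half_pos (M.len_pos i)).le
        refine h8.trans ?_
        rw [h7]
        have h9 := mul_le_mul_of_nonneg_left h6 (M.len_pos i).le
        linarith
    _ = 2 * (1 + (k + 1) * K) ^ 2 * (∑ i, M.len i * (X * localSize α M L Q i))
        + 2 * c ^ 2 * (∑ i, M.len i / 2 * r i) := by
        simp only [Finset.sum_add_distrib, ← Finset.mul_sum]
    _ ≤ _ := by gcongr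

theorem mean_nodes_sq_le (E : ErrorSetting k α g gt u T A G B L K γ M s uh Q) (hρ : 0 ≤ ρ)
    (hM : M.IsRegular ρ)
    (hcb : ∀ p : ℝ[X], p.natDegree ≤ k → PolyBound (c * l2norm p) p) {t : ℝ} (ht : t ∈ Icc 0 T)
    (hY : ∑ i, M.len i / 2 * l2norm (refError k α M s (uh t) (u t) i) ^ 2 ≤ Y) :
    1 / N * ∑ i, ∑ j, (u t (interpNode α M s i j) - (uh t i).eval (interpNode α M s i j)) ^ 2
      ≤ ρ * ((k + 1) * c ^ 2 * Y) := by
  refine (mean_le_sum hM fun i => Finset.sum_nonneg fun j _ => sq_nonneg _).trans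
    (mul_le_mul_of_nonneg_left ?_ hρ)
  calc _ ≤ ∑ i, (k + 1) * c ^ 2
        * (M.len i / 2 * l2norm (refError k α M s (uh t) (u t) i) ^ 2) := by
        refine Finset.sum_le_sum fun i _ => ?_
        have h1 : ∀ j, (u t (interpNode α M s i j) - (uh t i).eval (interpNode α M s i j)) ^ 2
            ≤ c ^ 2 * l2norm (refError k α M s (uh t) (u t) i) ^ 2 := by
          intro j
          rw [E.sub_node_eq, neg_sq, ← mul_pow, ← sq_abs]
          exact pow_le_pow_left₀ (abs_nonneg _)
            ((hcb _ (E.natDegree_refError_le ht i)).eval _ ((E.isPartition i).mem_Icc _)) 2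
        have h2 := Finset.sum_le_sum fun j (_ : j ∈ Finset.univ) => h1 j
        rw [Finset.sum_const, Finset.card_univ, Fintype.card_fin, nsmul_eq_mul] at h2
        push_cast at h2
        have := mul_le_mul_of_nonneg_left h2 (half_pos (M.len_pos i)).le
        linarith
    _ ≤ _ := by
        rw [← Finset.mul_sum]
        gcongr

theorem mean_deriv_sq_le (E : ErrorSetting k α g gt u T A G B L K γ M s uh Q) (hρ : 0 ≤ ρ)
    (hM : M.IsRegular ρ)
    (hcb : ∀ p : ℝ[X], p.natDegree ≤ k → PolyBound (c * l2norm p) p) {t : ℝ} (ht : t ∈ Icc 0 T)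
    (hY : ∑ i, M.len i / 2 * l2norm (refError k α M s (uh t) (u t) i) ^ 2 ≤ Y) :
    1 / N * ∑ i, ∑ z ∈ criticalPoints α M s i,
        (deriv (u t) z - (derivative (uh t i)).eval z) ^ 2
      ≤ ρ * k * (2 * Real.pi * (1 + 2 * (k + 1) * K) ^ 2 * (A * M.size ^ (k + 1)) ^ 2
        + 8 * c ^ 2 * ρ ^ 2 / M.size ^ 2 * Y) := by
  have hsz := M.size_pos
  have hK := E.K_nonneg
  set r : Fin N → ℝ := fun i => l2norm (refError k α M s (uh t) (u t) i) ^ 2 with hr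
  have hr0 : ∀ i, 0 ≤ r i := fun i => sq_nonneg _
  set a := (1 + 2 * (k + 1) * K) * (A * M.size ^ (k + 1)) with ha
  rw [mul_assoc]
  refine (mean_le_sum hM fun i => Finset.sum_nonneg fun j _ => sq_nonneg _).trans
    (mul_le_mul_of_nonneg_left ?_ hρ)
  calc _ ≤ ∑ i, (k * a ^ 2 * M.len i
        + k * (8 * c ^ 2 * ρ ^ 2 / M.size ^ 2) * (M.len i / 2 * r i)) := by
        refine Finset.sum_le_sum fun i _ => ?_
        have hlen := M.len_pos i
        have h1 : ∀ z ∈ criticalPoints α M s i, (deriv (u t) z - (derivative (uh t i)).eval z) ^ 2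
            ≤ 2 * a ^ 2 + 8 * c ^ 2 * ρ ^ 2 / M.size ^ 2 * r i := by
          intro z hz
          have h2 := pow_le_pow_left₀ (abs_nonneg _) (E.abs_deriv_sub_le hcb ht i hz) 2
          rw [sq_abs] at h2
          set b := 2 / M.len i * (c * l2norm (refError k α M s (uh t) (u t) i)) with hb
          have h5 : (a + b) ^ 2 ≤ 2 * a ^ 2 + 2 * b ^ 2 := by nlinarith [sq_nonneg (a - b)]
          have h6 : 2 / M.len i ≤ 2 * ρ / M.size := by
            rw [div_le_div_iff₀ hlen hsz]
            have := hM i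
            linarith
          have h7 : b ^ 2 ≤ (2 * ρ / M.size) ^ 2 * (c ^ 2 * r i) := by
            calc b ^ 2 = (2 / M.len i) ^ 2 * (c ^ 2 * r i) := by rw [hb, hr]; ring
              _ ≤ _ := by
                have := hr0 i
                gcongr
          refine (h2.trans h5).trans ?_
          calc 2 * a ^ 2 + 2 * b ^ 2 ≤ 2 * a ^ 2 + 2 * ((2 * ρ / M.size) ^ 2 * (c ^ 2 * r i)) := by
                linarith
            _ = _ := by ring
        have h2 := Finset.sum_le_card_nsmul _ _ _ h1
        rw [nsmul_eq_mul] at h2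
        have hnn : 0 ≤ 2 * a ^ 2 + 8 * c ^ 2 * ρ ^ 2 / M.size ^ 2 * r i := by
          have := hr0 i
          positivity
        have h3 : (((criticalPoints α M s i).card : ℕ) : ℝ) ≤ k := by
          exact_mod_cast card_criticalPoints_le i
        have h4 := mul_le_mul_of_nonneg_left (h2.trans (mul_le_mul_of_nonneg_right h3 hnn))
          (half_pos hlen).le
        linarith
    _ = k * a ^ 2 * (∑ i, M.len i)
        + k * (8 * c ^ 2 * ρ ^ 2 / M.size ^ 2) * ∑ i, M.len i / 2 * r i := by
        simp only [Finset.sum_add_distrib, ← Finset.mul_sum]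
    _ ≤ k * a ^ 2 * (2 * Real.pi) + k * (8 * c ^ 2 * ρ ^ 2 / M.size ^ 2) * Y := by
        rw [M.sum_len]
        gcongr
    _ = _ := by rw [ha]; ring

end ErrorSetting

/-- An estimate by every number above the norm of the solution is an estimate by the norm. -/
theorem le_mul_toReal {a b : ℝ} (hb : 0 < b) {x : ℝ≥0∞} (hx : x ≠ ⊤)
    (h : ∀ A, 0 ≤ A → x < ENNReal.ofReal A → a ≤ b * A) : a ≤ b * x.toReal := by
  rw [← div_le_iff₀' hb]
  refine le_of_forall_gt_imp_ge_of_dense fun A hA => ?_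
  rw [div_le_iff₀' hb]
  have hA0 : 0 ≤ A := ENNReal.toReal_nonneg.trans hA.le
  exact h A hA0 ((ENNReal.lt_ofReal_iff_toReal_lt hx).2 hA)

theorem sqrt_le_sqrt_mul {x c y : ℝ} (hc : 0 ≤ c) (hy : 0 ≤ y) (h : x ≤ c * y ^ 2) :
    √x ≤ √c * y := by
  rw [Real.sqrt_le_iff]
  refine ⟨by positivity, ?_⟩
  rwa [mul_pow, Real.sq_sqrt hc]

end SpectralVolume

end

open SpectralVolume

theorem theorem5p3 (k m m' : ℕ) (hk : 1 ≤ k) (T ρ : ℝ) (hT : 0 < T)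
    (α : ℝ → ℝ) (hα : ContDiff ℝ ∞ α) (hper : Function.Periodic α (2 * Real.pi))
    (hm : SpectralVolume.HasMaxZeroOrder α m)
    (g : ℝ → ℝ → ℝ)
    (hg : ContDiffOn ℝ ∞ (fun p : ℝ × ℝ => g p.1 p.2) (Icc 0 T ×ˢ Icc 0 (2 * Real.pi)))
    -- `m' = min {m, k + 3}`, except for a source term together with a zero of order above `k + 3`
    (hm'_min : (m ≤ k + 3 ∨ ∀ t ∈ Icc 0 T, ∀ x ∈ Icc 0 (2 * Real.pi), g t x = 0) →
      m' = min m (k + 3))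
    (hm'_else : ¬ (m ≤ k + 3 ∨ ∀ t ∈ Icc 0 T, ∀ x ∈ Icc 0 (2 * Real.pi), g t x = 0) →
      m' = m) :
    ∃ C > 0, ∀ (N : ℕ) [NeZero N] (M : SpectralVolume.Mesh N), M.IsRegular ρ →
      ∀ s : Fin N → Fin (k + 2) → ℝ,
        (SpectralVolume.IsRSV α M s ∨ (SpectralVolume.IsLSV s ∧ 2 ≤ k)) →
      ∀ u : ℝ → ℝ → ℝ, SpectralVolume.IsSolution α g T (k + 3) u →
      ∀ uh : ℝ → Fin N → ℝ[X], SpectralVolume.IsSVSolution α M g T s (u 0) uh →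
      ∀ t ∈ Icc 0 T,
        SpectralVolume.errInterp α M s (uh t) (u t)
            ≤ C * M.size ^ ((k : ℝ) + 1 + 1 / (2 * (m' : ℝ)))
              * (SpectralVolume.sobolevNormOn (k + 3) T u).toReal ∧
        SpectralVolume.errUpwind α M (uh t) (u t) + SpectralVolume.errAverage M (uh t) (u t)
            + SpectralVolume.errNodes α M s (uh t) (u t)
            ≤ C * M.size ^ ((k : ℝ) + 1 + 1 / (2 * (m' : ℝ)))
              * (SpectralVolume.sobolevNormOn (k + 3) T u).toReal ∧
        SpectralVolume.errDeriv α M s (uh t) (u t)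
            ≤ C * M.size ^ ((k : ℝ) + 1 / (2 * (m' : ℝ)))
              * (SpectralVolume.sobolevNormOn (k + 3) T u).toReal := by
  obtain ⟨K, hK, href⟩ := exists_uniform_refBound k
  obtain ⟨c, hc, hcb⟩ := exists_polyBound_l2norm k
  obtain ⟨hm'1, gt, G, B, L, γ, D, hD, hset⟩ :=
    exists_errorSetting hk hT hα hper hm hg hm'_min hm'_else href
  have hm'R : (1 : ℝ) ≤ m' := by exact_mod_cast hm'1
  have hc0 : 0 ≤ c := by linarith
  -- no mesh is regular for a negative `ρ`, but the constants have to be nonnegative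
  set ρ' := max ρ 0 with hρ'
  have hρ0 : 0 ≤ ρ' := le_max_right _ _
  set E₀ := |errorConst k G B L K c ρ' T| * D with hE₀
  have hE₀0 : 0 ≤ E₀ := by positivity
  set q : ℝ := 1 / (2 * (m' : ℝ)) with hq
  have hq1 : q ≤ 1 := by rw [hq, div_le_one (by linarith)]; linarith
  -- `h ^ (k + 1) ≤ c₃ * h ^ (k + q)`, as `h ≤ 2 π`
  set c₃ : ℝ := (2 * Real.pi) ^ ((k : ℝ) + 1 - (k + q)) with hc₃
  have hc₃0 : 0 ≤ c₃ := Real.rpow_nonneg Real.two_pi_pos.le _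
  set C₂ := 3 * ρ' * ((1 + (k + 1) * K) ^ 2 * D + c ^ 2 * (1 + ρ') * E₀) with hC₂
  set C₃ := ρ' * (2 * (1 + (k + 1) * K) ^ 2 * D + 2 * c ^ 2 * E₀) with hC₃
  set C₄ := ρ' * ((k + 1) * c ^ 2 * E₀) with hC₄
  set C₅ := ρ' * k * (2 * Real.pi * (1 + 2 * (k + 1) * K) ^ 2 * c₃ ^ 2
    + 8 * c ^ 2 * ρ' ^ 2 * E₀) with hC₅
  have hC₂0 : 0 ≤ C₂ := by positivity
  have hC₃0 : 0 ≤ C₃ := by positivity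
  have hC₄0 : 0 ≤ C₄ := by positivity
  have hC₅0 : 0 ≤ C₅ := by have := Real.pi_pos; positivity
  have hs₁ := Real.sqrt_nonneg E₀
  have hs₂ := Real.sqrt_nonneg C₂
  have hs₃ := Real.sqrt_nonneg C₃
  have hs₄ := Real.sqrt_nonneg C₄
  have hs₅ := Real.sqrt_nonneg C₅
  refine ⟨1 + √E₀ + √C₂ + √C₃ + √C₄ + √C₅, by positivity,
    fun N _ M hM s hs u hu uh huh t ht => ?_⟩
  have hM' : M.IsRegular ρ' := fun i =>
    (hM i).trans (mul_le_mul_of_nonneg_right (le_max_left _ _) (M.len_pos i).le)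
  have hsz := M.size_pos
  set R := M.size ^ ((k : ℝ) + 1 + q) with hR
  set R' := M.size ^ ((k : ℝ) + q) with hR'
  have hR0 : 0 < R := Real.rpow_pos_of_pos hsz _
  have hR'0 : 0 < R' := Real.rpow_pos_of_pos hsz _
  have hRR' : R = M.size * R' := by
    rw [hR, hR', ← Real.rpow_one_add' hsz.le (by positivity)]
    congr 1; ring
  have hR2 : (M.size ^ (k + 1)) ^ 2 * M.size ^ (1 / m' : ℝ) = R ^ 2 := by
    rw [hR, ← Real.rpow_natCast, ← Real.rpow_natCast, ← Real.rpow_natCast, ← Real.rpow_mul hsz.le,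
      ← Real.rpow_mul hsz.le, ← Real.rpow_add hsz]
    congr 1
    rw [hq]
    push_cast
    field_simp
  have hP : M.size ^ (k + 1) ≤ c₃ * R' := by
    have := rpow_le_const_mul_rpow hsz M.size_le (show (k : ℝ) + q ≤ k + 1 by linarith)
    rwa [show (k : ℝ) + 1 = ((k + 1 : ℕ) : ℝ) by push_cast; ring, Real.rpow_natCast,
      show ((k + 1 : ℕ) : ℝ) = (k : ℝ) + 1 by push_cast; ring] at this
  -- the estimates with a bound `A` for the norm of the solution
  have key : ∀ A, 0 ≤ A → sobolevNormOn (k + 3) T u < ENNReal.ofReal A →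
      errInterp α M s (uh t) (u t) ≤ √E₀ * (A * R) ∧
      errUpwind α M (uh t) (u t) ≤ √C₂ * (A * R) ∧
      errAverage M (uh t) (u t) ≤ √C₃ * (A * R) ∧
      errNodes α M s (uh t) (u t) ≤ √C₄ * (A * R) ∧
      errDeriv α M s (uh t) (u t) ≤ √C₅ * (A * R') := by
    intro A hA0 hA
    obtain ⟨Q, E, hsum⟩ := hset N M s hs u hu uh huh A hA0 hA
    have hAR : 0 ≤ A * R := by positivity
    have hAR' : 0 ≤ A * R' := by positivity
    have hsum0 : 0 ≤ ∑ i, M.len i * localSize α M L Q i :=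
      Finset.sum_nonneg fun i _ => mul_nonneg (M.len_pos i).le (E.localSize_nonneg i)
    have hX : A ^ 2 * (M.size ^ (k + 1)) ^ 2 * ∑ i, M.len i * localSize α M L Q i
        ≤ D * (A * R) ^ 2 := by
      calc _ ≤ A ^ 2 * (M.size ^ (k + 1)) ^ 2 * (D * M.size ^ (1 / m' : ℝ)) := by gcongr
        _ = D * (A ^ 2 * ((M.size ^ (k + 1)) ^ 2 * M.size ^ (1 / m' : ℝ))) := by ring
        _ = _ := by rw [hR2]; ring
    have hZ : ∑ i, M.len i * ((A * M.size ^ (k + 1)) ^ 2 * localSize α M L Q i)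
        ≤ D * (A * R) ^ 2 := by
      refine le_of_eq_of_le ?_ hX
      rw [Finset.mul_sum]
      exact Finset.sum_congr rfl fun i _ => by ring
    have hY : ∑ i, M.len i / 2 * l2norm (refError k α M s (uh t) (u t) i) ^ 2
        ≤ E₀ * (A * R) ^ 2 := by
      refine (E.sum_l2norm_refError_le hρ0 hM' hK href hc0 hcb ht).trans ?_
      calc _ ≤ |errorConst k G B L K c ρ' T|
            * (A ^ 2 * (M.size ^ (k + 1)) ^ 2 * ∑ i, M.len i * localSize α M L Q i) :=
            mul_le_mul_of_nonneg_right (le_abs_self _) (by positivity)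
        _ ≤ |errorConst k G B L K c ρ' T| * (D * (A * R) ^ 2) := by gcongr
        _ = _ := by rw [hE₀]; ring
    refine ⟨sqrt_le_sqrt_mul hE₀0 hAR ?_, sqrt_le_sqrt_mul hC₂0 hAR ?_,
      sqrt_le_sqrt_mul hC₃0 hAR ?_, sqrt_le_sqrt_mul hC₄0 hAR ?_,
      sqrt_le_sqrt_mul hC₅0 hAR' ?_⟩
    · rw [E.errInterp_sq_eq]
      exact hY
    · exact (E.mean_upwind_sq_le hρ0 hM' hc0 hcb ht hZ hY).trans (le_of_eq (by rw [hC₂]; ring))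
    · exact (E.mean_average_sq_le hρ0 hM' hcb ht hZ hY).trans (le_of_eq (by rw [hC₃]; ring))
    · exact (E.mean_nodes_sq_le hρ0 hM' hcb ht hY).trans (le_of_eq (by rw [hC₄]; ring))
    · refine (E.mean_deriv_sq_le hρ0 hM' hcb ht hY).trans ?_
      have h1 : 8 * c ^ 2 * ρ' ^ 2 / M.size ^ 2 * (E₀ * (A * R) ^ 2)
          = 8 * c ^ 2 * ρ' ^ 2 * E₀ * (A * R') ^ 2 := by
        rw [hRR']; field_simp
      have h2 : (A * M.size ^ (k + 1)) ^ 2 ≤ c₃ ^ 2 * (A * R') ^ 2 := by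
        calc _ ≤ (A * (c₃ * R')) ^ 2 := by gcongr
          _ = _ := by ring
      have hpi := Real.pi_pos
      rw [h1]
      calc _ ≤ ρ' * k * (2 * Real.pi * (1 + 2 * (k + 1) * K) ^ 2 * (c₃ ^ 2 * (A * R') ^ 2)
            + 8 * c ^ 2 * ρ' ^ 2 * E₀ * (A * R') ^ 2) := by gcongr
        _ = _ := by rw [hC₅]; ring
  have hfin := hu.regular.ne
  have hCpos : 0 < 1 + √E₀ + √C₂ + √C₃ + √C₄ + √C₅ := by positivity
  refine ⟨le_mul_toReal (mul_pos hCpos hR0) hfin fun A hA0 hA => ?_,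
    le_mul_toReal (mul_pos hCpos hR0) hfin fun A hA0 hA => ?_,
    le_mul_toReal (mul_pos hCpos hR'0) hfin fun A hA0 hA => ?_⟩
  · obtain ⟨h1, -⟩ := key A hA0 hA
    have h6 : √E₀ * (A * R) ≤ (1 + √E₀ + √C₂ + √C₃ + √C₄ + √C₅) * (A * R) :=
      mul_le_mul_of_nonneg_right (by linarith) (by positivity)
    linarith
  · obtain ⟨-, h2, h3, h4, -⟩ := key A hA0 hA
    have h5 : (√C₂ + √C₃ + √C₄) * (A * R) ≤ (1 + √E₀ + √C₂ + √C₃ + √C₄ + √C₅) * (A * R) :=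
      mul_le_mul_of_nonneg_right (by linarith) (by positivity)
    linarith
  · obtain ⟨-, -, -, -, h5⟩ := key A hA0 hA
    have h6 : √C₅ * (A * R') ≤ (1 + √E₀ + √C₂ + √C₃ + √C₄ + √C₅) * (A * R') :=
      mul_le_mul_of_nonneg_right (by linarith) (by positivity)
    linarith
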